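/- Let $0<k<1$, $l_0=[-1,-k]$, $l_1=[k,1]$ (each slit with an upper bank $l_j^+$ and a lower bank $l_j^-$), let $\mathcal D$ be the exterior of $l_0\cup l_1$ in the extended plane, and $\zeta_\infty\in(-k,k)$. Let $\mu,\mu_0,\mu_1>0$ with $\mu_j\ne\mu$, $\kappa_j=\mu_j/\mu$, $\lambda_j=\mu_j/(1-\kappa_j)$, $\tilde\lambda_j=\kappa_j/(1-\kappa_j)$, $\tau,\tau^\infty,c_{-1}\in\mathbb C$ with $\tau\neq0$, $c_{-1}\ne0$, $c=\frac{\bar\tau^\infty-\bar\tau}{\mu}c_{-1}$, and let $a_j,d_j'$ be real ($j=0,1$). Consider the Schwarz problems for functions $F$, $\omega$ analytic in $\mathcal D\setminus\{\zeta_\infty\}$ (including $\infty$) and continuous up to the slits, such that $F_0=F-\frac{c}{\zeta-\zeta_\infty}$ and $\omega_0=\omega-\frac{c_{-1}}{\zeta-\zeta_\infty}$ have removable singularities at $\zeta_\infty$: $$\text{(I)}\ \ \operatorname{Im}F=a_j\ \text{ on } l_j,\qquad\qquad \text{(II)}\ \ \operatorname{Re}[\bar\tau\omega]=\lambda_j(\operatorname{Re}F-d_j')\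 \text{ on } l_j .$$ Let $q$ be the branch of $\sqrt{(\zeta^2-1)(\zeta^2-k^2)}$ in $\mathcal D$ with $q\sim\zeta^2$ at $\infty$, and $\mathcal R$ the elliptic surface $u^2=(\zeta^2-1)(\zeta^2-k^2)$ with sheets $\mathbb C_1:u=q(\zeta)$ and $\mathbb C_2:u=-q(\zeta)$, glued along the loops $l_0,l_1$; write $(\xi,v)$ for a point of a loop, so that $v=q(\xi\pm i0)$ at $\xi\pm i0\in l_j^\pm$, and orient each loop to the right along the upper bank and back along the lower one. Put $$A_j(\xi)=a_j-\operatorname{Im}\frac{c}{\xi-\zeta_\infty},\qquad g_1(\xi)=\frac{|q(\xi)|}{\pi}\sum_{j=0}^1(-1)^j\ \mathrm{p.v.}\!\int_{l_j^+}\frac{A_j(\eta)\,d\eta}{|q(\eta)|(\eta-\xi)},$$ $$g_{0}(\xi)=g_{0,j}(\xi)=\operatorname{Re}\Big[\frac{c_{-1}}{\xi-\zeta_\infty}\Big(\frac{\bar\tau^\infty}{\mu}-\frac{\bar\tau}{\mu_j}\Big)\Big]\ \ (\xi\in l_j).$$ All integrals below exist (those with a singular Cauchy kernel as principal values). For a real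 density $h$ on the loops, the Riemann–Hilbert problem with density $h$ asks for a function $\Phi$, analytic on the two sheets off the loops, continuous up to the loops, symmetric in the sense that $\overline{\Phi(\bar\zeta,-\bar u)}=\Phi(\zeta,u)$, with $\Phi^+-\Phi^-=2ih$ on $l_0\cup l_1$, where $\Phi^+$, $\Phi^-$ are the limits from $\mathbb C_1$, $\mathbb C_2$. Then: 1. *First problem.* $F$ solves (I) if and only if the function $\Phi_1$ on $\mathcal R$ equal to $F_0(\zeta)$ on $\mathbb C_1$ and to $\overline{F_0(\bar\zeta)}$ on $\mathbb C_2$ solves the Riemann–Hilbert problem with density $A_j$ on $l_j$ and is bounded at the two infinite points. The general solution of that Riemann–Hilbert problem with at most simple poles at the infinite points is $$\Phi_1=\beta_0+\beta_1\zeta+\frac1{2\pi}\sum_{j}\int_{l_j}A_j(\xi)\Big(1+\frac uv\Big)\frac{d\xi}{\xi-\zeta},\qquad\beta_0,\beta_1\in\mathbb R,$$ and it is bounded at the infinite points if and only if $\beta_1=0$ and $$a_0-a_1=\Big(\int_k^1\frac{d\xi}{|q(\xi)|}\Big)^{-1}\Big(\int_{-1}^{-k}-\int_k^1\Big)\operatorname{Im}\Big(\frac{c}{\xi-\zeta_\infty}\Big)\frac{d\xi}{|q(\xi)|}.\tag{4.10}$$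 Thus $F$ solves (I) if and only if (4.10) holds and, for some $\beta_0\in\mathbb R$, $F(\zeta)=\beta_0+\frac{c}{\zeta-\zeta_\infty}+\frac{q(\zeta)}{2\pi}\sum_j\int_{l_j}\frac{A_j(\eta)\,d\eta}{(\eta-\zeta)v}$. On the banks $F_0(\xi\pm i0)=\beta_0\pm(-1)^jg_1(\xi)+iA_j(\xi)$, $\xi\pm i0\in l_j^\pm$. 2. *Second problem.* Let $F$ be a solution of (I) with constant $\beta_0$, $\rho_j'=\beta_0-d_j'$, $\rho_j=\lambda_j\rho_j'$, and $G_j=\lambda_j[g_{0,j}\pm(-1)^jg_1]$ on $l_j^\pm$. Then $\omega$ solves (II) if and only if the function $\Phi_2$ equal to $i\bar\tau\omega_0(\zeta)$ on $\mathbb C_1$ and to $-i\tau\overline{\omega_0(\bar\zeta)}$ on $\mathbb C_2$ solves the Riemann–Hilbert problem with density $G_j+\rho_j$ on $l_j$ and is bounded at the infinite points. The general solution of that Riemann–Hilbert problem with at most simple poles at the infinite points is $$\Phi_2=\gamma_0+\gamma_1\zeta+\frac1{2\pi}\sum_j\int_{l_j}[G_j(\eta)+\rho_j]\Big(1+\frac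 uv\Big)\frac{d\eta}{\eta-\zeta},\qquad\gamma_0,\gamma_1\in\mathbb R,$$ and it is bounded at the infinite points if and only if $\gamma_1=0$ and $$\rho_0-\rho_1=-\Big(\int_k^1\frac{d\xi}{|q(\xi)|}\Big)^{-1}\Big(\lambda_0\int_{-1}^{-k}\frac{g_{0,0}(\xi)\,d\xi}{|q(\xi)|}-\lambda_1\int_k^1\frac{g_{0,1}(\xi)\,d\xi}{|q(\xi)|}\Big).\tag{4.27}$$ Thus $\omega$ solves (II) if and only if (4.27) holds and, for a constant $\gamma'=-i\gamma_0/\bar\tau$ with $\gamma_0\in\mathbb R$, $$\omega(\zeta)=\gamma'+\frac{c_{-1}}{\zeta-\zeta_\infty}-\frac{i}{\pi\bar\tau}\sum_{j}(-1)^j\lambda_j\int_{l_j^+}\Big\{g_1(\eta)+\frac{iq(\zeta)}{|q(\eta)|}[g_{0,j}(\eta)+\rho_j']\Big\}\frac{d\eta}{\eta-\zeta}.\tag{4.30}$$ If (4.27) holds, then for an arbitrary complex $\gamma'$ the function (4.30) solves (II) with $d_j'$ replaced by $d_j'-\lambda_j^{-1}\operatorname{Re}[\bar\tau\gamma']$.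 3. *Profiles.* If (4.10) and (4.27) hold and $\omega$ is given by (4.30) with $\gamma'\in\mathbb C$, then for $m=0,1$ and $\xi$ in the interior of $l_m$ $$\omega(\xi\pm i0)=\gamma'+\frac{c_{-1}}{\xi-\zeta_\infty}-\frac{i\mu}{\pi\bar\tau}\Big\{\sum_{j}(-1)^j\tilde\lambda_j\ \mathrm{p.v.}\!\int_{l_j^+}\Big[g_1(\eta)\pm(-1)^m\frac{|q(\xi)|}{|q(\eta)|}(g_{0,j}(\eta)+\rho_j')\Big]\frac{d\eta}{\eta-\xi}+\pi i\tilde\lambda_m\big[g_{0,m}(\xi)+\rho_m'\pm(-1)^mg_1(\xi)\big]\Big\}.\tag{4.31}$$ The contour $L_m=\omega(l_m)$ of the boundary values of $\omega$ on the two banks of $l_m$ is the closure of the set of points (4.31); and if $\omega$ is univalent in $\mathcal D$, then the boundary in $\mathbb C$ of the image domain $\omega(\mathcal D)$ is $L_0\cup L_1$. -/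

import Mathlib

open Complex Filter Topology MeasureTheory Set Asymptotics
open scoped ComplexConjugate

noncomputable section

namespace TwoSlits

/-! ### The slit domain and its banks -/

/-- The two slits, as subsets of the real line: `[-1, -k]` and `[k, 1]`. -/
def slit (k : ℝ) (j : Fin 2) : Set ℝ := if j = 0 then Icc (-1) (-k) else Icc k 1

/-- The slits without their tips. -/
def openSlit (k : ℝ) (j : Fin 2) : Set ℝ := if j = 0 then Ioo (-1) (-k) else Ioo k 1

/-- The finite part of the exterior of the two slits; the point `∞` is handled through limits along
`cocompact ℂ`. -/
def slitDomain (k : ℝ) : Set ℂ := (⋃ j : Fin 2, (fun x : ℝ => (x : ℂ)) '' slit k j)ᶜ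

/-- The two banks (upper, lower) of a slit. -/
inductive Bank : Type
  | upper : Bank
  | lower : Bank

/-- The sign `±` attached to a bank. -/
def Bank.sgn : Bank → ℝ
  | Bank.upper => 1
  | Bank.lower => -1

/-- The sign `(-1)^j`. -/
def sg (j : Fin 2) : ℝ := (-1) ^ (j : ℕ)

/-- `ζ → ξ ± i0`: approach to the real point `ξ` from the open upper (lower) half-plane. -/
def bankFilter (s : Bank) (ξ : ℝ) : Filter ℂ := 𝓝[{ζ : ℂ | 0 < s.sgn * ζ.im}] (ξ : ℂ)

/-- Continuity up to the boundary: limits at all points of both banks, and unrestricted limits at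
the four tips, where the two banks meet. -/
def ContinuousUpToSlits (k : ℝ) (f : ℂ → ℂ) : Prop :=
  (∀ j, ∀ ξ ∈ slit k j, ∀ s, ∃ w, Tendsto f (bankFilter s ξ) (𝓝 w)) ∧
  ∀ e ∈ ({-1, -k, k, 1} : Set ℝ), ∃ w, Tendsto f (𝓝[slitDomain k] (e : ℂ)) (𝓝 w)

/-! ### The elliptic surface `u² = (ζ² - 1)(ζ² - k²)` -/

/-- The finite part of the elliptic surface. -/
def ellipticSurface (k : ℝ) : Set (ℂ × ℂ) := {p | p.2 ^ 2 = (p.1 ^ 2 - 1) * (p.1 ^ 2 - (k : ℂ) ^ 2)}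

/-- The single-valued branch `q` of `√((ζ² - 1)(ζ² - k²))` in the slit domain with `q(ζ) ~ ζ²` at
infinity, written with principal roots: the jumps of the factors cancel off the slits. -/
def branch (k : ℝ) (ζ : ℂ) : ℂ :=
  (ζ - 1) ^ (1 / 2 : ℂ) * (ζ - k) ^ (1 / 2 : ℂ) * (ζ + k) ^ (1 / 2 : ℂ) * (ζ + 1) ^ (1 / 2 : ℂ)

theorem branch_sq (k : ℝ) (ζ : ℂ) :
    branch k ζ ^ 2 = (ζ ^ 2 - 1) * (ζ ^ 2 - (k : ℂ) ^ 2) := by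
  have h : ∀ w : ℂ, (w ^ (1 / 2 : ℂ)) ^ 2 = w := fun w => by
    rw [one_div]; exact_mod_cast Complex.cpow_nat_inv_pow w two_ne_zero
  unfold branch
  rw [mul_pow, mul_pow, mul_pow, h, h, h, h]
  ring

/-- `|q(ξ)|` for `ξ` on a slit. -/
def absq (k ξ : ℝ) : ℝ := √((1 - ξ ^ 2) * (ξ ^ 2 - k ^ 2))

/-- The first sheet `ℂ₁` (cut along the slits), on which `u = q(ζ)`. -/
def sheetOne (k : ℝ) : Set (ℂ × ℂ) := {p | p.1 ∈ slitDomain k ∧ p.2 = branch k p.1}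

/-- The second sheet `ℂ₂` (cut along the slits), on which `u = -q(ζ)`. -/
def sheetTwo (k : ℝ) : Set (ℂ × ℂ) := {p | p.1 ∈ slitDomain k ∧ p.2 = -branch k p.1}

theorem sheets_subset (k : ℝ) : sheetOne k ∪ sheetTwo k ⊆ ellipticSurface k := by
  rintro p (⟨-, h⟩ | ⟨-, h⟩)
  · simp only [ellipticSurface, mem_ofPred_eq, h, branch_sq]
  · simp only [ellipticSurface, mem_ofPred_eq, h, neg_sq, branch_sq]

/-- The value `v = q(ξ ± i0)` on a bank: `∓ i|q(ξ)|` on the banks of the left slit and `± i|q(ξ)|`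
on the banks of the right slit. -/
def bankV (k : ℝ) (j : Fin 2) (s : Bank) (ξ : ℝ) : ℂ := -((sg j * s.sgn * absq k ξ : ℝ) : ℂ) * I

/-- The point `(ξ, v)` of the loop `l_j` on the surface. -/
def loopPoint (k : ℝ) (j : Fin 2) (s : Bank) (ξ : ℝ) : ℂ × ℂ := ((ξ : ℂ), bankV k j s ξ)

/-- The anti-conformal involution `(ζ, u) ↦ (ζ̄, -ū)`, whose symmetry line is the pair of loops. -/
def symm (p : ℂ × ℂ) : ℂ × ℂ := (conj p.1, -conj p.2)

/-- `∮_{l_j} f`: the loop `l_j` runs to the right along the upper bank and back along the lower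
bank, so that the slit domain is on its left. -/
def loopIntegral (k : ℝ) (j : Fin 2) (f : Bank → ℝ → ℂ) : ℂ :=
  (∫ ξ in slit k j, f Bank.upper ξ) - ∫ ξ in slit k j, f Bank.lower ξ

/-- The function on the two sheets that equals `f(ζ)` on the first sheet and the conjugate of
`f(ζ̄)` on the second one. -/
def lift (k : ℝ) (f : ℂ → ℂ) (p : ℂ × ℂ) : ℂ :=
  open Classical in if p.2 = branch k p.1 then f p.1 else conj (f (conj p.1))

/-- The Riemann-Hilbert problem `Φ⁺ - Φ⁻ = 2ih` on the loops, with `h j s ξ` the density at the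
point `ξ ± i0` of the loop `l_j`, for symmetric functions that are analytic on the two sheets and
continuous up to the loops. `Φ⁺` and `Φ⁻` are the limits from the first and the second sheet. -/
structure IsRHSolution (k : ℝ) (h : Fin 2 → Bank → ℝ → ℝ) (Φ : ℂ × ℂ → ℂ) : Prop where
  analytic_one : DifferentiableOn ℂ (fun ζ => Φ (ζ, branch k ζ)) (slitDomain k)
  analytic_two : DifferentiableOn ℂ (fun ζ => Φ (ζ, -branch k ζ)) (slitDomain k)
  symmetric : ∀ p ∈ sheetOne k ∪ sheetTwo k, conj (Φ (symm p)) = Φ p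
  jump : ∀ j, ∀ ξ ∈ slit k j, ∀ s, ∃ wp wm : ℂ,
    Tendsto Φ (𝓝[sheetOne k] loopPoint k j s ξ) (𝓝 wp) ∧
    Tendsto Φ (𝓝[sheetTwo k] loopPoint k j s ξ) (𝓝 wm) ∧
    wp - wm = 2 * I * (h j s ξ : ℂ)

/-- Boundedness at the two infinite points of the surface. -/
def BoundedAtInfinities (k : ℝ) (Φ : ℂ × ℂ → ℂ) : Prop :=
  (fun ζ => Φ (ζ, branch k ζ)) =O[cocompact ℂ] (fun _ => (1 : ℝ)) ∧
  (fun ζ => Φ (ζ, -branch k ζ)) =O[cocompact ℂ] (fun _ => (1 : ℝ))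

/-- Poles of order at most one at the two infinite points of the surface. -/
def SimplePolesAtInfinities (k : ℝ) (Φ : ℂ × ℂ → ℂ) : Prop :=
  (fun ζ => Φ (ζ, branch k ζ)) =O[cocompact ℂ] (fun ζ : ℂ => ζ) ∧
  (fun ζ => Φ (ζ, -branch k ζ)) =O[cocompact ℂ] (fun ζ : ℂ => ζ)

/-- `b₀ + b₁ζ + (1/2π) ∑_j ∮_{l_j} h (1 + u/v) dξ/(ξ - ζ)`. -/
def rhFormula (k : ℝ) (h : Fin 2 → Bank → ℝ → ℝ) (b₀ b₁ : ℝ) (p : ℂ × ℂ) : ℂ :=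
  b₀ + b₁ * p.1 + 1 / (2 * Real.pi) *
    ∑ j, loopIntegral k j (fun s ξ => (h j s ξ : ℂ) * (1 + p.2 / bankV k j s ξ) / ((ξ : ℂ) - p.1))

/-! ### Principal values -/

/-- `I = p.v. ∫_S f(η) dη/(η - ξ)`; an ordinary integral if `ξ` is not in the closure of `S`. -/
def HasPV (f : ℝ → ℝ) (S : Set ℝ) (ξ I : ℝ) : Prop :=
  (∀ ε > 0, IntegrableOn (fun η => f η / (η - ξ)) (S \ Ioo (ξ - ε) (ξ + ε))) ∧
  Tendsto (fun ε : ℝ => ∫ η in S \ Ioo (ξ - ε) (ξ + ε), f η / (η - ξ)) (𝓝[>] 0) (𝓝 I)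

/-- The value of `p.v. ∫_S f(η) dη/(η - ξ)`. -/
def pv (f : ℝ → ℝ) (S : Set ℝ) (ξ : ℝ) : ℝ :=
  limUnder (𝓝[>] (0 : ℝ)) (fun ε : ℝ => ∫ η in S \ Ioo (ξ - ε) (ξ + ε), f η / (η - ξ))

/-! ### The parameters and the two Schwarz problems -/

/-- The parameters: `k` and `ζ_∞`, the shear moduli `μ` of the matrix and `μ_j` of the inclusions,
the stresses `τ = τ₁ + iτ₂` in the inclusions and `τ^∞` at infinity, the scale `c₋₁`. -/
structure Params where
  k : ℝ
  zInf : ℝ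
  mu : ℝ
  muIncl : Fin 2 → ℝ
  tau : ℂ
  tauInf : ℂ
  cm1 : ℂ

/-- The standing assumptions on the parameters. -/
structure Params.Admissible (P : Params) : Prop where
  k_pos : 0 < P.k
  k_lt_one : P.k < 1
  zInf_mem : P.zInf ∈ Ioo (-P.k) P.k
  mu_pos : 0 < P.mu
  muIncl_pos : ∀ j, 0 < P.muIncl j
  muIncl_ne : ∀ j, P.muIncl j ≠ P.mu
  tau_ne : P.tau ≠ 0
  cm1_ne : P.cm1 ≠ 0

namespace Params

variable (P : Params)

/-- `κ_j = μ_j/μ`. -/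
def kappa (j : Fin 2) : ℝ := P.muIncl j / P.mu

/-- `λ_j = μ_j/(1 - κ_j)`. -/
def lam (j : Fin 2) : ℝ := P.muIncl j / (1 - P.kappa j)

/-- `λ̃_j = κ_j/(1 - κ_j)`. -/
def lamT (j : Fin 2) : ℝ := P.kappa j / (1 - P.kappa j)

/-- `c = (τ̄^∞ - τ̄) c₋₁/μ`. -/
def c : ℂ := (conj P.tauInf - conj P.tau) / P.mu * P.cm1

/-- The slit domain punctured at `ζ_∞`. -/
def punctured : Set ℂ := slitDomain P.k \ {(P.zInf : ℂ)}

end Params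

/-- `f` is analytic in the exterior of the slits, including `∞`, up to a pole at `ζ_∞` with
principal part `r/(ζ - ζ_∞)`, and continuous up to the slits. -/
structure IsSlitFunction (P : Params) (r : ℂ) (f : ℂ → ℂ) : Prop where
  analytic : DifferentiableOn ℂ f P.punctured
  pole : ∃ w, Tendsto (fun ζ => f ζ - r / (ζ - P.zInf)) (𝓝[≠] (P.zInf : ℂ)) (𝓝 w)
  at_infinity : ∃ w, Tendsto f (cocompact ℂ) (𝓝 w)
  boundary : ContinuousUpToSlits P.k f

/-- The first Schwarz problem: `Im F = a_j` on `l_j`. -/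
def IsSchwarzOne (P : Params) (a : Fin 2 → ℝ) (F : ℂ → ℂ) : Prop :=
  IsSlitFunction P P.c F ∧
  ∀ j, ∀ ξ ∈ slit P.k j, ∀ s, Tendsto (fun ζ => (F ζ).im) (bankFilter s ξ) (𝓝 (a j))

/-- The second Schwarz problem: `Re[τ̄ω] = λ_j[Re F - d_j]` on `l_j`. -/
def IsSchwarzTwo (P : Params) (F : ℂ → ℂ) (d : Fin 2 → ℝ) (ω : ℂ → ℂ) : Prop :=
  IsSlitFunction P P.cm1 ω ∧
  ∀ j, ∀ ξ ∈ slit P.k j, ∀ s,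
    Tendsto (fun ζ => (conj P.tau * ω ζ).re - P.lam j * ((F ζ).re - d j)) (bankFilter s ξ) (𝓝 0)

/-- `f(ζ) - r/(ζ - ζ_∞)`, with the removable singularity at `ζ_∞` removed. -/
def regularPart (P : Params) (r : ℂ) (f : ℂ → ℂ) : ℂ → ℂ :=
  Function.update (fun ζ => f ζ - r / (ζ - P.zInf)) (P.zInf : ℂ)
    (limUnder (𝓝[≠] (P.zInf : ℂ)) (fun ζ => f ζ - r / (ζ - P.zInf)))

/-! ### The first problem -/

/-- `a_j - Im(c/(ξ - ζ_∞))`. -/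
def densOne (P : Params) (a : Fin 2 → ℝ) (j : Fin 2) (ξ : ℝ) : ℝ :=
  a j - (P.c / ((ξ : ℂ) - P.zInf)).im

/-- The solvability condition for `a₀ - a₁`. -/
def SolvOne (P : Params) (a : Fin 2 → ℝ) : Prop :=
  a 0 - a 1 = (∫ ξ in slit P.k 1, 1 / absq P.k ξ)⁻¹ *
    ((∫ ξ in slit P.k 0, (P.c / ((ξ : ℂ) - P.zInf)).im / absq P.k ξ) -
      ∫ ξ in slit P.k 1, (P.c / ((ξ : ℂ) - P.zInf)).im / absq P.k ξ)

/-- `F(ζ) = β₀ + c/(ζ - ζ_∞) + (q(ζ)/2π) ∑_j ∮_{l_j} [a_j - Im(c/(η - ζ_∞))] dη/((η - ζ)v)`. -/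
def formulaOne (P : Params) (a : Fin 2 → ℝ) (β₀ : ℝ) (ζ : ℂ) : ℂ :=
  β₀ + P.c / (ζ - P.zInf) + branch P.k ζ / (2 * Real.pi) *
    ∑ j, loopIntegral P.k j
      (fun s η => (densOne P a j η : ℂ) / (((η : ℂ) - ζ) * bankV P.k j s η))

/-- `g₁(ξ) = (|q(ξ)|/π) ∑_j (-1)^j p.v. ∫_{l_j⁺} [a_j - Im(c/(η - ζ_∞))] dη/(|q(η)|(η - ξ))`. -/
def g1 (P : Params) (a : Fin 2 → ℝ) (ξ : ℝ) : ℝ :=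
  absq P.k ξ / Real.pi *
    ∑ j, sg j * pv (fun η => densOne P a j η / absq P.k η) (slit P.k j) ξ

/-! ### The second problem -/

/-- `g₀(ξ) = Re[c₋₁/(ξ - ζ_∞) · (τ̄^∞/μ - τ̄/μ_j)]` on `l_j`. -/
def g0 (P : Params) (j : Fin 2) (ξ : ℝ) : ℝ :=
  (P.cm1 / ((ξ : ℂ) - P.zInf) * (conj P.tauInf / P.mu - conj P.tau / P.muIncl j)).re

/-- `G_j + ρ_j` with `ρ_j = λ_j ρ'_j` and `G_j = λ_j[g₀ ± (-1)^j g₁]`. -/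
def densTwo (P : Params) (a ρ' : Fin 2 → ℝ) (j : Fin 2) (s : Bank) (ξ : ℝ) : ℝ :=
  P.lam j * (g0 P j ξ + s.sgn * sg j * g1 P a ξ) + P.lam j * ρ' j

/-- The solvability condition for `ρ₀ - ρ₁`. -/
def SolvTwo (P : Params) (ρ' : Fin 2 → ℝ) : Prop :=
  P.lam 0 * ρ' 0 - P.lam 1 * ρ' 1 = -(∫ ξ in slit P.k 1, 1 / absq P.k ξ)⁻¹ *
    (P.lam 0 * (∫ ξ in slit P.k 0, g0 P 0 ξ / absq P.k ξ) -
      P.lam 1 * ∫ ξ in slit P.k 1, g0 P 1 ξ / absq P.k ξ)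

/-- The map inside the slit domain:
`γ' + c₋₁/(ζ - ζ_∞) - (i/(πτ̄)) ∑_j (-1)^j λ_j ∫_{l_j⁺} {g₁(η) + iq(ζ)/|q(η)| [g₀(η) + ρ'_j]} dη/(η - ζ)`.
-/
def formulaTwo (P : Params) (a ρ' : Fin 2 → ℝ) (γ' ζ : ℂ) : ℂ :=
  γ' + P.cm1 / (ζ - P.zInf) - I / (Real.pi * conj P.tau) *
    ∑ j, (sg j * P.lam j : ℂ) * ∫ η in slit P.k j,
      ((g1 P a η : ℂ) + I * branch P.k ζ / absq P.k η * ((g0 P j η : ℂ) + ρ' j)) / ((η : ℂ) - ζ)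

/-- The density `g₁(η) ± (-1)^m |q(ξ)|/|q(η)| (g₀(η) + ρ'_j)` of the singular integrals. -/
def profileDensity (P : Params) (a ρ' : Fin 2 → ℝ) (m : Fin 2) (s : Bank) (ξ : ℝ) (j : Fin 2)
    (η : ℝ) : ℝ :=
  g1 P a η + s.sgn * sg m * (absq P.k ξ / absq P.k η) * (g0 P j η + ρ' j)

/-- The value of the map at the point `ξ ± i0` of the loop `l_m`, in terms of singular integrals. -/
def profileFormula (P : Params) (a ρ' : Fin 2 → ℝ) (γ' : ℂ) (m : Fin 2) (s : Bank) (ξ : ℝ) : ℂ :=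
  γ' + P.cm1 / ((ξ : ℂ) - P.zInf) - I * P.mu / (Real.pi * conj P.tau) *
    ((∑ j, sg j * P.lamT j * pv (profileDensity P a ρ' m s ξ j) (slit P.k j) ξ : ℝ) +
      Real.pi * I * P.lamT m * (g0 P m ξ + ρ' m + s.sgn * sg m * g1 P a ξ))

/-- The contour `L_m`: the set of boundary values of `ω` on the loop `l_m`. -/
def profile (P : Params) (ω : ℂ → ℂ) (m : Fin 2) : Set ℂ :=
  {z | ∃ ξ ∈ slit P.k m, ∃ s, Tendsto ω (bankFilter s ξ) (𝓝 z)}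

/-- `ω` is univalent in the exterior of the slits, including `∞`, where its value is `w`. -/
def IsUnivalent (P : Params) (ω : ℂ → ℂ) (w : ℂ) : Prop :=
  Tendsto ω (cocompact ℂ) (𝓝 w) ∧ InjOn ω P.punctured ∧ w ∉ ω '' P.punctured

end TwoSlits

end

open TwoSlits

/-!
A symmetric function on the surface is determined by its restriction `f` to the first sheet, and
its limits from the two sheets at a point of a loop are conjugate to each other. Hence the jump
condition with density `h` says that `Im f = h` on the banks: the Riemann-Hilbert problem is a
Schwarz problem in the slit domain (`isRHSolution_iff`). Subtracting the pole, and multiplying by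
`iτ̄` in the second problem, turns (I) and (II) into bounded Schwarz problems (`isSchwarzOne_iff`,
`isSchwarzTwo_iff`); the densities match because `λ_j/μ_j - λ_j/μ = 1` (`lam_mul_g0`).

*Uniqueness.* Let `f` have real boundary values and at most linear growth, and let `f*(ζ)` be the
conjugate of `f(ζ̄)`. Then `f + f*` and `q(f - f*)` are continuous across the slits, hence entire.
The second vanishes at the four tips, so it is divisible by `q²`, and growth at infinity makes the
quotient zero. So `f` is an affine function with real coefficients (`homogeneous_schwarz`), and any
particular solution yields the general one (`rh_general_solution`).

*Existence.* The densities in both problems are `A_j ± (-1)^j λ_j g` with `A_j` real, of the form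
`α_j + r_j/(ξ - ζ_∞)`, and `g = g₁`. The particular solution is the sum of an even part
`(iq/π) ∑ (-1)^j ∫ A_j dη/(|q|(η - ζ))` and an odd part `(1/π) ∑ (-1)^j λ_j ∫ g dη/(η - ζ)`. Its
behaviour at the slits, tips included, follows from the period identity `q(K₀ - K₁) = π`, where
`K_j = ∫_{l_j} dη/(|q|(η - ζ))` (`branch_mul_periodInt_sub`): partial fractions reduce the integral
over `l_m` to `K_m`, which the identity exchanges for the integral over the other slit. Near `l_m`
the even part becomes `i(A_m + qN_m)` with `N_m` analytic across the slit and real on it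
(`evenPart_eq_local`). Comparison with the Sokhotski-Plemelj formula gives `g₁ = |q|N_m` on `l_m`
(`singularInt_eq`, `isTipRegular_g1`). The same identity, applied to the Cauchy integral of
`|q|N_m`, shows that the odd part is `-λ_m q N_m` plus a function that is continuous at `l_m` and
real on it (`IsTipRegular.exists_regular`, `IsTipRegular.isSchwarz_oddPart`).

*Solvability.* At infinity the particular solution is `-(i/π)Mζ + O(1)`, with the real moment
`M = ∑ (-1)^j ∫_{l_j} A_j dξ/|q|`. Added to `β₀ + β₁ζ` it is bounded if and only if `β₁ = 0` and
`M = 0` (`isBigO_one_affine_add_iff`, `bounded_schwarz_iff`), and `M = 0` is the solvability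
condition in either problem (`moment_eq_zero_iff_solvOne`, `moment_eq_zero_iff_solvTwo`).

*Profiles.* Since the solution is continuous up to the banks, its boundary values may be computed
along the normal, where the Sokhotski-Plemelj formula is elementary (`plemelj_interior`,
`tendsto_formulaTwo_vertical`). If `ω` is univalent, its image is open. A boundary point of the
image is the limit of `ω` along an ultrafilter that converges in the sphere, necessarily to a point
of a slit. Conversely a boundary value on a bank is not assumed in the domain, by openness and
injectivity (`frontier_insert_image`, `notMem_insert_image_of_tendsto`).
-/


noncomputable section

namespace TwoSlits

section

/-! ### The slit domain, its banks and tips -/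

theorem slit_zero (k : ℝ) : slit k 0 = Icc (-1) (-k) := by simp [slit]

theorem slit_one (k : ℝ) : slit k 1 = Icc k 1 := by simp [slit]

theorem openSlit_zero (k : ℝ) : openSlit k 0 = Ioo (-1) (-k) := by simp [openSlit]

theorem openSlit_one (k : ℝ) : openSlit k 1 = Ioo k 1 := by simp [openSlit]

theorem sg_zero : sg 0 = 1 := by simp [sg]

theorem sg_one : sg 1 = -1 := by simp [sg]

theorem sg_mul_self (j : Fin 2) : sg j * sg j = 1 := by fin_cases j <;> simp [sg]

theorem Bank.sgn_mul_self (s : Bank) : s.sgn * s.sgn = 1 := by cases s <;> simp [Bank.sgn]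

theorem Bank.sgn_ne_zero (s : Bank) : s.sgn ≠ 0 := by cases s <;> simp [Bank.sgn]

/-- The opposite bank. -/
def Bank.opp : Bank → Bank
  | Bank.upper => Bank.lower
  | Bank.lower => Bank.upper

theorem Bank.opp_sgn (s : Bank) : s.opp.sgn = -s.sgn := by cases s <;> simp [Bank.sgn, Bank.opp]

theorem isCompact_slit (k : ℝ) (j : Fin 2) : IsCompact (slit k j) := by
  unfold slit; split_ifs <;> exact isCompact_Icc

theorem measurableSet_slit (k : ℝ) (j : Fin 2) : MeasurableSet (slit k j) :=
  (isCompact_slit k j).measurableSet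

theorem openSlit_subset (k : ℝ) (j : Fin 2) : openSlit k j ⊆ slit k j := by
  unfold slit openSlit; split_ifs <;> exact Ioo_subset_Icc_self

theorem isOpen_openSlit (k : ℝ) (j : Fin 2) : IsOpen (openSlit k j) := by
  unfold openSlit; split_ifs <;> exact isOpen_Ioo

variable {k : ℝ}

theorem closure_openSlit (hk1 : k < 1) (j : Fin 2) : closure (openSlit k j) = slit k j := by
  unfold slit openSlit
  split_ifs
  · exact closure_Ioo (by linarith)
  · exact closure_Ioo (by linarith)

theorem mem_openSlit_or_tip {j : Fin 2} {ξ : ℝ} (h : ξ ∈ slit k j) :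
    ξ ∈ openSlit k j ∨ ξ ∈ ({-1, -k, k, 1} : Set ℝ) := by
  fin_cases j
  · simp only [Fin.zero_eta, slit_zero, openSlit_zero, mem_Icc, mem_Ioo] at h ⊢
    rcases h.1.eq_or_lt with h1 | h1
    · right; simp [← h1]
    · rcases h.2.eq_or_lt with h2 | h2
      · right; simp [h2]
      · exact Or.inl ⟨h1, h2⟩
  · simp only [Fin.mk_one, slit_one, openSlit_one, mem_Icc, mem_Ioo] at h ⊢
    rcases h.1.eq_or_lt with h1 | h1
    · right; simp [← h1]
    · rcases h.2.eq_or_lt with h2 | h2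
      · right; simp [h2]
      · exact Or.inl ⟨h1, h2⟩

theorem exists_slit_of_tip (hk1 : k < 1) {e : ℝ} (he : e ∈ ({-1, -k, k, 1} : Set ℝ)) :
    ∃ j, e ∈ slit k j := by
  simp only [mem_insert_iff, mem_singleton_iff] at he
  rcases he with rfl | rfl | rfl | rfl
  · exact ⟨0, by rw [slit_zero]; exact ⟨le_rfl, by linarith⟩⟩
  · exact ⟨0, by rw [slit_zero]; exact ⟨by linarith, le_rfl⟩⟩
  · exact ⟨1, by rw [slit_one]; exact ⟨le_rfl, by linarith⟩⟩
  · exact ⟨1, by rw [slit_one]; exact ⟨by linarith, le_rfl⟩⟩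

theorem abs_le_one_of_mem_slit (hk0 : 0 < k) {j : Fin 2} {ξ : ℝ} (h : ξ ∈ slit k j) : |ξ| ≤ 1 := by
  fin_cases j
  · simp only [Fin.zero_eta, slit_zero, mem_Icc] at h
    rw [abs_le]; constructor <;> linarith
  · simp only [Fin.mk_one, slit_one, mem_Icc] at h
    rw [abs_le]; constructor <;> linarith

theorem le_abs_of_mem_slit {j : Fin 2} {ξ : ℝ} (h : ξ ∈ slit k j) : k ≤ |ξ| := by
  fin_cases j
  · simp only [Fin.zero_eta, slit_zero, mem_Icc] at h
    rw [le_abs]; right; linarith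
  · simp only [Fin.mk_one, slit_one, mem_Icc] at h
    rw [le_abs]; left; linarith

theorem slit_disjoint (hk0 : 0 < k) {i j : Fin 2} (hij : i ≠ j) {ξ : ℝ} (h : ξ ∈ slit k i) :
    ξ ∉ slit k j := by
  intro h'
  fin_cases i <;> fin_cases j <;> simp_all [slit_zero, slit_one] <;> linarith

theorem mem_slitDomain {ζ : ℂ} : ζ ∈ slitDomain k ↔ ∀ j, ∀ x ∈ slit k j, (x : ℂ) ≠ ζ := by
  simp [slitDomain, -ofReal_inj]

theorem mem_slitDomain_of_im_ne {ζ : ℂ} (h : ζ.im ≠ 0) : ζ ∈ slitDomain k :=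
  mem_slitDomain.2 fun _ _ _ hx => h (by simp [← hx])

theorem ofReal_mem_slitDomain {x : ℝ} : (x : ℂ) ∈ slitDomain k ↔ ∀ j, x ∉ slit k j := by
  rw [mem_slitDomain]
  constructor
  · intro h j hx
    exact h j x hx rfl
  · intro h j y hy hyx
    rw [ofReal_inj] at hyx
    exact h j (hyx ▸ hy)

theorem isCompact_ofReal_slit (k : ℝ) (j : Fin 2) :
    IsCompact ((fun x : ℝ => (x : ℂ)) '' slit k j) :=
  (isCompact_slit k j).image continuous_ofReal

theorem isOpen_slitDomain (k : ℝ) : IsOpen (slitDomain k) := by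
  rw [slitDomain, isOpen_compl_iff]
  exact isClosed_iUnion_of_finite fun j => (isCompact_ofReal_slit k j).isClosed

theorem mem_slitDomain_of_one_lt_norm (hk0 : 0 < k) {ζ : ℂ} (h : 1 < ‖ζ‖) : ζ ∈ slitDomain k := by
  refine mem_slitDomain.2 fun j x hx hxz => ?_
  rw [← hxz, norm_real, Real.norm_eq_abs] at h
  exact absurd (abs_le_one_of_mem_slit hk0 hx) (not_le.2 h)

theorem eventually_one_lt_norm : ∀ᶠ ζ : ℂ in cocompact ℂ, 1 < ‖ζ‖ :=
  (tendsto_norm_cocompact_atTop (E := ℂ)).eventually_gt_atTop 1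

theorem eventually_mem_slitDomain (hk0 : 0 < k) : ∀ᶠ ζ : ℂ in cocompact ℂ, ζ ∈ slitDomain k :=
  eventually_one_lt_norm.mono fun _ h => mem_slitDomain_of_one_lt_norm hk0 h

theorem mid_mem_slitDomain {z : ℝ} (hz : z ∈ Ioo (-k) k) : (z : ℂ) ∈ slitDomain k := by
  refine ofReal_mem_slitDomain.2 fun j hj => ?_
  have := le_abs_of_mem_slit hj
  exact absurd (abs_lt.2 ⟨hz.1, hz.2⟩) (not_lt.2 this)

theorem conj_mem_slitDomain {ζ : ℂ} (h : ζ ∈ slitDomain k) : conj ζ ∈ slitDomain k := by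
  rw [mem_slitDomain] at h ⊢
  intro j x hx hxz
  exact h j x hx (by rw [← conj_conj ζ, ← hxz, conj_ofReal])

/-- The vertical approach to a point of a bank. -/
theorem tendsto_vertical (s : Bank) (ξ : ℝ) :
    Tendsto (fun ε : ℝ => (ξ : ℂ) + s.sgn * ε * I) (𝓝[>] 0) (bankFilter s ξ) := by
  refine tendsto_nhdsWithin_iff.2 ⟨?_, ?_⟩
  · have : Continuous fun ε : ℝ => (ξ : ℂ) + s.sgn * ε * I := by fun_prop
    simpa using (this.tendsto 0).mono_left nhdsWithin_le_nhds
  · filter_upwards [self_mem_nhdsWithin] with ε hε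
    have : 0 < s.sgn * s.sgn * ε := by rw [s.sgn_mul_self]; simpa using hε
    simpa [← mul_assoc] using this

instance bankFilter_neBot (s : Bank) (ξ : ℝ) : (bankFilter s ξ).NeBot :=
  (tendsto_vertical s ξ).neBot

theorem bankFilter_le_slitDomain (s : Bank) (ξ : ℝ) : bankFilter s ξ ≤ 𝓝[slitDomain k] (ξ : ℂ) :=
  nhdsWithin_mono _ fun ζ hζ => mem_slitDomain_of_im_ne (by
    intro h; simp only [mem_ofPred_eq, h, mul_zero, lt_irrefl] at hζ)

theorem bankFilter_le_nhds (s : Bank) (ξ : ℝ) : bankFilter s ξ ≤ 𝓝 (ξ : ℂ) := nhdsWithin_le_nhds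

theorem tendsto_conj_bank (s : Bank) (ξ : ℝ) :
    Tendsto (fun ζ : ℂ => conj ζ) (bankFilter s ξ) (bankFilter s.opp ξ) := by
  refine tendsto_nhdsWithin_iff.2 ⟨?_, ?_⟩
  · have := (continuous_conj.tendsto (ξ : ℂ)).mono_left (bankFilter_le_nhds s ξ)
    simpa using this
  · filter_upwards [self_mem_nhdsWithin] with ζ hζ
    simpa [Bank.opp_sgn] using hζ

/-- Near an interior point of a slit the slit domain consists of the two half-planes. -/
theorem nhdsWithin_slitDomain_of_interior {j : Fin 2} {ξ : ℝ} (h : ξ ∈ openSlit k j) :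
    𝓝[slitDomain k] (ξ : ℂ) = bankFilter Bank.upper ξ ⊔ bankFilter Bank.lower ξ := by
  apply le_antisymm
  · unfold bankFilter
    rw [← nhdsWithin_union]
    have hU : {ζ : ℂ | ζ.re ∈ openSlit k j} ∈ 𝓝 (ξ : ℂ) :=
      ((isOpen_openSlit k j).preimage continuous_re).mem_nhds (by simpa using h)
    rw [← nhdsWithin_inter_of_mem' (mem_nhdsWithin_of_mem_nhds hU)]
    refine nhdsWithin_mono _ ?_
    rintro ζ ⟨h1, h2⟩
    rcases lt_trichotomy ζ.im 0 with h3 | h3 | h3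
    · right; simpa [Bank.sgn]
    · exact absurd (Complex.ext (by simp) (by simp [h3]))
        (mem_slitDomain.1 h1 j ζ.re (openSlit_subset k j h2))
    · left; simpa [Bank.sgn] using h3
  · exact sup_le (bankFilter_le_slitDomain _ _) (bankFilter_le_slitDomain _ _)

/-! ### The branch `q` -/

theorem cpow_half_sq (w : ℂ) : (w ^ (1 / 2 : ℂ)) ^ 2 = w := by
  rw [one_div]; exact_mod_cast Complex.cpow_nat_inv_pow w two_ne_zero

theorem cpow_half_ofReal {x : ℝ} (hx : 0 ≤ x) : (x : ℂ) ^ (1 / 2 : ℂ) = (√x : ℝ) := by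
  rw [Real.sqrt_eq_rpow, ofReal_cpow hx]; norm_num

/-- The principal roots of `w` and `-w` differ by the factor `i` above and on the negative
half-line, by `-i` below and on the positive one. -/
theorem cpow_half_neg {w : ℂ} :
    w ^ (1 / 2 : ℂ) = (if 0 < w.im ∨ (w.im = 0 ∧ w.re < 0) then I else -I) * (-w) ^ (1 / 2 : ℂ) := by
  rcases eq_or_ne w 0 with rfl | hw
  · simp
  have hI : exp ((Real.pi : ℂ) * I * (1 / 2)) = I := by
    rw [show (Real.pi : ℂ) * I * (1 / 2) = Real.pi / 2 * I by ring, exp_pi_div_two_mul_I]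
  have hI' : exp (-((Real.pi : ℂ) * I * (1 / 2))) = -I := by
    rw [show -((Real.pi : ℂ) * I * (1 / 2)) = -(Real.pi / 2 * I) by ring, exp_neg,
      exp_pi_div_two_mul_I, inv_I]
  rw [cpow_def_of_ne_zero hw, cpow_def_of_ne_zero (neg_ne_zero.2 hw)]
  split_ifs with h
  · have harg : (-w).arg = w.arg - Real.pi := by
      rcases h with h | ⟨h1, h2⟩
      · exact arg_neg_eq_arg_sub_pi_of_im_pos h
      · exact arg_neg_eq_arg_sub_pi_iff.2 (Or.inr ⟨h1, h2⟩)
    have : log w = log (-w) + Real.pi * I := by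
      simp only [log, norm_neg, harg]; push_cast; ring
    rw [this, add_mul, exp_add, hI, mul_comm]
  · have harg : (-w).arg = w.arg + Real.pi := by
      rw [arg_neg_eq_arg_add_pi_iff]
      by_contra h'
      push Not at h h'
      have him : w.im = 0 := le_antisymm h.1 h'.1
      exact hw (Complex.ext (le_antisymm (h'.2 him) (h.2 him)) him)
    have : log w = log (-w) + -(Real.pi * I) := by
      simp only [log, norm_neg, harg]; push_cast; ring
    rw [this, add_mul, exp_add, neg_mul, hI', mul_comm]

/-- Two roots whose cuts are crossed together: the two factors `±i` multiply to `-1`. -/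
theorem cpow_half_mul_neg {a b : ℝ} {ζ : ℂ} (h : ζ.im = 0 → (ζ.re < a ∧ ζ.re < b) ∨
    (a < ζ.re ∧ b < ζ.re)) :
    (ζ - a) ^ (1 / 2 : ℂ) * (ζ - b) ^ (1 / 2 : ℂ) =
      -((a - ζ) ^ (1 / 2 : ℂ) * (b - ζ) ^ (1 / 2 : ℂ)) := by
  rw [cpow_half_neg (w := ζ - a), cpow_half_neg (w := ζ - b), neg_sub, neg_sub]
  have : (0 < (ζ - a).im ∨ ((ζ - a).im = 0 ∧ (ζ - a).re < 0)) ↔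
      (0 < (ζ - b).im ∨ ((ζ - b).im = 0 ∧ (ζ - b).re < 0)) := by
    simp only [sub_im, ofReal_im, sub_zero, sub_re, ofReal_re, sub_neg]
    by_cases h0 : ζ.im = 0
    · rcases h h0 with h1 | h1
      · simp [h0, h1.1, h1.2]
      · simp [h0, not_lt.2 h1.1.le, not_lt.2 h1.2.le]
    · simp [h0]
  simp only [this]
  split_ifs
  · linear_combination ((a - ζ) ^ (1 / 2 : ℂ) * (b - ζ) ^ (1 / 2 : ℂ)) * I_mul_I
  · linear_combination ((a - ζ) ^ (1 / 2 : ℂ) * (b - ζ) ^ (1 / 2 : ℂ)) * I_mul_I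

theorem branch_eq_sub (k : ℝ) (ζ : ℂ) : branch k ζ = (ζ - (1 : ℝ)) ^ (1 / 2 : ℂ) *
    (ζ - k) ^ (1 / 2 : ℂ) * ((ζ - (-k : ℝ)) ^ (1 / 2 : ℂ) * (ζ - (-1 : ℝ)) ^ (1 / 2 : ℂ)) := by
  simp [branch, mul_assoc]

theorem branch_ne_zero {ζ : ℂ} (hk1 : k < 1) (h : ζ ∈ slitDomain k) : branch k ζ ≠ 0 := by
  intro h0
  have h1 := branch_sq k ζ
  rw [h0, zero_pow two_ne_zero] at h1
  have h2 : (ζ - (1 : ℝ)) * (ζ - (-1 : ℝ)) * ((ζ - k) * (ζ - (-k : ℝ))) = 0 := by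
    push_cast; linear_combination -h1
  have tip : ∀ e : ℝ, e ∈ ({-1, -k, k, 1} : Set ℝ) → ζ ≠ e := fun e he he' => by
    obtain ⟨j, hj⟩ := exists_slit_of_tip hk1 he
    exact mem_slitDomain.1 h j e hj he'.symm
  simp only [mul_eq_zero, sub_eq_zero] at h2
  rcases h2 with (h2 | h2) | (h2 | h2) <;> exact tip _ (by simp) h2

/-- The cuts `(-∞, a]` of the four principal roots cancel in pairs: `{1, k}` on `(-k, k)` and both
pairs on `(-∞, -1)`. -/
theorem differentiableOn_branch (hk0 : 0 < k) (hk1 : k < 1) :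
    DifferentiableOn ℂ (branch k) (slitDomain k) := by
  have d1 : ∀ (a : ℝ) (ζ : ℂ), (a < ζ.re ∨ ζ.im ≠ 0) →
      DifferentiableAt ℂ (fun ζ : ℂ => (ζ - a) ^ (1 / 2 : ℂ)) ζ := fun a ζ h => by
    refine DifferentiableAt.cpow_const (by fun_prop) ?_
    rw [mem_slitPlane_iff]
    simpa using h
  have d2 : ∀ (a : ℝ) (ζ : ℂ), (ζ.re < a ∨ ζ.im ≠ 0) →
      DifferentiableAt ℂ (fun ζ : ℂ => (a - ζ) ^ (1 / 2 : ℂ)) ζ := fun a ζ h => by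
    refine DifferentiableAt.cpow_const (by fun_prop) ?_
    rw [mem_slitPlane_iff]
    simpa using h
  intro ζ hζ
  apply DifferentiableAt.differentiableWithinAt
  by_cases h1 : 1 < ζ.re ∨ ζ.im ≠ 0
  · rw [show branch k = _ from funext (branch_eq_sub k)]
    refine ((d1 _ _ h1).mul (d1 _ _ ?_)).mul ((d1 _ _ ?_).mul (d1 _ _ ?_)) <;>
      refine h1.imp_left fun h => by linarith
  · push Not at h1
    obtain ⟨h1, him⟩ := h1
    have hζr : ζ = (ζ.re : ℂ) := Complex.ext rfl (by simp [him])
    have hns : ∀ j, ζ.re ∉ slit k j := by rw [hζr, ofReal_mem_slitDomain] at hζ; exact hζ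
    have hs0 := hns 0
    have hs1 := hns 1
    rw [slit_zero, mem_Icc, not_and, not_le] at hs0
    rw [slit_one, mem_Icc, not_and'] at hs1
    have h2 : ζ.re < k := not_le.1 (hs1 h1)
    by_cases h3 : ζ.re < -1
    · have heq : branch k =ᶠ[𝓝 ζ] fun ζ : ℂ => ((1 : ℝ) - ζ) ^ (1 / 2 : ℂ) *
          (k - ζ) ^ (1 / 2 : ℂ) *
          (((-k : ℝ) - ζ) ^ (1 / 2 : ℂ) * ((-1 : ℝ) - ζ) ^ (1 / 2 : ℂ)) := by
        filter_upwards [(isOpen_Iio.preimage continuous_re).mem_nhds (show ζ.re ∈ Iio (-1) from h3)]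
          with x hx
        have hx : x.re < -1 := hx
        rw [branch_eq_sub, cpow_half_mul_neg fun _ => Or.inl ⟨by linarith, by linarith⟩,
          cpow_half_mul_neg fun _ => Or.inl ⟨by linarith, by linarith⟩, neg_mul_neg]
      refine DifferentiableAt.congr_of_eventuallyEq ?_ heq
      refine ((d2 _ _ ?_).mul (d2 _ _ ?_)).mul ((d2 _ _ ?_).mul (d2 _ _ ?_)) <;>
      left <;> linarith
    · have h4 : -k < ζ.re := hs0 (not_lt.1 h3)
      have heq : branch k =ᶠ[𝓝 ζ] fun ζ : ℂ => -(((1 : ℝ) - ζ) ^ (1 / 2 : ℂ) *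
          (k - ζ) ^ (1 / 2 : ℂ)) *
          ((ζ - (-k : ℝ)) ^ (1 / 2 : ℂ) * (ζ - (-1 : ℝ)) ^ (1 / 2 : ℂ)) := by
        filter_upwards [(isOpen_Iio.preimage continuous_re).mem_nhds (show ζ.re ∈ Iio k from h2)]
          with x hx
        have hx : x.re < k := hx
        rw [branch_eq_sub, cpow_half_mul_neg fun _ => Or.inl ⟨by linarith, by linarith⟩]
      refine DifferentiableAt.congr_of_eventuallyEq ?_ heq
      refine ((d2 _ _ ?_).mul (d2 _ _ ?_)).neg.mul ((d1 _ _ ?_).mul (d1 _ _ ?_)) <;>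
      left <;> linarith

theorem branch_conj_of_im_ne {ζ : ℂ} (h : ζ.im ≠ 0) : branch k (conj ζ) = conj (branch k ζ) := by
  have : ∀ a : ℝ, (conj ζ - a) ^ (1 / 2 : ℂ) = conj ((ζ - a) ^ (1 / 2 : ℂ)) := fun a => by
    have h1 : (conj ζ - a).arg ≠ Real.pi := by
      intro h2
      have := (arg_eq_pi_iff.1 h2).2
      simp at this; exact h this
    have := cpow_conj (conj ζ - a) (1 / 2) h1
    rw [show conj (1 / 2 : ℂ) = 1 / 2 by
      rw [map_div₀, map_one, map_ofNat]] at this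
    rw [this]; simp
  rw [branch_eq_sub, branch_eq_sub, this, this, this, this]
  simp only [map_mul]

theorem mem_closure_im_ne (ζ : ℂ) : ζ ∈ closure {w : ℂ | w.im ≠ 0} := by
  by_cases h : ζ.im = 0
  · have h1 := tendsto_vertical Bank.upper ζ.re
    have h2 : ζ = (ζ.re : ℂ) := Complex.ext rfl (by simp [h])
    rw [h2]
    refine mem_closure_of_tendsto (h1.mono_right (bankFilter_le_nhds _ _)) ?_
    filter_upwards [self_mem_nhdsWithin] with ε hε
    simpa [Bank.sgn] using ne_of_gt hε
  · exact subset_closure h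

/-- Two functions continuous in the slit domain agree if they agree off the real axis. -/
theorem eqOn_slitDomain_of_im_ne {f g : ℂ → ℂ} (hf : ContinuousOn f (slitDomain k))
    (hg : ContinuousOn g (slitDomain k)) (h : ∀ ζ : ℂ, ζ.im ≠ 0 → f ζ = g ζ) {ζ : ℂ}
    (hζ : ζ ∈ slitDomain k) : f ζ = g ζ := by
  have hU := (isOpen_slitDomain k).mem_nhds hζ
  have hne : (𝓝[{w : ℂ | w.im ≠ 0}] ζ).NeBot := mem_closure_iff_nhdsWithin_neBot.1 (mem_closure_im_ne ζ)
  refine tendsto_nhds_unique (f := f) ((hf.continuousAt hU).tendsto.mono_left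
    (nhdsWithin_le_nhds (s := {w : ℂ | w.im ≠ 0}))) ?_
  refine Tendsto.congr' ?_ ((hg.continuousAt hU).tendsto.mono_left nhdsWithin_le_nhds)
  filter_upwards [self_mem_nhdsWithin] with w hw
  exact (h w hw).symm

theorem continuousOn_conj_comp {f : ℂ → ℂ} (hf : ContinuousOn f (slitDomain k)) :
    ContinuousOn (fun ζ => conj (f (conj ζ))) (slitDomain k) :=
  continuous_conj.comp_continuousOn
    (hf.comp continuous_conj.continuousOn fun _ h => conj_mem_slitDomain h)

theorem branch_conj (hk0 : 0 < k) (hk1 : k < 1) {ζ : ℂ} (h : ζ ∈ slitDomain k) :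
    branch k (conj ζ) = conj (branch k ζ) := by
  have := (differentiableOn_branch hk0 hk1).continuousOn
  have := eqOn_slitDomain_of_im_ne (continuousOn_conj_comp this) this
    (fun ζ hζ => by rw [branch_conj_of_im_ne hζ, conj_conj]) h
  rw [← this, conj_conj]

/-- The principal root is continuous from the closed upper half-plane, the negative half-line
included. -/
theorem tendsto_cpow_half_upper (w : ℂ) :
    Tendsto (fun ζ : ℂ => ζ ^ (1 / 2 : ℂ)) (𝓝[{ζ : ℂ | 0 ≤ ζ.im}] w) (𝓝 (w ^ (1 / 2 : ℂ))) := by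
  by_cases h : 0 ≤ w.re ∨ w.im ≠ 0
  · exact (continuousAt_cpow_const_of_re_pos h (by norm_num)).tendsto.mono_left nhdsWithin_le_nhds
  · push Not at h
    have h0 : w ≠ 0 := fun h' => by simp [h'] at h
    have h1 := continuousWithinAt_log_of_re_neg_of_im_zero h.1 h.2
    have h2 : Tendsto (fun ζ : ℂ => exp (log ζ * (1 / 2))) (𝓝[{ζ : ℂ | 0 ≤ ζ.im}] w)
        (𝓝 (exp (log w * (1 / 2)))) :=
      (continuous_exp.tendsto _).comp (h1.tendsto.mul_const _)
    rw [cpow_def_of_ne_zero h0]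
    refine h2.congr' ?_
    filter_upwards [mem_nhdsWithin_of_mem_nhds (isOpen_ne.mem_nhds h0)] with ζ hζ
    rw [cpow_def_of_ne_zero hζ]

/-- The value of `branch` at a real point is its limit from above. -/
theorem tendsto_branch_upper (k ξ : ℝ) :
    Tendsto (branch k) (bankFilter Bank.upper ξ) (𝓝 (branch k ξ)) := by
  have h : ∀ a : ℝ, Tendsto (fun ζ : ℂ => (ζ - a) ^ (1 / 2 : ℂ)) (bankFilter Bank.upper ξ)
      (𝓝 (((ξ : ℂ) - a) ^ (1 / 2 : ℂ))) := fun a => by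
    refine (tendsto_cpow_half_upper ((ξ : ℂ) - a)).comp ?_
    refine tendsto_nhdsWithin_iff.2 ⟨?_, ?_⟩
    · exact (Continuous.tendsto (by fun_prop) (ξ : ℂ)).mono_left (bankFilter_le_nhds _ _)
    · filter_upwards [self_mem_nhdsWithin] with ζ hζ
      have : 0 < ζ.im := by simpa [Bank.sgn] using hζ
      simpa using this.le
  rw [show branch k = _ from funext (branch_eq_sub k)]
  exact ((h 1).mul (h k)).mul ((h (-k)).mul (h (-1)))

theorem absq_nonneg (k ξ : ℝ) : 0 ≤ absq k ξ := Real.sqrt_nonneg _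

theorem radicand_nonneg (hk0 : 0 < k) {j : Fin 2} {ξ : ℝ} (h : ξ ∈ slit k j) :
    0 ≤ (1 - ξ ^ 2) * (ξ ^ 2 - k ^ 2) := by
  have h1 := abs_le_one_of_mem_slit hk0 h
  have h2 := le_abs_of_mem_slit h
  rw [← sq_abs ξ]
  apply mul_nonneg <;> nlinarith [abs_nonneg ξ]

theorem radicand_pos (hk0 : 0 < k) {j : Fin 2} {ξ : ℝ} (h : ξ ∈ openSlit k j) :
    0 < (1 - ξ ^ 2) * (ξ ^ 2 - k ^ 2) := by
  fin_cases j
  · simp only [Fin.zero_eta, openSlit_zero, mem_Ioo] at h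
    apply mul_pos <;> nlinarith
  · simp only [Fin.mk_one, openSlit_one, mem_Ioo] at h
    apply mul_pos <;> nlinarith

theorem absq_sq (hk0 : 0 < k) {j : Fin 2} {ξ : ℝ} (h : ξ ∈ slit k j) :
    absq k ξ ^ 2 = (1 - ξ ^ 2) * (ξ ^ 2 - k ^ 2) := Real.sq_sqrt (radicand_nonneg hk0 h)

theorem absq_pos (hk0 : 0 < k) {j : Fin 2} {ξ : ℝ} (h : ξ ∈ openSlit k j) : 0 < absq k ξ :=
  Real.sqrt_pos.2 (radicand_pos hk0 h)

theorem absq_tip {e : ℝ} (he : e ∈ ({-1, -k, k, 1} : Set ℝ)) : absq k e = 0 := by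
  simp only [mem_insert_iff, mem_singleton_iff] at he
  rcases he with rfl | rfl | rfl | rfl <;> simp [absq]

theorem continuous_absq (k : ℝ) : Continuous (absq k) := by unfold absq; fun_prop

/-- On a slit `branch` takes the values of the upper bank, the principal roots being continuous
from above. -/
theorem branch_slit (hk0 : 0 < k) {j : Fin 2} {ξ : ℝ} (h : ξ ∈ slit k j) :
    branch k ξ = bankV k j Bank.upper ξ := by
  have e : ∀ a : ℝ, a ≤ ξ → ((ξ : ℂ) - a) ^ (1 / 2 : ℂ) = (√(ξ - a) : ℝ) := fun a ha => by
    rw [← ofReal_sub, cpow_half_ofReal (by linarith)]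
  have e' : ∀ a : ℝ, ξ ≤ a → ((ξ : ℂ) - a) ^ (1 / 2 : ℂ) = I * (√(a - ξ) : ℝ) := fun a ha => by
    rcases ha.eq_or_lt with rfl | ha
    · simp
    · rw [cpow_half_neg, if_pos (Or.inr (by simpa using ha)), neg_sub, ← ofReal_sub,
        cpow_half_ofReal (by linarith)]
  rw [branch_eq_sub]
  fin_cases j
  · simp only [Fin.zero_eta, slit_zero, mem_Icc] at h
    rw [e' 1 (by linarith), e' k (by linarith), e' (-k) (by linarith), e (-1) (by linarith)]
    have : absq k ξ = √(1 - ξ) * √(k - ξ) * √(-k - ξ) * √(ξ - -1) := by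
      rw [absq, ← Real.sqrt_mul (by linarith), ← Real.sqrt_mul (by nlinarith),
        ← Real.sqrt_mul (mul_nonneg (by nlinarith) (by linarith))]
      ring_nf
    simp only [bankV, sg, Bank.sgn, this]
    push_cast
    linear_combination (√(1 - ξ) * √(k - ξ) * √(-k - ξ) * √(ξ - -1) : ℂ) * I * I_sq
  · simp only [Fin.mk_one, slit_one, mem_Icc] at h
    rw [e' 1 (by linarith), e k (by linarith), e (-k) (by linarith), e (-1) (by linarith)]
    have : absq k ξ = √(1 - ξ) * √(ξ - k) * √(ξ - -k) * √(ξ - -1) := by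
      rw [absq, ← Real.sqrt_mul (by linarith), ← Real.sqrt_mul (by nlinarith),
        ← Real.sqrt_mul (mul_nonneg (by nlinarith) (by linarith))]
      ring_nf
    simp only [bankV, sg, Bank.sgn, this]
    push_cast
    ring

theorem bankV_opp (k : ℝ) (j : Fin 2) (s : Bank) (ξ : ℝ) :
    bankV k j s.opp ξ = -bankV k j s ξ := by
  simp [bankV, Bank.opp_sgn]

theorem conj_bankV (k : ℝ) (j : Fin 2) (s : Bank) (ξ : ℝ) :
    conj (bankV k j s ξ) = -bankV k j s ξ := by
  simp [bankV]

theorem tendsto_branch_bank (hk0 : 0 < k) {j : Fin 2} {ξ : ℝ} (h : ξ ∈ slit k j) (s : Bank) :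
    Tendsto (branch k) (bankFilter s ξ) (𝓝 (bankV k j s ξ)) := by
  have hu : Tendsto (branch k) (bankFilter Bank.upper ξ) (𝓝 (bankV k j Bank.upper ξ)) := by
    have := tendsto_branch_upper k ξ
    rwa [branch_slit hk0 h] at this
  cases s
  · exact hu
  · have h1 := (continuous_conj.tendsto _).comp (hu.comp (tendsto_conj_bank Bank.lower ξ))
    rw [conj_bankV, ← bankV_opp] at h1
    refine h1.congr' ?_
    filter_upwards [self_mem_nhdsWithin] with ζ hζ
    have : ζ.im ≠ 0 := fun h => by simp [h] at hζ
    simp [branch_conj_of_im_ne this]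

theorem tendsto_branch_tip {e : ℝ} (he : e ∈ ({-1, -k, k, 1} : Set ℝ)) :
    Tendsto (branch k) (𝓝 (e : ℂ)) (𝓝 0) := by
  rw [tendsto_zero_iff_norm_tendsto_zero]
  have h1 : ∀ ζ, ‖branch k ζ‖ = √(‖(ζ ^ 2 - 1) * (ζ ^ 2 - (k : ℂ) ^ 2)‖) := fun ζ => by
    rw [← branch_sq, norm_pow, Real.sqrt_sq (norm_nonneg _)]
  simp only [h1]
  have h2 : Continuous fun ζ : ℂ => √(‖(ζ ^ 2 - 1) * (ζ ^ 2 - (k : ℂ) ^ 2)‖) := by fun_prop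
  have h3 := h2.tendsto (e : ℂ)
  convert h3 using 2
  simp only [mem_insert_iff, mem_singleton_iff] at he
  rcases he with rfl | rfl | rfl | rfl <;> simp

/-- `q(ζ)/ζ² → 1` at infinity: in the right half-plane the principal roots of `ζ` can be factored
out, and `q` is even. -/
theorem tendsto_branch_div_sq (hk0 : 0 < k) (hk1 : k < 1) :
    Tendsto (fun ζ => branch k ζ / ζ ^ 2) (cocompact ℂ) (𝓝 1) := by
  have main : ∀ a : ℝ, |a| ≤ 1 → ∀ ζ : ℂ, 1 < ‖ζ‖ → 0 ≤ ζ.re →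
      (ζ - a) ^ (1 / 2 : ℂ) = ζ ^ (1 / 2 : ℂ) * (1 - a / ζ) ^ (1 / 2 : ℂ) := by
    intro a ha ζ h1 h2
    have h0 : ζ ≠ 0 := fun h => by rw [h, norm_zero] at h1; linarith
    have hlt : ‖(a : ℂ) / ζ‖ < 1 := by
      rw [norm_div, norm_real, div_lt_one (by linarith)]
      exact lt_of_le_of_lt ha h1
    have hre : 0 < (1 - (a : ℂ) / ζ).re := by
      have := (le_abs_self _).trans (abs_re_le_norm ((a : ℂ) / ζ))
      simp only [sub_re, one_re]; linarith
    have hn : (1 - (a : ℂ) / ζ) ≠ 0 := fun h => by rw [h] at hre; simp at hre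
    have e1 := abs_arg_le_pi_div_two_iff.2 h2
    have e2 := abs_arg_lt_pi_div_two_iff.2 (Or.inl hre)
    rw [abs_le] at e1
    rw [abs_lt] at e2
    rw [show ζ - a = ζ * (1 - a / ζ) by field_simp, cpow_def_of_ne_zero (mul_ne_zero h0 hn),
      cpow_def_of_ne_zero h0, cpow_def_of_ne_zero hn,
      log_mul h0 hn ⟨by linarith [e1.1, e2.1], by linarith [e1.2, e2.2]⟩, add_mul, exp_add]
  let b : ℂ → ℂ := fun ζ => (1 - (1 : ℝ) / ζ) ^ (1 / 2 : ℂ) * (1 - (k : ℝ) / ζ) ^ (1 / 2 : ℂ) *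
    ((1 - (-k : ℝ) / ζ) ^ (1 / 2 : ℂ) * (1 - (-1 : ℝ) / ζ) ^ (1 / 2 : ℂ))
  have hpos : ∀ ζ : ℂ, 1 < ‖ζ‖ → 0 ≤ ζ.re → branch k ζ = ζ ^ 2 * b ζ := by
    intro ζ h1 h2
    have hk : |k| ≤ 1 := by rw [abs_of_pos hk0]; exact hk1.le
    rw [branch_eq_sub, main 1 (by simp) ζ h1 h2, main k hk ζ h1 h2,
      main (-k) (by rwa [abs_neg]) ζ h1 h2, main (-1) (by simp) ζ h1 h2]
    simp only [b]
    have h4 : (ζ ^ (1 / 2 : ℂ)) ^ 4 = ζ ^ 2 := by rw [show 4 = 2 * 2 from rfl, pow_mul, cpow_half_sq]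
    rw [← h4]
    ring
  have hall : ∀ ζ : ℂ, 1 < ‖ζ‖ → branch k ζ = ζ ^ 2 * b ζ := by
    intro ζ h1
    by_cases h2 : 0 ≤ ζ.re
    · exact hpos ζ h1 h2
    · have h3 := hpos (-ζ) (by simpa using h1) (by simp; linarith)
      have hc : ζ.im = 0 → ζ.re < -1 := fun h => by
        have : ζ = (ζ.re : ℂ) := Complex.ext rfl (by simp [h])
        rw [this, norm_real, Real.norm_eq_abs, abs_of_neg (by linarith)] at h1
        linarith
      have e1 : branch k ζ = branch k (-ζ) := by
        rw [branch_eq_sub k ζ, cpow_half_mul_neg fun h => Or.inl ⟨by linarith [hc h], by linarith [hc h]⟩,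
          cpow_half_mul_neg fun h => Or.inl ⟨by linarith [hc h], by linarith [hc h]⟩, branch]
        push_cast
        rw [show (1 : ℂ) - ζ = -ζ + 1 by ring, show (k : ℂ) - ζ = -ζ + k by ring,
          show -(k : ℂ) - ζ = -ζ - k by ring, show (-1 : ℂ) - ζ = -ζ - 1 by ring]
        ring
      have e2 : b (-ζ) = b ζ := by
        simp only [b]
        push_cast
        simp only [div_neg, neg_div, neg_neg]
        ring
      rw [e1, h3, e2]; ring
  have hb : Tendsto b (cocompact ℂ) (𝓝 1) := by
    have hf : ∀ a : ℝ, Tendsto (fun ζ : ℂ => (1 - (a : ℂ) / ζ) ^ (1 / 2 : ℂ)) (cocompact ℂ) (𝓝 1) := by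
      intro a
      have h1 : Tendsto (fun ζ : ℂ => 1 - (a : ℂ) / ζ) (cocompact ℂ) (𝓝 1) := by
        have := tendsto_inv₀_cobounded (α := ℂ)
        rw [Metric.cobounded_eq_cocompact] at this
        simpa [div_eq_mul_inv] using (this.const_mul (a : ℂ)).const_sub 1
      have h2 := (continuousAt_cpow_const_of_re_pos (z := 1) (w := 1 / 2) (by simp)
        (by norm_num)).tendsto.comp h1
      rw [one_cpow] at h2
      exact h2
    have h1 := ((hf 1).mul (hf k)).mul ((hf (-k)).mul (hf (-1)))
    simp only [mul_one] at h1
    exact h1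
  refine hb.congr' ?_
  filter_upwards [eventually_one_lt_norm] with ζ h1
  have h0 : ζ ≠ 0 := fun h => by rw [h, norm_zero] at h1; linarith
  rw [hall ζ h1]
  field_simp

end

section

variable {k : ℝ}

/-! ### Removability of real segments and extension to entire functions -/

/-- A continuous function that is holomorphic off the real axis is holomorphic: by Morera's
theorem, because a rectangle that meets the real axis splits into two rectangles whose interiors
do not. -/
theorem differentiableOn_of_continuousOn_of_im_ne {U : Set ℂ} {g : ℂ → ℂ} (hU : IsOpen U)
    (hc : ContinuousOn g U) (hd : ∀ ζ ∈ U, ζ.im ≠ 0 → DifferentiableAt ℂ g ζ) :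
    DifferentiableOn ℂ g U := by
  refine (isConservativeOn_and_continuousOn_iff_isDifferentiableOn hU).1 ⟨?_, hc⟩
  have base : ∀ z w : ℂ, Rectangle z w ⊆ U → (0 : ℝ) ∉ Ioo (min z.im w.im) (max z.im w.im) →
      wedgeIntegral z w g + wedgeIntegral w z g = 0 := by
    intro z w hzw h0
    rw [wedgeIntegral_add_wedgeIntegral_eq]
    refine integral_boundary_rect_eq_zero_of_continuousOn_of_differentiableOn g z w
      (hc.mono hzw) fun ζ hζ => ?_
    refine (hd ζ (hzw ?_) fun h => h0 (h ▸ hζ.2)).differentiableWithinAt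
    exact ⟨Ioo_subset_Icc_self hζ.1, Ioo_subset_Icc_self hζ.2⟩
  intro z w hzw
  rw [← add_eq_zero_iff_eq_neg]
  by_cases h0 : (0 : ℝ) ∈ Ioo (min z.im w.im) (max z.im w.im)
  · have h0' : (0 : ℝ) ∈ uIcc z.im w.im := Ioo_subset_Icc_self h0
    have sub1 : Rectangle z (w.re : ℂ) ⊆ Rectangle z w := by
      intro ζ hζ
      refine ⟨by simpa using hζ.1, uIcc_subset_uIcc left_mem_uIcc h0' (by simpa using hζ.2)⟩
    have sub2 : Rectangle (z.re : ℂ) w ⊆ Rectangle z w := by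
      intro ζ hζ
      refine ⟨by simpa using hζ.1, uIcc_subset_uIcc h0' right_mem_uIcc (by simpa using hζ.2)⟩
    have b1 := base z (w.re : ℂ) (sub1.trans hzw) (by
      simp only [ofReal_im, mem_Ioo, min_lt_iff, lt_max_iff, lt_irrefl, or_false]
      intro h; linarith [h.1, h.2])
    have b2 := base (z.re : ℂ) w (sub2.trans hzw) (by
      simp only [ofReal_im, mem_Ioo, min_lt_iff, lt_max_iff, lt_irrefl, false_or]
      intro h; linarith [h.1, h.2])
    have side : ∀ x ∈ uIcc z.re w.re, ∀ a ∈ uIcc z.im w.im, ∀ b ∈ uIcc z.im w.im,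
        IntervalIntegrable (fun y : ℝ => g (x + y * I)) volume a b := by
      intro x hx a ha b hb
      refine ContinuousOn.intervalIntegrable ?_
      refine hc.comp (by fun_prop) fun y hy => hzw ?_
      exact ⟨by simpa using hx, by simpa using uIcc_subset_uIcc ha hb hy⟩
    have a1 := intervalIntegral.integral_add_adjacent_intervals
      (side z.re left_mem_uIcc z.im left_mem_uIcc 0 h0')
      (side z.re left_mem_uIcc 0 h0' w.im right_mem_uIcc)
    have a2 := intervalIntegral.integral_add_adjacent_intervals
      (side w.re right_mem_uIcc z.im left_mem_uIcc 0 h0')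
      (side w.re right_mem_uIcc 0 h0' w.im right_mem_uIcc)
    rw [wedgeIntegral_add_wedgeIntegral_eq] at b1 b2 ⊢
    rw [← a1, ← a2]
    simp only [ofReal_re, ofReal_im, smul_eq_mul] at b1 b2 ⊢
    linear_combination b1 + b2
  · exact base z w hzw h0

theorem dense_slitDomain (k : ℝ) : Dense (slitDomain k) := fun ζ =>
  closure_mono (fun _ h => mem_slitDomain_of_im_ne h) (mem_closure_im_ne ζ)

/-- A function whose limits from the two banks coincide extends to an entire function. -/
theorem exists_entire_extension {f : ℂ → ℂ} (hd : DifferentiableOn ℂ f (slitDomain k))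
    (hl : ∀ j, ∀ ξ ∈ slit k j, ∃ w, Tendsto f (𝓝[slitDomain k] (ξ : ℂ)) (𝓝 w)) :
    ∃ g : ℂ → ℂ, Differentiable ℂ g ∧ EqOn g f (slitDomain k) := by
  refine ⟨extendFrom (slitDomain k) f, ?_, fun ζ hζ => extendFrom_extends hd.continuousOn ζ hζ⟩
  have heq : EqOn (extendFrom (slitDomain k) f) f (slitDomain k) :=
    fun ζ hζ => extendFrom_extends hd.continuousOn ζ hζ
  have hc : Continuous (extendFrom (slitDomain k) f) := by
    refine continuous_extendFrom (dense_slitDomain k) fun ζ => ?_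
    by_cases hζ : ζ ∈ slitDomain k
    · exact ⟨f ζ, hd.continuousOn ζ hζ⟩
    · rw [mem_slitDomain] at hζ
      push Not at hζ
      obtain ⟨j, x, hx, rfl⟩ := hζ
      exact hl j x hx
  rw [← differentiableOn_univ]
  refine differentiableOn_of_continuousOn_of_im_ne isOpen_univ hc.continuousOn fun ζ _ hζ => ?_
  have hU := (isOpen_slitDomain k).mem_nhds (mem_slitDomain_of_im_ne (k := k) hζ)
  exact (hd.differentiableAt hU).congr_of_eventuallyEq (heq.eventuallyEq_of_mem hU)

theorem tendsto_inv_cocompact : Tendsto (fun ζ : ℂ => ζ⁻¹) (cocompact ℂ) (𝓝 0) := by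
  have := tendsto_inv₀_cobounded (α := ℂ)
  rwa [Metric.cobounded_eq_cocompact] at this

theorem tendsto_inv_punctured : Tendsto (fun t : ℂ => t⁻¹) (𝓝[≠] 0) (cocompact ℂ) := by
  rw [← Metric.cobounded_eq_cocompact]
  exact tendsto_inv₀_nhdsNE_zero

/-- Removability of the point at infinity. -/
theorem exists_tendsto_of_isBigO_one {f : ℂ → ℂ}
    (hd : ∀ᶠ ζ in cocompact ℂ, DifferentiableAt ℂ f ζ)
    (hO : f =O[cocompact ℂ] (fun _ => (1 : ℝ))) : ∃ w, Tendsto f (cocompact ℂ) (𝓝 w) := by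
  have h1 : ∀ᶠ t in 𝓝[≠] (0 : ℂ), DifferentiableAt ℂ (fun t => f t⁻¹) t := by
    filter_upwards [tendsto_inv_punctured.eventually hd, self_mem_nhdsWithin] with t ht h0
    exact DifferentiableAt.comp t ht (differentiableAt_inv h0)
  have h2 : (fun t => f t⁻¹) =O[𝓝[≠] (0 : ℂ)] (fun _ => (1 : ℝ)) :=
    hO.comp_tendsto tendsto_inv_punctured
  have h3 : IsBoundedUnder (· ≤ ·) (𝓝[≠] (0 : ℂ)) fun t => ‖f t⁻¹ - f (0 : ℂ)⁻¹‖ := by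
    have := (h2.sub (isBigO_const_const (f (0 : ℂ)⁻¹) (one_ne_zero (α := ℝ)) _))
    exact (isBigO_one_iff ℝ).1 this
  have h4 := tendsto_limUnder_of_differentiable_on_punctured_nhds_of_bounded_under h1 h3
  refine ⟨_, (h4.comp (?_ : Tendsto (fun ζ : ℂ => ζ⁻¹) (cocompact ℂ) (𝓝[≠] 0))).congr
    fun ζ => by simp⟩
  refine tendsto_nhdsWithin_iff.2 ⟨tendsto_inv_cocompact, ?_⟩
  filter_upwards [eventually_one_lt_norm] with ζ h
  exact inv_ne_zero fun h' => by rw [h', norm_zero] at h; linarith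

theorem isBigO_one_id : (fun _ => (1 : ℝ)) =O[cocompact ℂ] (fun ζ : ℂ => ζ) := by
  refine IsBigO.of_bound 1 ?_
  filter_upwards [eventually_one_lt_norm] with ζ h
  simpa using h.le

/-- Division of an entire function by a linear factor. -/
theorem exists_entire_factor {g : ℂ → ℂ} (hg : Differentiable ℂ g) (e : ℂ) :
    ∃ h : ℂ → ℂ, Differentiable ℂ h ∧ ∀ ζ, g ζ = g e + (ζ - e) * h ζ := by
  refine ⟨dslope g e, ?_, fun ζ => ?_⟩
  · rw [← differentiableOn_univ] at hg ⊢
    exact (differentiableOn_dslope univ_mem).2 hg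
  · have := sub_smul_dslope g e ζ
    rw [smul_eq_mul] at this
    rw [this]; ring

/-- An entire function of at most linear growth is a polynomial of degree at most one. -/
theorem exists_affine_of_isBigO_id {g : ℂ → ℂ} (hg : Differentiable ℂ g)
    (hO : g =O[cocompact ℂ] (fun ζ => ζ)) : ∃ b₀ b₁ : ℂ, ∀ ζ, g ζ = b₀ + b₁ * ζ := by
  obtain ⟨h, hd, he⟩ := exists_entire_factor hg 0
  have h1 : h =O[cocompact ℂ] (fun _ => (1 : ℝ)) := by
    have h2 : (fun ζ => g ζ - g 0) =O[cocompact ℂ] (fun ζ : ℂ => ζ) :=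
      hO.sub ((isBigO_const_const _ one_ne_zero _).trans isBigO_one_id)
    have h3 := h2.mul (isBigO_refl (fun ζ : ℂ => ζ⁻¹) (cocompact ℂ))
    have h4 : (fun ζ : ℂ => ζ * ζ⁻¹) =O[cocompact ℂ] (fun _ => (1 : ℝ)) := by
      refine IsBigO.of_bound 1 (Eventually.of_forall fun ζ => ?_)
      by_cases h : ζ = 0 <;> simp [h]
    refine (h3.trans h4).congr' ?_ EventuallyEq.rfl
    filter_upwards [eventually_one_lt_norm] with ζ h
    have h0 : ζ ≠ 0 := fun h' => by rw [h', norm_zero] at h; linarith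
    simp only [he ζ, sub_zero, add_sub_cancel_left]
    field_simp
  obtain ⟨w, hw⟩ := exists_tendsto_of_isBigO_one (Eventually.of_forall hd) h1
  refine ⟨g 0, w, fun ζ => ?_⟩
  rw [he ζ, hd.apply_eq_of_tendsto_cocompact ζ hw, sub_zero, mul_comm]

/-! ### Schwarz problems for regular functions -/

/-- The Schwarz problem `Im f = h` on the banks for functions analytic in the finite part of the
exterior of the slits and continuous up to the slits. -/
structure IsSchwarz (k : ℝ) (h : Fin 2 → Bank → ℝ → ℝ) (f : ℂ → ℂ) : Prop where
  differentiableOn : DifferentiableOn ℂ f (slitDomain k)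
  boundary : ContinuousUpToSlits k f
  im_bank : ∀ j, ∀ ξ ∈ slit k j, ∀ s, Tendsto (fun ζ => (f ζ).im) (bankFilter s ξ) (𝓝 (h j s ξ))

theorem eventually_bank_mem_slitDomain (s : Bank) (ξ : ℝ) :
    ∀ᶠ ζ in bankFilter s ξ, ζ ∈ slitDomain k :=
  bankFilter_le_slitDomain s ξ self_mem_nhdsWithin

theorem ContinuousUpToSlits.congr {f g : ℂ → ℂ} {U : Set ℂ} (hf : ContinuousUpToSlits k f)
    (hU : ∀ j, ∀ ξ ∈ slit k j, U ∈ 𝓝[slitDomain k] (ξ : ℂ)) (hk1 : k < 1) (h : EqOn f g U) :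
    ContinuousUpToSlits k g := by
  refine ⟨fun j ξ hξ s => ?_, fun e he => ?_⟩
  · obtain ⟨w, hw⟩ := hf.1 j ξ hξ s
    exact ⟨w, hw.congr' (h.eventuallyEq_of_mem (bankFilter_le_slitDomain s ξ (hU j ξ hξ)))⟩
  · obtain ⟨w, hw⟩ := hf.2 e he
    obtain ⟨j, hj⟩ := exists_slit_of_tip hk1 he
    exact ⟨w, hw.congr' (h.eventuallyEq_of_mem (hU j e hj))⟩

theorem ContinuousUpToSlits.add {f g : ℂ → ℂ} (hf : ContinuousUpToSlits k f)
    (hg : ContinuousUpToSlits k g) : ContinuousUpToSlits k (fun ζ => f ζ + g ζ) := by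
  refine ⟨fun j ξ hξ s => ?_, fun e he => ?_⟩
  · obtain ⟨w, hw⟩ := hf.1 j ξ hξ s
    obtain ⟨w', hw'⟩ := hg.1 j ξ hξ s
    exact ⟨_, hw.add hw'⟩
  · obtain ⟨w, hw⟩ := hf.2 e he
    obtain ⟨w', hw'⟩ := hg.2 e he
    exact ⟨_, hw.add hw'⟩

theorem ContinuousUpToSlits.const_mul {f : ℂ → ℂ} (hf : ContinuousUpToSlits k f) (c : ℂ) :
    ContinuousUpToSlits k (fun ζ => c * f ζ) := by
  refine ⟨fun j ξ hξ s => ?_, fun e he => ?_⟩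
  · obtain ⟨w, hw⟩ := hf.1 j ξ hξ s
    exact ⟨_, hw.const_mul c⟩
  · obtain ⟨w, hw⟩ := hf.2 e he
    exact ⟨_, hw.const_mul c⟩

theorem continuousUpToSlits_of_continuousAt {f : ℂ → ℂ} (hk1 : k < 1)
    (h : ∀ j, ∀ ξ ∈ slit k j, ContinuousAt f ξ) : ContinuousUpToSlits k f := by
  refine ⟨fun j ξ hξ s => ⟨_, (h j ξ hξ).tendsto.mono_left (bankFilter_le_nhds s ξ)⟩,
    fun e he => ?_⟩
  obtain ⟨j, hj⟩ := exists_slit_of_tip hk1 he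
  exact ⟨_, (h j e hj).tendsto.mono_left nhdsWithin_le_nhds⟩

theorem IsSchwarz.congr {h : Fin 2 → Bank → ℝ → ℝ} {f g : ℂ → ℂ} (hf : IsSchwarz k h f)
    (hk1 : k < 1) (hfg : EqOn f g (slitDomain k)) : IsSchwarz k h g := by
  refine ⟨hf.differentiableOn.congr fun ζ hζ => (hfg hζ).symm,
    hf.boundary.congr (fun _ _ _ => self_mem_nhdsWithin) hk1 hfg, fun j ξ hξ s => ?_⟩
  refine (hf.im_bank j ξ hξ s).congr' ?_
  filter_upwards [eventually_bank_mem_slitDomain s ξ] with ζ hζ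
  rw [hfg hζ]

theorem IsSchwarz.add {h h' : Fin 2 → Bank → ℝ → ℝ} {f g : ℂ → ℂ} (hf : IsSchwarz k h f)
    (hg : IsSchwarz k h' g) :
    IsSchwarz k (fun j s ξ => h j s ξ + h' j s ξ) (fun ζ => f ζ + g ζ) :=
  ⟨hf.differentiableOn.add hg.differentiableOn, hf.boundary.add hg.boundary,
    fun j ξ hξ s => by simpa using (hf.im_bank j ξ hξ s).add (hg.im_bank j ξ hξ s)⟩

theorem IsSchwarz.neg {h : Fin 2 → Bank → ℝ → ℝ} {f : ℂ → ℂ} (hf : IsSchwarz k h f) :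
    IsSchwarz k (fun j s ξ => -h j s ξ) (fun ζ => -f ζ) :=
  ⟨hf.differentiableOn.neg, by simpa using hf.boundary.const_mul (-1),
    fun j ξ hξ s => by simpa using (hf.im_bank j ξ hξ s).neg⟩

theorem isSchwarz_affine (hk1 : k < 1) (b₀ b₁ : ℂ) :
    IsSchwarz k (fun _ _ ξ => b₀.im + b₁.im * ξ) (fun ζ => b₀ + b₁ * ζ) := by
  have hc : Continuous fun ζ : ℂ => b₀ + b₁ * ζ := by fun_prop
  refine ⟨by fun_prop, continuousUpToSlits_of_continuousAt hk1 fun _ _ _ => hc.continuousAt,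
    fun j ξ _ s => ?_⟩
  have : Tendsto (fun ζ : ℂ => (b₀ + b₁ * ζ).im) (bankFilter s ξ) (𝓝 (b₀ + b₁ * (ξ : ℂ)).im) :=
    ((continuous_im.comp hc).tendsto (ξ : ℂ)).mono_left (bankFilter_le_nhds s ξ)
  simpa using this

/-- The value of a function continuous up to the slits at a point of a bank, with its imaginary
part given by the boundary condition. -/
theorem IsSchwarz.exists_tendsto {h : Fin 2 → Bank → ℝ → ℝ} {f : ℂ → ℂ} (hf : IsSchwarz k h f)
    {j : Fin 2} {ξ : ℝ} (hξ : ξ ∈ slit k j) (s : Bank) :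
    ∃ w, Tendsto f (bankFilter s ξ) (𝓝 w) ∧ w.im = h j s ξ := by
  obtain ⟨w, hw⟩ := hf.boundary.1 j ξ hξ s
  exact ⟨w, hw, tendsto_nhds_unique ((continuous_im.tendsto w).comp hw) (hf.im_bank j ξ hξ s)⟩

theorem tendsto_conj_slitDomain (ξ : ℝ) :
    Tendsto (fun ζ : ℂ => conj ζ) (𝓝[slitDomain k] (ξ : ℂ)) (𝓝[slitDomain k] (ξ : ℂ)) := by
  refine tendsto_nhdsWithin_iff.2 ⟨?_, ?_⟩
  · have := (continuous_conj.tendsto (ξ : ℂ)).mono_left (nhdsWithin_le_nhds (s := slitDomain k))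
    simpa using this
  · filter_upwards [self_mem_nhdsWithin] with ζ hζ
    exact conj_mem_slitDomain hζ

theorem differentiableOn_conj_conj {f : ℂ → ℂ} (hf : DifferentiableOn ℂ f (slitDomain k)) :
    DifferentiableOn ℂ (fun ζ => conj (f (conj ζ))) (slitDomain k) := by
  intro ζ hζ
  have h1 := hf.differentiableAt ((isOpen_slitDomain k).mem_nhds (conj_mem_slitDomain hζ))
  have h2 := h1.conj_conj
  rw [conj_conj] at h2
  exact h2.differentiableWithinAt

theorem tendsto_conj_cocompact : Tendsto (fun ζ : ℂ => conj ζ) (cocompact ℂ) (cocompact ℂ) :=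
  conjCLE.toHomeomorph.isClosedEmbedding.tendsto_cocompact

/-- The homogeneous Schwarz problem: the even part `(f + f*)/2`, `f*(ζ)` being the conjugate of
`f(ζ̄)`, and the product of the odd part `(f - f*)/2` with `q` are continuous across the slits.
The former is an affine function, the latter is divisible by `q²` because it vanishes at the four
tips, and the quotient vanishes at infinity. -/
theorem homogeneous_schwarz (hk0 : 0 < k) (hk1 : k < 1) {f : ℂ → ℂ}
    (hf : IsSchwarz k (fun _ _ _ => 0) f) (hO : f =O[cocompact ℂ] (fun ζ => ζ)) :
    ∃ b₀ b₁ : ℝ, ∀ ζ ∈ slitDomain k, f ζ = b₀ + b₁ * ζ := by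
  set fs : ℂ → ℂ := fun ζ => conj (f (conj ζ)) with hfs
  have hfsd : DifferentiableOn ℂ fs (slitDomain k) := differentiableOn_conj_conj hf.differentiableOn
  have hfsO : fs =O[cocompact ℂ] (fun ζ => ζ) := by
    have := hO.comp_tendsto tendsto_conj_cocompact
    rw [← isBigO_norm_norm] at this ⊢
    simpa [hfs, Function.comp_def] using this
  have bank : ∀ j, ∀ ξ ∈ slit k j, ∃ w : Bank → ℂ, ∀ s, Tendsto f (bankFilter s ξ) (𝓝 (w s)) ∧
      Tendsto fs (bankFilter s ξ) (𝓝 (w s.opp)) := by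
    intro j ξ hξ
    choose w hw hwi using fun s => hf.exists_tendsto hξ s
    refine ⟨w, fun s => ⟨hw s, ?_⟩⟩
    have h1 := (continuous_conj.tendsto _).comp ((hw s.opp).comp (tendsto_conj_bank s ξ))
    rwa [conj_eq_iff_im.2 (hwi s.opp)] at h1
  have tip : ∀ e ∈ ({-1, -k, k, 1} : Set ℝ), ∃ w, Tendsto f (𝓝[slitDomain k] (e : ℂ)) (𝓝 w) ∧
      Tendsto fs (𝓝[slitDomain k] (e : ℂ)) (𝓝 (conj w)) := by
    intro e he
    obtain ⟨w, hw⟩ := hf.boundary.2 e he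
    exact ⟨w, hw, (continuous_conj.tendsto _).comp (hw.comp (tendsto_conj_slitDomain e))⟩
  -- the even part
  obtain ⟨E, hE, hEeq⟩ := exists_entire_extension (f := fun ζ => (f ζ + fs ζ) / 2)
    ((hf.differentiableOn.add hfsd).div_const 2) (fun j ξ hξ => by
      rcases mem_openSlit_or_tip hξ with h | h
      · obtain ⟨w, hw⟩ := bank j ξ hξ
        refine ⟨(w Bank.upper + w Bank.lower) / 2, ?_⟩
        rw [nhdsWithin_slitDomain_of_interior h, tendsto_sup]
        refine ⟨((hw _).1.add (hw _).2).div_const 2, ?_⟩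
        rw [add_comm (w Bank.upper)]
        exact ((hw _).1.add (hw _).2).div_const 2
      · obtain ⟨w, h1, h2⟩ := tip ξ h
        exact ⟨_, (h1.add h2).div_const 2⟩)
  -- the odd part
  have hq0 : ∀ j, ∀ ξ ∈ slit k j, ξ ∈ ({-1, -k, k, 1} : Set ℝ) →
      Tendsto (fun ζ => (f ζ - fs ζ) / 2 * branch k ζ) (𝓝[slitDomain k] (ξ : ℂ)) (𝓝 0) := by
    intro j ξ hξ h
    obtain ⟨w, h1, h2⟩ := tip ξ h
    simpa using ((h1.sub h2).div_const 2).mul ((tendsto_branch_tip h).mono_left nhdsWithin_le_nhds)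
  obtain ⟨Q, hQ, hQeq⟩ := exists_entire_extension (f := fun ζ => (f ζ - fs ζ) / 2 * branch k ζ)
    (((hf.differentiableOn.sub hfsd).div_const 2).mul (differentiableOn_branch hk0 hk1))
    (fun j ξ hξ => by
      rcases mem_openSlit_or_tip hξ with h | h
      · obtain ⟨w, hw⟩ := bank j ξ hξ
        refine ⟨(w Bank.upper - w Bank.lower) / 2 * bankV k j Bank.upper ξ, ?_⟩
        rw [nhdsWithin_slitDomain_of_interior h, tendsto_sup]
        refine ⟨(((hw _).1.sub (hw _).2).div_const 2).mul (tendsto_branch_bank hk0 hξ _), ?_⟩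
        have := (((hw Bank.lower).1.sub (hw Bank.lower).2).div_const 2).mul
          (tendsto_branch_bank hk0 hξ Bank.lower)
        convert this using 2
        have hop := bankV_opp k j Bank.upper ξ
        simp only [Bank.opp] at hop ⊢
        rw [hop]; ring
      · exact ⟨0, hq0 j ξ hξ h⟩)
  have hQtip : ∀ e ∈ ({-1, -k, k, 1} : Set ℝ), Q e = 0 := by
    intro e he
    obtain ⟨j, hj⟩ := exists_slit_of_tip hk1 he
    have hne : (𝓝[slitDomain k] (e : ℂ)).NeBot :=
      mem_closure_iff_nhdsWithin_neBot.1 (dense_slitDomain k _)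
    refine tendsto_nhds_unique ((hQ.continuous.tendsto (e : ℂ)).mono_left
      (nhdsWithin_le_nhds (s := slitDomain k))) ?_
    refine (hq0 j e hj he).congr' ?_
    filter_upwards [self_mem_nhdsWithin] with ζ hζ
    exact (hQeq hζ).symm
  -- `Q` is divisible by `(ζ² - 1)(ζ² - k²)`, one tip at a time
  have h1k : (1 : ℂ) ≠ k := by exact_mod_cast hk1.ne'
  have h1k' : (1 : ℂ) ≠ -k := by exact_mod_cast (by linarith : (-k) < 1).ne'
  have h11 : (1 : ℂ) ≠ -1 := by exact_mod_cast (by norm_num : (-1 : ℝ) < 1).ne'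
  have hkk : (k : ℂ) ≠ -k := by exact_mod_cast (by linarith : -k < k).ne'
  have hk1' : (k : ℂ) ≠ -1 := by exact_mod_cast (by linarith : -1 < k).ne'
  have hmk1 : -(k : ℂ) ≠ -1 := by exact_mod_cast (by linarith : -1 < -k).ne'
  obtain ⟨Q1, hQ1, e1⟩ := exists_entire_factor hQ 1
  obtain ⟨Q2, hQ2, e2⟩ := exists_entire_factor hQ1 k
  obtain ⟨Q3, hQ3, e3⟩ := exists_entire_factor hQ2 (-k)
  obtain ⟨Q4, hQ4, e4⟩ := exists_entire_factor hQ3 (-1)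
  have z1 : Q 1 = 0 := by simpa using hQtip 1 (by simp)
  simp only [z1, zero_add] at e1
  have z2 : Q1 k = 0 := by
    have := hQtip k (by simp)
    rw [e1, mul_eq_zero, sub_eq_zero] at this
    exact this.resolve_left (Ne.symm h1k)
  simp only [z2, zero_add] at e2
  have z3 : Q2 (-k) = 0 := by
    have := hQtip (-k) (by simp)
    rw [ofReal_neg, e1, e2, mul_eq_zero, sub_eq_zero, mul_eq_zero, sub_eq_zero] at this
    exact (this.resolve_left (Ne.symm h1k')).resolve_left (Ne.symm hkk)
  simp only [z3, zero_add] at e3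
  have z4 : Q3 (-1) = 0 := by
    have := hQtip (-1) (by simp)
    rw [ofReal_neg, ofReal_one, e1, e2, e3, mul_eq_zero, sub_eq_zero, mul_eq_zero, sub_eq_zero,
      mul_eq_zero, sub_eq_zero] at this
    exact ((this.resolve_left (Ne.symm h11)).resolve_left (Ne.symm hk1')).resolve_left
      (Ne.symm hmk1)
  simp only [z4, zero_add] at e4
  have hQfac : ∀ ζ, Q ζ = branch k ζ ^ 2 * Q4 ζ := fun ζ => by
    rw [e1, e2, e3, e4, branch_sq]; ring
  have hodd : ∀ ζ ∈ slitDomain k, (f ζ - fs ζ) / 2 = branch k ζ * Q4 ζ := by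
    intro ζ hζ
    have h1 := hQeq hζ
    have h2 := branch_ne_zero hk1 hζ
    simp only [hQfac] at h1
    apply mul_right_cancel₀ h2
    rw [← h1]; ring
  have hQ40 : Tendsto Q4 (cocompact ℂ) (𝓝 0) := by
    have b1 := (tendsto_branch_div_sq hk0 hk1).inv₀ one_ne_zero
    have b2 : (fun ζ => (f ζ - fs ζ) / 2) =O[cocompact ℂ] (fun ζ => ζ) := by
      simpa [div_eq_inv_mul] using (hO.sub hfsO).const_mul_left (2⁻¹ : ℂ)
    have b3 := (b2.mul (b1.isBigO_one ℂ)).mul (isBigO_refl (fun ζ : ℂ => (ζ ^ 2)⁻¹) (cocompact ℂ))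
    have b4 : Q4 =O[cocompact ℂ] (fun ζ : ℂ => ζ⁻¹) := by
      refine b3.congr' ?_ ?_
      · filter_upwards [eventually_one_lt_norm] with ζ h
        have h0 : ζ ≠ 0 := fun h' => by rw [h', norm_zero] at h; linarith
        have hm := mem_slitDomain_of_one_lt_norm hk0 h
        have := branch_ne_zero hk1 hm
        rw [hodd ζ hm]
        field_simp
      · filter_upwards [eventually_one_lt_norm] with ζ h
        have h0 : ζ ≠ 0 := fun h' => by rw [h', norm_zero] at h; linarith
        field_simp
    exact b4.trans_tendsto tendsto_inv_cocompact
  have hsymm : ∀ ζ ∈ slitDomain k, f ζ = E ζ := by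
    intro ζ hζ
    have h1 := hodd ζ hζ
    rw [hQ4.apply_eq_of_tendsto_cocompact ζ hQ40, mul_zero] at h1
    have h2 := hEeq hζ
    simp only at h2
    rw [h2]
    linear_combination h1
  -- the odd part vanishes by Liouville's theorem, and the even part is affine
  obtain ⟨b₀, b₁, hb⟩ := exists_affine_of_isBigO_id hE (by
    refine hO.congr' ?_ EventuallyEq.rfl
    filter_upwards [eventually_mem_slitDomain hk0] with ζ hζ using hsymm ζ hζ)
  -- real values at the two ends of one slit make the coefficients real
  have him : ∀ ξ ∈ slit k 1, b₀.im + b₁.im * ξ = 0 := by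
    intro ξ hξ
    have h1 := ((isSchwarz_affine hk1 b₀ b₁).im_bank 1 ξ hξ Bank.upper)
    refine tendsto_nhds_unique h1 ((hf.im_bank 1 ξ hξ Bank.upper).congr' ?_)
    filter_upwards [eventually_bank_mem_slitDomain Bank.upper ξ] with ζ hζ
    rw [hsymm ζ hζ, hb]
  have i1 := him 1 (by rw [slit_one]; exact ⟨hk1.le, le_rfl⟩)
  have i2 := him k (by rw [slit_one]; exact ⟨le_rfl, hk1.le⟩)
  have i3 : b₁.im = 0 := by
    have : b₁.im * (1 - k) = 0 := by linear_combination i1 - i2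
    exact (mul_eq_zero.1 this).resolve_right (by linarith)
  have i4 : b₀.im = 0 := by rw [i3] at i1; linarith
  refine ⟨b₀.re, b₁.re, fun ζ hζ => ?_⟩
  rw [hsymm ζ hζ, hb, show (b₀.re : ℂ) = b₀ from Complex.ext rfl (by simp [i4]),
    show (b₁.re : ℂ) = b₁ from Complex.ext rfl (by simp [i3])]

/-! ### The Riemann-Hilbert problem on the surface as a Schwarz problem -/

theorem tendsto_to_sheetOne (hk0 : 0 < k) {j : Fin 2} {ξ : ℝ} (hξ : ξ ∈ slit k j) (s : Bank) :
    Tendsto (fun ζ => (ζ, branch k ζ)) (bankFilter s ξ) (𝓝[sheetOne k] loopPoint k j s ξ) := by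
  refine tendsto_nhdsWithin_iff.2 ⟨?_, ?_⟩
  · exact (tendsto_id.mono_left (bankFilter_le_nhds s ξ)).prodMk_nhds (tendsto_branch_bank hk0 hξ s)
  · filter_upwards [eventually_bank_mem_slitDomain s ξ] with ζ hζ
    exact ⟨hζ, rfl⟩

theorem tendsto_to_sheetTwo (hk0 : 0 < k) {j : Fin 2} {ξ : ℝ} (hξ : ξ ∈ slit k j) (s : Bank) :
    Tendsto (fun ζ => (ζ, -branch k ζ)) (bankFilter s.opp ξ)
      (𝓝[sheetTwo k] loopPoint k j s ξ) := by
  refine tendsto_nhdsWithin_iff.2 ⟨?_, ?_⟩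
  · have h := (tendsto_branch_bank hk0 hξ s.opp).neg
    rw [bankV_opp, neg_neg] at h
    exact (tendsto_id.mono_left (bankFilter_le_nhds _ ξ)).prodMk_nhds h
  · filter_upwards [eventually_bank_mem_slitDomain s.opp ξ] with ζ hζ
    exact ⟨hζ, rfl⟩

theorem bankV_ne_zero (hk0 : 0 < k) {j : Fin 2} {ξ : ℝ} (hξ : ξ ∈ openSlit k j) (s : Bank) :
    bankV k j s ξ ≠ 0 := by
  have h1 := (absq_pos hk0 hξ).ne'
  have h2 := s.sgn_ne_zero
  have h3 : sg j ≠ 0 := left_ne_zero_of_mul_eq_one (sg_mul_self j)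
  simp [bankV, h1, h2, h3]

/-- Near an interior point of a loop the values of `q` tell the two banks apart. -/
theorem tendsto_fst_of_tendsto_branch (hk0 : 0 < k) {j : Fin 2} {ξ : ℝ} (hξ : ξ ∈ openSlit k j)
    (s : Bank) {α : Type*} {l : Filter α} {z : α → ℂ} (hz : Tendsto z l (𝓝[slitDomain k] (ξ : ℂ)))
    (hq : Tendsto (fun a => branch k (z a)) l (𝓝 (bankV k j s ξ))) :
    Tendsto z l (bankFilter s ξ) := by
  have hs := openSlit_subset k j hξ
  refine tendsto_nhdsWithin_iff.2 ⟨hz.mono_right nhdsWithin_le_nhds, ?_⟩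
  have hne : bankV k j s ξ ≠ bankV k j s.opp ξ := by
    rw [bankV_opp]
    exact fun h => bankV_ne_zero hk0 hξ s (self_eq_neg.1 h)
  obtain ⟨U, V, hU, hV, hUs, hVs, hd⟩ := t2_separation hne
  have h1 : ∀ᶠ ζ in bankFilter s.opp ξ, branch k ζ ∈ V :=
    (tendsto_branch_bank hk0 hs s.opp).eventually (hV.mem_nhds hVs)
  have h2 : ∀ᶠ ζ in 𝓝[slitDomain k] (ξ : ℂ), branch k ζ ∈ U → 0 < s.sgn * ζ.im := by
    have h3 : 𝓝[slitDomain k] (ξ : ℂ) = bankFilter s ξ ⊔ bankFilter s.opp ξ := by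
      rw [nhdsWithin_slitDomain_of_interior hξ]
      cases s
      · rfl
      · exact sup_comm _ _
    rw [h3]
    refine eventually_sup.2 ⟨?_, ?_⟩
    · filter_upwards [self_mem_nhdsWithin] with ζ hζ _ using hζ
    · filter_upwards [h1] with ζ hζ hζ'
      exact absurd hζ (disjoint_left.1 hd hζ')
  filter_upwards [hz.eventually h2, hq.eventually (hU.mem_nhds hUs)] with a ha ha'
  exact ha ha'

theorem tendsto_fst_sheetOne (k : ℝ) (j : Fin 2) (s : Bank) (ξ : ℝ) :
    Tendsto (Prod.fst : ℂ × ℂ → ℂ) (𝓝[sheetOne k] loopPoint k j s ξ)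
      (𝓝[slitDomain k] (ξ : ℂ)) := by
  refine tendsto_nhdsWithin_iff.2 ⟨?_, ?_⟩
  · exact (continuous_fst.tendsto (loopPoint k j s ξ)).mono_left nhdsWithin_le_nhds
  · filter_upwards [self_mem_nhdsWithin] with p hp using hp.1

theorem tendsto_fst_sheetTwo (k : ℝ) (j : Fin 2) (s : Bank) (ξ : ℝ) :
    Tendsto (Prod.fst : ℂ × ℂ → ℂ) (𝓝[sheetTwo k] loopPoint k j s ξ)
      (𝓝[slitDomain k] (ξ : ℂ)) := by
  refine tendsto_nhdsWithin_iff.2 ⟨?_, ?_⟩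
  · exact (continuous_fst.tendsto (loopPoint k j s ξ)).mono_left nhdsWithin_le_nhds
  · filter_upwards [self_mem_nhdsWithin] with p hp using hp.1

/-- A function continuous up to the slits, lifted to a sheet, is continuous up to the loops. -/
theorem ContinuousUpToSlits.tendsto_sheet (hk0 : 0 < k) {f : ℂ → ℂ}
    (hf : ContinuousUpToSlits k f) {j : Fin 2} {ξ : ℝ} (hξ : ξ ∈ slit k j) (s : Bank) {w : ℂ}
    (hw : Tendsto f (bankFilter s ξ) (𝓝 w)) {α : Type*} {l : Filter α} {z : α → ℂ}
    (hz : Tendsto z l (𝓝[slitDomain k] (ξ : ℂ)))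
    (hq : Tendsto (fun a => branch k (z a)) l (𝓝 (bankV k j s ξ))) :
    Tendsto (fun a => f (z a)) l (𝓝 w) := by
  rcases mem_openSlit_or_tip hξ with h | h
  · exact hw.comp (tendsto_fst_of_tendsto_branch hk0 h s hz hq)
  · obtain ⟨w', hw'⟩ := hf.2 ξ h
    rw [tendsto_nhds_unique hw (hw'.mono_left (bankFilter_le_slitDomain s ξ))]
    exact hw'.comp hz

/-- A symmetric function on the surface is determined by its restriction to the first sheet, and
its limits from the two sheets at a point of a loop are complex conjugates of each other: the jump
condition prescribes the imaginary part on the banks. The tips need no separate condition on the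
surface, where the two banks of a loop meet in a single point. -/
theorem isRHSolution_iff (hk0 : 0 < k) (hk1 : k < 1) {h : Fin 2 → Bank → ℝ → ℝ} {Φ : ℂ × ℂ → ℂ} :
    IsRHSolution k h Φ ↔ IsSchwarz k h (fun ζ => Φ (ζ, branch k ζ)) ∧
      ∀ ζ ∈ slitDomain k, Φ (ζ, -branch k ζ) = conj (Φ (conj ζ, branch k (conj ζ))) := by
  constructor
  · intro H
    have hsym : ∀ ζ ∈ slitDomain k, Φ (ζ, -branch k ζ) = conj (Φ (conj ζ, branch k (conj ζ))) := by
      intro ζ hζ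
      have := H.symmetric (ζ, -branch k ζ) (Or.inr ⟨hζ, rfl⟩)
      simp only [symm, map_neg, neg_neg] at this
      rw [← this, branch_conj hk0 hk1 hζ]
    refine ⟨⟨H.analytic_one, ⟨fun j ξ hξ s => ?_, fun e he => ?_⟩, fun j ξ hξ s => ?_⟩, hsym⟩
    · obtain ⟨wp, wm, h1, h2, h3⟩ := H.jump j ξ hξ s
      exact ⟨wp, h1.comp (tendsto_to_sheetOne hk0 hξ s)⟩
    · obtain ⟨j, hj⟩ := exists_slit_of_tip hk1 he
      obtain ⟨wp, wm, h1, h2, h3⟩ := H.jump j e hj Bank.upper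
      refine ⟨wp, h1.comp (tendsto_nhdsWithin_iff.2 ⟨?_, ?_⟩)⟩
      · have : loopPoint k j Bank.upper e = ((e : ℂ), 0) := by simp [loopPoint, bankV, absq_tip he]
        rw [this]
        exact (tendsto_id.mono_left nhdsWithin_le_nhds).prodMk_nhds
          ((tendsto_branch_tip he).mono_left nhdsWithin_le_nhds)
      · filter_upwards [self_mem_nhdsWithin] with ζ hζ using ⟨hζ, rfl⟩
    · obtain ⟨wp, wm, h1, h2, h3⟩ := H.jump j ξ hξ s
      have l1 := h1.comp (tendsto_to_sheetOne hk0 hξ s)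
      have l2 := (continuous_conj.tendsto _).comp
        ((h2.comp (tendsto_to_sheetTwo hk0 hξ s)).comp (tendsto_conj_bank s ξ))
      have l3 : Tendsto ((fun p => Φ p) ∘ fun ζ => (ζ, branch k ζ)) (bankFilter s ξ)
          (𝓝 (conj wm)) := by
        refine l2.congr' ?_
        filter_upwards [eventually_bank_mem_slitDomain (k := k) s ξ] with ζ hζ
        simp [hsym _ (conj_mem_slitDomain hζ)]
      have e1 : wp = conj wm := tendsto_nhds_unique l1 l3
      have e2 : wp.im = h j s ξ := by
        have := congrArg Complex.im h3
        rw [← conj_conj wm, ← e1] at this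
        simp at this
        linarith
      rw [← e2]
      exact (continuous_im.tendsto wp).comp l1
  · rintro ⟨H, hsym⟩
    have hsym' : ∀ ζ ∈ slitDomain k, conj (Φ (conj ζ, -branch k (conj ζ))) = Φ (ζ, branch k ζ) := by
      intro ζ hζ
      rw [hsym _ (conj_mem_slitDomain hζ)]
      simp
    refine ⟨H.differentiableOn, ?_, ?_, fun j ξ hξ s => ?_⟩
    · exact (differentiableOn_conj_conj H.differentiableOn).congr hsym
    · rintro ⟨ζ, u⟩ (⟨hζ, hu⟩ | ⟨hζ, hu⟩)
      · simp only at hζ hu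
        rw [hu, symm, ← branch_conj hk0 hk1 hζ]
        exact hsym' ζ hζ
      · simp only at hζ hu
        rw [hu, symm, hsym ζ hζ, branch_conj hk0 hk1 hζ]
        simp
    · obtain ⟨w, hw, hwi⟩ := H.exists_tendsto hξ s
      refine ⟨w, conj w, ?_, ?_, ?_⟩
      · have hq : Tendsto (fun p : ℂ × ℂ => branch k p.1) (𝓝[sheetOne k] loopPoint k j s ξ)
            (𝓝 (bankV k j s ξ)) := by
          refine ((continuous_snd.tendsto (loopPoint k j s ξ)).mono_left
            nhdsWithin_le_nhds).congr' ?_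
          filter_upwards [self_mem_nhdsWithin] with p hp using hp.2
        refine (H.boundary.tendsto_sheet hk0 hξ s hw (tendsto_fst_sheetOne k j s ξ) hq).congr' ?_
        filter_upwards [self_mem_nhdsWithin] with p hp
        rw [← hp.2]
      · have hz := (tendsto_conj_slitDomain (k := k) ξ).comp (tendsto_fst_sheetTwo k j s ξ)
        have hq : Tendsto (fun p : ℂ × ℂ => branch k (conj p.1)) (𝓝[sheetTwo k] loopPoint k j s ξ)
            (𝓝 (bankV k j s ξ)) := by
          have h1 : Tendsto (fun p : ℂ × ℂ => -conj p.2) (𝓝[sheetTwo k] loopPoint k j s ξ)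
              (𝓝 (-conj (bankV k j s ξ))) :=
            (Continuous.tendsto (by fun_prop) (loopPoint k j s ξ)).mono_left nhdsWithin_le_nhds
          rw [conj_bankV, neg_neg] at h1
          refine h1.congr' ?_
          filter_upwards [self_mem_nhdsWithin] with p hp
          rw [hp.2, branch_conj hk0 hk1 hp.1]
          simp
        refine ((continuous_conj.tendsto w).comp
          (H.boundary.tendsto_sheet hk0 hξ s hw hz hq)).congr' ?_
        filter_upwards [self_mem_nhdsWithin] with p hp
        have := hsym p.1 hp.1
        rw [← hp.2] at this
        exact this.symm
      · rw [sub_conj, hwi]; push_cast; ring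

theorem lift_one (k : ℝ) (f : ℂ → ℂ) (ζ : ℂ) : lift k f (ζ, branch k ζ) = f ζ := by simp [lift]

theorem lift_two (hk1 : k < 1) (f : ℂ → ℂ) {ζ : ℂ} (h : ζ ∈ slitDomain k) :
    lift k f (ζ, -branch k ζ) = conj (f (conj ζ)) := by
  have : -branch k ζ ≠ branch k ζ := fun h' => branch_ne_zero hk1 h (neg_eq_self.1 h')
  simp [lift, this]

theorem isRHSolution_lift_iff (hk0 : 0 < k) (hk1 : k < 1) {h : Fin 2 → Bank → ℝ → ℝ} {f : ℂ → ℂ} :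
    IsRHSolution k h (lift k f) ↔ IsSchwarz k h f := by
  rw [isRHSolution_iff hk0 hk1]
  simp only [lift_one]
  exact and_iff_left fun ζ hζ => lift_two hk1 f hζ

/-- A symmetric function has the same growth at the two infinite points. -/
theorem isBigO_sheetTwo (hk0 : 0 < k) {Φ : ℂ × ℂ → ℂ} {n : ℕ}
    (hsym : ∀ ζ ∈ slitDomain k, Φ (ζ, -branch k ζ) = conj (Φ (conj ζ, branch k (conj ζ))))
    (hO : (fun ζ => Φ (ζ, branch k ζ)) =O[cocompact ℂ] (fun ζ : ℂ => ζ ^ n)) :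
    (fun ζ => Φ (ζ, -branch k ζ)) =O[cocompact ℂ] (fun ζ : ℂ => ζ ^ n) := by
  have h1 := hO.comp_tendsto tendsto_conj_cocompact
  rw [← isBigO_norm_norm] at h1 ⊢
  refine h1.congr' ?_ ?_
  · filter_upwards [eventually_mem_slitDomain hk0] with ζ hζ
    simp [hsym ζ hζ]
  · exact Eventually.of_forall fun ζ => by simp

theorem isBigO_pow_zero {f : ℂ → ℂ} : f =O[cocompact ℂ] (fun ζ : ℂ => ζ ^ 0) ↔
    f =O[cocompact ℂ] (fun _ => (1 : ℝ)) := by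
  simp only [pow_zero]
  exact ⟨fun h => h.trans (isBigO_const_const _ one_ne_zero _),
    fun h => h.trans (isBigO_const_const _ one_ne_zero _)⟩

theorem boundedAtInfinities_iff (hk0 : 0 < k) {Φ : ℂ × ℂ → ℂ}
    (hsym : ∀ ζ ∈ slitDomain k, Φ (ζ, -branch k ζ) = conj (Φ (conj ζ, branch k (conj ζ)))) :
    BoundedAtInfinities k Φ ↔ (fun ζ => Φ (ζ, branch k ζ)) =O[cocompact ℂ] (fun _ => (1 : ℝ)) := by
  refine and_iff_left_of_imp fun h => ?_
  rw [← isBigO_pow_zero] at h ⊢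
  exact isBigO_sheetTwo hk0 hsym h

theorem boundedAtInfinities_lift_iff (hk0 : 0 < k) (hk1 : k < 1) (f : ℂ → ℂ) :
    BoundedAtInfinities k (lift k f) ↔ f =O[cocompact ℂ] (fun _ => (1 : ℝ)) := by
  rw [boundedAtInfinities_iff hk0 fun ζ hζ => by rw [lift_two hk1 f hζ, lift_one]]
  simp only [lift_one]

theorem simplePolesAtInfinities_iff (hk0 : 0 < k) {Φ : ℂ × ℂ → ℂ}
    (hsym : ∀ ζ ∈ slitDomain k, Φ (ζ, -branch k ζ) = conj (Φ (conj ζ, branch k (conj ζ)))) :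
    SimplePolesAtInfinities k Φ ↔
      (fun ζ => Φ (ζ, branch k ζ)) =O[cocompact ℂ] (fun ζ : ℂ => ζ) := by
  refine and_iff_left_of_imp fun h => ?_
  simpa using isBigO_sheetTwo (n := 1) hk0 hsym (by simpa using h)

theorem isBigO_affine (b₀ b₁ : ℂ) : (fun ζ => b₀ + b₁ * ζ) =O[cocompact ℂ] (fun ζ : ℂ => ζ) :=
  ((isBigO_const_const _ one_ne_zero _).trans isBigO_one_id).add
    ((isBigO_refl (fun ζ : ℂ => ζ) _).const_mul_left b₁)

/-- A particular solution `g` of the Schwarz problem determines the general solution of the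
Riemann-Hilbert problem with at most simple poles at the infinite points. -/
theorem rh_general_solution (hk0 : 0 < k) (hk1 : k < 1) {h : Fin 2 → Bank → ℝ → ℝ} {g : ℂ → ℂ}
    (hg : IsSchwarz k h g) (hgO : g =O[cocompact ℂ] (fun ζ => ζ)) (Φ : ℂ × ℂ → ℂ) :
    (IsRHSolution k h Φ ∧ SimplePolesAtInfinities k Φ) ↔
      ∃ b₀ b₁ : ℝ, ∀ p ∈ sheetOne k ∪ sheetTwo k, Φ p = b₀ + b₁ * p.1 + lift k g p := by
  rw [isRHSolution_iff hk0 hk1]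
  constructor
  · rintro ⟨⟨H, hsym⟩, hO⟩
    have hO1 := hO.1
    have hd : IsSchwarz k (fun _ _ _ => 0) (fun ζ => Φ (ζ, branch k ζ) + -g ζ) := by
      have := H.add hg.neg
      simpa using this
    obtain ⟨b₀, b₁, hb⟩ := homogeneous_schwarz hk0 hk1 hd (hO1.add hgO.neg_left)
    refine ⟨b₀, b₁, ?_⟩
    rintro ⟨ζ, u⟩ (⟨hζ, hu⟩ | ⟨hζ, hu⟩)
    · simp only at hζ hu
      rw [hu, lift_one]
      linear_combination hb ζ hζ
    · simp only at hζ hu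
      have h1 := hb _ (conj_mem_slitDomain hζ)
      rw [hu, hsym ζ hζ, lift_two hk1 _ hζ]
      rw [← sub_eq_add_neg, sub_eq_iff_eq_add] at h1
      rw [h1]; simp
  · rintro ⟨b₀, b₁, hb⟩
    have h1 : ∀ ζ ∈ slitDomain k, b₀ + b₁ * ζ + g ζ = Φ (ζ, branch k ζ) := fun ζ hζ => by
      rw [hb _ (Or.inl ⟨hζ, rfl⟩), lift_one]
    have hsym : ∀ ζ ∈ slitDomain k, Φ (ζ, -branch k ζ) = conj (Φ (conj ζ, branch k (conj ζ))) := by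
      intro ζ hζ
      rw [hb _ (Or.inr ⟨hζ, rfl⟩), ← h1 _ (conj_mem_slitDomain hζ), lift_two hk1 _ hζ]
      simp
    refine ⟨⟨?_, hsym⟩, (simplePolesAtInfinities_iff hk0 hsym).2 ?_⟩
    · have := ((isSchwarz_affine hk1 b₀ b₁).add hg).congr hk1 h1
      simpa using this
    · refine ((isBigO_affine b₀ b₁).add hgO).congr' ?_ EventuallyEq.rfl
      filter_upwards [eventually_mem_slitDomain hk0] with ζ hζ using h1 ζ hζ

end

section

variable {k : ℝ}

/-! ### Cauchy integrals over compact subsets of the real line -/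

/-- The Cauchy integral `∫_S φ(η) dη/(η - ζ)` of a real density. -/
def cauchyInt (φ : ℝ → ℝ) (S : Set ℝ) (ζ : ℂ) : ℂ := ∫ η in S, (φ η : ℂ) / ((η : ℂ) - ζ)

variable {S : Set ℝ} {φ ψ : ℝ → ℝ}

theorem exists_dist_le (hS : IsCompact S) {ζ₀ : ℂ} (h : ∀ η ∈ S, (η : ℂ) ≠ ζ₀) :
    ∃ r > 0, ∀ ζ ∈ Metric.ball ζ₀ r, ∀ η ∈ S, r ≤ ‖(η : ℂ) - ζ‖ := by
  have h1 : ((fun x : ℝ => (x : ℂ)) '' S)ᶜ ∈ 𝓝 ζ₀ := by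
    refine (hS.image continuous_ofReal).isClosed.isOpen_compl.mem_nhds ?_
    rintro ⟨x, hx, hx'⟩
    exact h x hx hx'
  obtain ⟨r, hr, hb⟩ := Metric.mem_nhds_iff.1 h1
  refine ⟨r / 2, by positivity, fun ζ hζ η hη => ?_⟩
  by_contra! hlt
  rw [Metric.mem_ball] at hζ
  have : (η : ℂ) ∈ Metric.ball ζ₀ r := by
    rw [Metric.mem_ball]
    calc dist (η : ℂ) ζ₀ ≤ dist (η : ℂ) ζ + dist ζ ζ₀ := dist_triangle _ _ _
      _ < r / 2 + r / 2 := by rw [dist_eq_norm]; linarith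
      _ = r := by ring
  exact hb this ⟨η, hη, rfl⟩

theorem integrableOn_mul_continuousOn (hS : IsCompact S) (hφ : IntegrableOn φ S) {g : ℝ → ℂ}
    (hg : ContinuousOn g S) : IntegrableOn (fun η => (φ η : ℂ) * g η) S :=
  IntegrableOn.mul_continuousOn (g := fun η => (φ η : ℂ)) (Integrable.ofReal hφ) hg hS

theorem integrableOn_cauchy (hS : IsCompact S) (hφ : IntegrableOn φ S) {ζ : ℂ}
    (h : ∀ η ∈ S, (η : ℂ) ≠ ζ) : IntegrableOn (fun η => (φ η : ℂ) / ((η : ℂ) - ζ)) S := by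
  simp only [div_eq_mul_inv]
  exact integrableOn_mul_continuousOn hS hφ
    (ContinuousOn.inv₀ (by fun_prop) fun η hη => sub_ne_zero.2 (h η hη))

theorem hasDerivAt_cauchyInt (hS : IsCompact S) (hφ : IntegrableOn φ S) {ζ₀ : ℂ}
    (h : ∀ η ∈ S, (η : ℂ) ≠ ζ₀) :
    HasDerivAt (cauchyInt φ S) (∫ η in S, (φ η : ℂ) / ((η : ℂ) - ζ₀) ^ 2) ζ₀ := by
  obtain ⟨r, hr, hb⟩ := exists_dist_le hS h
  have hne : ∀ ζ ∈ Metric.ball ζ₀ r, ∀ η ∈ S, (η : ℂ) ≠ ζ := fun ζ hζ η hη he => by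
    have := hb ζ hζ η hη
    rw [he, sub_self, norm_zero] at this; linarith
  have hm : ∀ᵐ η ∂(volume.restrict S), η ∈ S := ae_restrict_mem hS.measurableSet
  refine (hasDerivAt_integral_of_dominated_loc_of_deriv_le (𝕜 := ℂ)
    (F := fun ζ η => (φ η : ℂ) / ((η : ℂ) - ζ)) (F' := fun ζ η => (φ η : ℂ) / ((η : ℂ) - ζ) ^ 2)
    (Metric.ball_mem_nhds ζ₀ hr)
    (bound := fun η => ‖φ η‖ * (r ^ 2)⁻¹) ?_ ?_ ?_ ?_ ?_ ?_).2
  · filter_upwards [Metric.ball_mem_nhds ζ₀ hr] with ζ hζ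
    exact (integrableOn_cauchy hS hφ (hne ζ hζ)).aestronglyMeasurable
  · exact integrableOn_cauchy hS hφ h
  · simp only [div_eq_mul_inv]
    exact (integrableOn_mul_continuousOn hS hφ (ContinuousOn.inv₀ (by fun_prop) fun η hη =>
      pow_ne_zero 2 (sub_ne_zero.2 (h η hη)))).aestronglyMeasurable
  · filter_upwards [hm] with η hη ζ hζ
    rw [norm_div, norm_pow, norm_real, div_eq_mul_inv]
    have := hb ζ hζ η hη
    gcongr
  · exact Integrable.mul_const hφ.norm _
  · filter_upwards [hm] with η hη ζ hζ
    have h0 := sub_ne_zero.2 (hne ζ hζ η hη)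
    have h1 := ((hasDerivAt_id ζ).const_sub (η : ℂ)).inv h0
    simpa [div_eq_mul_inv] using h1.const_mul (φ η : ℂ)

theorem continuousAt_cauchyInt (hS : IsCompact S) (hφ : IntegrableOn φ S) {ζ₀ : ℂ}
    (h : ∀ η ∈ S, (η : ℂ) ≠ ζ₀) : ContinuousAt (cauchyInt φ S) ζ₀ :=
  (hasDerivAt_cauchyInt hS hφ h).continuousAt

theorem cauchyInt_add (hS : IsCompact S) (hφ : IntegrableOn φ S) (hψ : IntegrableOn ψ S) {ζ : ℂ}
    (h : ∀ η ∈ S, (η : ℂ) ≠ ζ) :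
    cauchyInt (fun η => φ η + ψ η) S ζ = cauchyInt φ S ζ + cauchyInt ψ S ζ := by
  unfold cauchyInt
  rw [← integral_add (integrableOn_cauchy hS hφ h) (integrableOn_cauchy hS hψ h)]
  congr 1; ext η; push_cast; ring

theorem cauchyInt_const_mul (c : ℝ) (φ : ℝ → ℝ) (S : Set ℝ) (ζ : ℂ) :
    cauchyInt (fun η => c * φ η) S ζ = c * cauchyInt φ S ζ := by
  unfold cauchyInt
  rw [← integral_const_mul]
  congr 1; ext η; push_cast; ring

theorem cauchyInt_congr (hS : IsCompact S) (h : EqOn φ ψ S) (ζ : ℂ) :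
    cauchyInt φ S ζ = cauchyInt ψ S ζ :=
  setIntegral_congr_fun hS.measurableSet fun η hη => by simp only [h hη]

theorem cauchyInt_conj (φ : ℝ → ℝ) (S : Set ℝ) (ζ : ℂ) :
    cauchyInt φ S (conj ζ) = conj (cauchyInt φ S ζ) := by
  unfold cauchyInt
  rw [← integral_conj]
  simp

theorem cauchyInt_ofReal (φ : ℝ → ℝ) (S : Set ℝ) (ξ : ℝ) :
    cauchyInt φ S ξ = ((∫ η in S, φ η / (η - ξ) : ℝ) : ℂ) := by
  unfold cauchyInt
  rw [← integral_complex_ofReal]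
  simp

theorem cauchyInt_im_ofReal (φ : ℝ → ℝ) (S : Set ℝ) (ξ : ℝ) : (cauchyInt φ S ξ).im = 0 := by
  rw [cauchyInt_ofReal, ofReal_im]

theorem tendsto_cauchyInt_cocompact (hS : IsCompact S) (hφ : IntegrableOn φ S) :
    Tendsto (cauchyInt φ S) (cocompact ℂ) (𝓝 0) := by
  obtain ⟨R, hR⟩ := hS.isBounded.exists_norm_le
  have h1 : Tendsto (fun ζ : ℂ => (∫ η in S, ‖φ η‖) * (‖ζ‖ - R)⁻¹) (cocompact ℂ) (𝓝 0) := by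
    have : Tendsto (fun ζ : ℂ => ‖ζ‖ - R) (cocompact ℂ) atTop :=
      tendsto_atTop_add_const_right _ _ tendsto_norm_cocompact_atTop
    simpa using (tendsto_inv_atTop_zero.comp this).const_mul (∫ η in S, ‖φ η‖)
  refine squeeze_zero_norm' ?_ h1
  filter_upwards [(tendsto_norm_cocompact_atTop (E := ℂ)).eventually_gt_atTop R] with ζ hζ
  rw [← integral_mul_const]
  refine norm_integral_le_of_norm_le (Integrable.mul_const hφ.norm _) ?_
  filter_upwards [ae_restrict_mem hS.measurableSet] with η hη
  rw [norm_div, norm_real, div_eq_mul_inv]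
  have h2 : ‖ζ‖ - R ≤ ‖(η : ℂ) - ζ‖ := by
    have := norm_sub_norm_le ζ (η : ℂ)
    rw [norm_real, norm_sub_rev] at this
    linarith [hR η hη]
  have h3 : 0 < ‖ζ‖ - R := by linarith
  gcongr

/-- The expansion of a Cauchy integral at infinity. -/
theorem mul_cauchyInt (hS : IsCompact S) (hφ : IntegrableOn φ S) {ζ : ℂ}
    (h : ∀ η ∈ S, (η : ℂ) ≠ ζ) :
    ζ * cauchyInt φ S ζ = -((∫ η in S, φ η : ℝ) : ℂ) + cauchyInt (fun η => η * φ η) S ζ := by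
  have h2 : IntegrableOn (fun η => -(φ η : ℂ)) S := (Integrable.ofReal hφ).neg
  unfold cauchyInt
  rw [← integral_const_mul, ← integral_complex_ofReal, ← integral_neg, ← integral_add h2]
  · refine setIntegral_congr_fun hS.measurableSet fun η hη => ?_
    have := sub_ne_zero.2 (h η hη)
    push_cast
    field_simp
    ring
  · refine integrableOn_cauchy (φ := fun η => η * φ η) hS ?_ h
    exact hφ.continuousOn_mul continuousOn_id hS

theorem tendsto_mul_cauchyInt (hS : IsCompact S) (hφ : IntegrableOn φ S) :
    Tendsto (fun ζ => ζ * cauchyInt φ S ζ) (cocompact ℂ) (𝓝 (-((∫ η in S, φ η : ℝ) : ℂ))) := by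
  have h1 : IntegrableOn (fun η => η * φ η) S := hφ.continuousOn_mul continuousOn_id hS
  have h2 := (tendsto_cauchyInt_cocompact hS h1).const_add (-((∫ η in S, φ η : ℝ) : ℂ))
  rw [add_zero] at h2
  refine h2.congr' ?_
  obtain ⟨R, hR⟩ := hS.isBounded.exists_norm_le
  filter_upwards [(tendsto_norm_cocompact_atTop (E := ℂ)).eventually_gt_atTop R] with ζ hζ
  refine (mul_cauchyInt hS hφ fun η hη he => ?_).symm
  have := hR η hη
  rw [← he, norm_real] at hζ
  linarith

/-- `∫_S φ(η) (f(η) - f(ζ))/(η - ζ) dη`, the regular part of the Cauchy integral with density `φf`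
for a function `f` that is analytic near `S`. -/
def cauchyRem (φ : ℝ → ℝ) (S : Set ℝ) (f : ℂ → ℂ) (ζ : ℂ) : ℂ :=
  ∫ η in S, (φ η : ℂ) * ((f η - f ζ) / ((η : ℂ) - ζ))

/-- The difference quotient of `f` is bounded by a Lipschitz constant for `η` near `ζ₀` and by
a bound for `|f(η)| + |f(ζ)|` over the distance for `η` away from `ζ₀`, so that dominated convergence
applies even if `ζ₀` lies on `S`. -/
theorem continuousAt_cauchyRem (hS : IsCompact S) (hφ : IntegrableOn φ S) {U : Set ℂ}
    (hU : IsOpen U) {f : ℂ → ℂ} (hf : DifferentiableOn ℂ f U) (hSU : ∀ η ∈ S, (η : ℂ) ∈ U)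
    {ζ₀ : ℂ} (hζ₀ : ζ₀ ∈ U) : ContinuousAt (cauchyRem φ S f) ζ₀ := by
  have hfS : ContinuousOn (fun η : ℝ => f η) S :=
    hf.continuousOn.comp continuous_ofReal.continuousOn hSU
  obtain ⟨M, hM⟩ := (hS.image_of_continuousOn hfS).isBounded.exists_norm_le
  obtain ⟨L, t, ht, hL⟩ := ((hf.analyticAt (hU.mem_nhds hζ₀)).contDiffAt (n := 1)).exists_lipschitzOnWith
  have hc : ContinuousAt f ζ₀ := hf.continuousOn.continuousAt (hU.mem_nhds hζ₀)
  obtain ⟨r, hr, hrt⟩ := Metric.mem_nhds_iff.1 ht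
  have hbd : ∀ᶠ ζ in 𝓝 ζ₀, ‖f ζ‖ ≤ ‖f ζ₀‖ + 1 :=
    (hc.norm.eventually_lt continuousAt_const (by linarith)).mono fun _ h => le_of_lt h
  refine continuousAt_of_dominated
    (bound := fun η => ‖φ η‖ * (L + (M + (‖f ζ₀‖ + 1)) * (r / 2)⁻¹)) ?_ ?_ ?_ ?_
  · refine Eventually.of_forall fun ζ => ?_
    refine (Integrable.ofReal hφ).aestronglyMeasurable.mul ?_
    refine AEStronglyMeasurable.mul (f := fun η : ℝ => f η - f ζ) ?_ ?_
    · exact (hfS.aestronglyMeasurable hS.measurableSet).sub aestronglyMeasurable_const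
    · exact (Measurable.inv (by fun_prop)).aestronglyMeasurable
  · filter_upwards [hbd, Metric.ball_mem_nhds ζ₀ (half_pos hr)] with ζ h1 h2
    filter_upwards [ae_restrict_mem hS.measurableSet] with η hη
    rw [norm_mul, norm_real, norm_div]
    have hM0 : 0 ≤ M := (norm_nonneg _).trans (hM _ ⟨η, hη, rfl⟩)
    refine mul_le_mul_of_nonneg_left ?_ (norm_nonneg _)
    rw [Metric.mem_ball] at h2
    by_cases h3 : (η : ℂ) ∈ Metric.ball ζ₀ r
    · have h4 := hL.dist_le_mul (η : ℂ) (hrt h3) ζ (hrt (by rw [Metric.mem_ball]; linarith))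
      rw [dist_eq_norm, dist_eq_norm] at h4
      have h5 : ‖f η - f ζ‖ / ‖(η : ℂ) - ζ‖ ≤ L := div_le_of_le_mul₀ (norm_nonneg _) L.2 h4
      have h6 : 0 ≤ (M + (‖f ζ₀‖ + 1)) * (r / 2)⁻¹ := by positivity
      linarith
    · rw [Metric.mem_ball, not_lt] at h3
      have h4 : r / 2 ≤ ‖(η : ℂ) - ζ‖ := by
        have := dist_triangle (η : ℂ) ζ ζ₀
        rw [← dist_eq_norm]; linarith
      have h5 : ‖f η - f ζ‖ ≤ M + (‖f ζ₀‖ + 1) :=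
        (norm_sub_le _ _).trans (add_le_add (hM _ ⟨η, hη, rfl⟩) h1)
      have h6 : ‖f η - f ζ‖ / ‖(η : ℂ) - ζ‖ ≤ (M + (‖f ζ₀‖ + 1)) * (r / 2)⁻¹ := by
        rw [div_eq_mul_inv]
        gcongr
      have := L.2
      linarith
  · exact Integrable.mul_const hφ.norm _
  · have h0 : ∀ᵐ η ∂(volume.restrict S), η ≠ ζ₀.re :=
      ae_restrict_of_ae (Measure.ae_ne volume ζ₀.re)
    filter_upwards [h0] with η hη
    refine ContinuousAt.const_mul ?_ _
    refine ContinuousAt.div (continuousAt_const.sub hc) (by fun_prop) ?_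
    exact sub_ne_zero.2 fun h => hη (by simp [← h])

/-- An analytic factor of the density can be taken out of a Cauchy integral up to a regular term. -/
theorem cauchyInt_mul (hS : IsCompact S) (hφ : IntegrableOn φ S) {f : ℂ → ℂ} {g : ℝ → ℝ}
    (hfg : ∀ η ∈ S, f η = g η) (hg : ContinuousOn g S) {ζ : ℂ} (h : ∀ η ∈ S, (η : ℂ) ≠ ζ) :
    cauchyInt (fun η => φ η * g η) S ζ = f ζ * cauchyInt φ S ζ + cauchyRem φ S f ζ := by
  unfold cauchyInt cauchyRem
  rw [← integral_const_mul, ← integral_add]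
  · refine setIntegral_congr_fun hS.measurableSet fun η hη => ?_
    have := sub_ne_zero.2 (h η hη)
    simp only [hfg η hη]
    push_cast
    field_simp
    ring
  · exact (integrableOn_cauchy hS hφ h).const_mul _
  · have : ContinuousOn (fun η : ℝ => ((g η : ℂ) - f ζ) / ((η : ℂ) - ζ)) S := by
      refine ContinuousOn.div ?_ (by fun_prop) fun η hη => sub_ne_zero.2 (h η hη)
      exact (continuous_ofReal.comp_continuousOn hg).sub continuousOn_const
    refine (integrableOn_mul_continuousOn hS hφ this).congr_fun (fun η hη => ?_) hS.measurableSet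
    simp only [hfg η hη]

theorem cauchyRem_im_ofReal (hS : IsCompact S) {f : ℂ → ℂ} {g : ℝ → ℝ}
    (hfg : ∀ η ∈ S, f η = g η) {ξ : ℝ} (hξ : ξ ∈ S) : (cauchyRem φ S f ξ).im = 0 := by
  have : cauchyRem φ S f ξ = ((∫ η in S, φ η * ((g η - g ξ) / (η - ξ)) : ℝ) : ℂ) := by
    unfold cauchyRem
    rw [← integral_complex_ofReal]
    refine setIntegral_congr_fun hS.measurableSet fun η hη => ?_
    simp only [hfg η hη, hfg ξ hξ]
    push_cast; ring
  rw [this, ofReal_im]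

/-! ### Principal values and vertical limits of Cauchy integrals -/

theorem HasPV.pv_eq {f : ℝ → ℝ} {ξ J : ℝ} (h : HasPV f S ξ J) : pv f S ξ = J := h.2.limUnder_eq

/-- The integral of `dη/(η - ζ)` over a symmetric interval about `ξ`, for `ζ = ξ ± iε`. -/
theorem integral_inv_sub_vertical (s : Bank) (ξ : ℝ) {δ ε : ℝ} (hε : 0 < ε) :
    ∫ η in (ξ - δ)..(ξ + δ), ((η : ℂ) - (ξ + s.sgn * ε * I))⁻¹ =
      s.sgn * (2 * Real.arctan (δ / ε)) * I := by
  have hd : ∀ η : ℝ, HasDerivAt (fun η : ℝ => ((Real.log ((η - ξ) ^ 2 + ε ^ 2) / 2 : ℝ) : ℂ) +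
      s.sgn * ((Real.arctan ((η - ξ) / ε) : ℝ) : ℂ) * I)
      (((η : ℂ) - (ξ + s.sgn * ε * I))⁻¹) η := by
    intro η
    have hpos : 0 < (η - ξ) ^ 2 + ε ^ 2 := by positivity
    have h0 : HasDerivAt (fun η : ℝ => η - ξ) 1 η := (hasDerivAt_id η).sub_const ξ
    have h1 := (((h0.pow 2).add_const (ε ^ 2)).log hpos.ne').div_const 2
    have h2 := (h0.div_const ε).arctan
    have h3 := h1.ofReal_comp.add ((h2.ofReal_comp.const_mul (s.sgn : ℂ)).mul_const I)
    refine h3.congr_deriv ?_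
    have e1 : (((η - ξ) ^ 2 + ε ^ 2 : ℝ) : ℂ) ≠ 0 := ofReal_ne_zero.2 hpos.ne'
    have e2 : (ε : ℂ) ≠ 0 := ofReal_ne_zero.2 hε.ne'
    have e3 : ((η : ℂ) - (ξ + s.sgn * ε * I)) * ((η - ξ) + s.sgn * ε * I) =
        (((η - ξ) ^ 2 + ε ^ 2 : ℝ) : ℂ) := by
      have : (s.sgn : ℂ) * s.sgn = 1 := by exact_mod_cast s.sgn_mul_self
      push_cast
      linear_combination (-(s.sgn * s.sgn * ε ^ 2) : ℂ) * I_sq + (ε : ℂ) ^ 2 * this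
    have e4 : (1 + ((η - ξ) / ε) ^ 2 : ℝ) = ((η - ξ) ^ 2 + ε ^ 2) / ε ^ 2 := by
      field_simp; ring
    rw [e4, inv_eq_of_mul_eq_one_right (b := ((η - ξ) + s.sgn * ε * I) / (((η - ξ) ^ 2 + ε ^ 2 : ℝ) : ℂ))
      (by rw [← mul_div_assoc, e3, div_self e1])]
    simp only [Pi.pow_apply]
    push_cast at e1 ⊢
    field_simp
  rw [intervalIntegral.integral_eq_sub_of_hasDerivAt (fun η _ => hd η)]
  · have : (ξ - δ - ξ) / ε = -(δ / ε) := by ring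
    rw [this, Real.arctan_neg]
    simp only [add_sub_cancel_left]
    push_cast
    simp only [sub_sub_cancel_left, neg_sq]
    ring_nf
  · refine Continuous.intervalIntegrable ?_ _ _
    refine Continuous.inv₀ (by fun_prop) fun η h => ?_
    have := congrArg Complex.im h
    simp at this
    exact this.elim s.sgn_ne_zero hε.ne'

/-- The Sokhotski-Plemelj formula along the normal, for a density that is Lipschitz at `ξ`. -/
theorem plemelj_interior (hS : IsCompact S) (hφ : IntegrableOn φ S) {ξ : ℝ} (hξ : S ∈ 𝓝 ξ)
    (hL : (fun η => φ η - φ ξ) =O[𝓝 ξ] (fun η => η - ξ)) :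
    HasPV φ S ξ (pv φ S ξ) ∧ ∀ s : Bank,
      Tendsto (fun ε : ℝ => cauchyInt φ S (ξ + s.sgn * ε * I)) (𝓝[>] 0)
        (𝓝 (pv φ S ξ + s.sgn * (Real.pi * φ ξ : ℝ) * I)) := by
  obtain ⟨M, hM⟩ := hL.bound
  obtain ⟨δ, hδ, hδS⟩ := Metric.mem_nhds_iff.1 (inter_mem hξ hM)
  rw [Real.ball_eq_Ioo] at hδS
  set J := Ioo (ξ - δ) (ξ + δ) with hJ
  have hM0 : 0 ≤ M := by
    have h1 : ξ + δ / 2 ∈ J := ⟨by linarith, by linarith⟩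
    have h2 := (norm_nonneg _).trans (hδS h1).2
    have h3 : 0 < ‖ξ + δ / 2 - ξ‖ := by simp; positivity
    exact nonneg_of_mul_nonneg_left h2 h3
  have hJS : J ⊆ S := fun η h => (hδS h).1
  have hmS := hS.measurableSet
  have hfin : volume S < ⊤ := hS.measure_lt_top
  -- `φ` minus its value at `ξ` on the interval `J`
  set ψ : ℝ → ℝ := fun η => φ η - J.indicator (fun _ => φ ξ) η with hψ
  have hind : IntegrableOn (J.indicator (fun _ => φ ξ)) S :=
    (integrableOn_const hfin.ne).indicator measurableSet_Ioo
  have hψi : IntegrableOn ψ S := hφ.sub hind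
  have hbound : ∀ η ∈ S, |ψ η| ≤ (M + |φ η| * δ⁻¹) * |η - ξ| := by
    intro η hη
    by_cases h : η ∈ J
    · have h1 := (hδS h).2
      simp only [mem_ofPred_eq, Real.norm_eq_abs] at h1
      simp only [hψ, indicator_of_mem h]
      have : 0 ≤ |φ η| * δ⁻¹ * |η - ξ| := by positivity
      linarith
    · simp only [hψ, indicator_of_notMem h, sub_zero]
      have h1 : δ ≤ |η - ξ| := by
        by_contra! h2
        rw [abs_lt] at h2
        exact h ⟨by linarith [h2.1], by linarith [h2.2]⟩
      have h2 : |φ η| ≤ |φ η| * δ⁻¹ * |η - ξ| := by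
        rw [mul_assoc]
        refine le_mul_of_one_le_right (abs_nonneg _) ?_
        rw [inv_mul_eq_div, one_le_div hδ]; exact h1
      have : 0 ≤ M * |η - ξ| := by positivity
      linarith
  have hbi : IntegrableOn (fun η => M + |φ η| * δ⁻¹) S :=
    (integrableOn_const hfin.ne).add (hφ.abs.mul_const _)
  have hae : ∀ᵐ η ∂(volume.restrict S), η ≠ ξ := ae_restrict_of_ae (Measure.ae_ne volume ξ)
  have hmem : ∀ᵐ η ∂(volume.restrict S), η ∈ S := ae_restrict_mem hmS
  have hdiv : ∀ η ∈ S, |ψ η / (η - ξ)| ≤ M + |φ η| * δ⁻¹ := by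
    intro η hη
    rw [abs_div]
    refine div_le_of_le_mul₀ (abs_nonneg _) (by positivity) (hbound η hη)
  have hψm : AEStronglyMeasurable ψ (volume.restrict S) := hψi.aestronglyMeasurable
  have hψdi : IntegrableOn (fun η => ψ η / (η - ξ)) S := by
    refine Integrable.mono' hbi ?_ ?_
    · exact hψm.mul (Measurable.inv (by fun_prop)).aestronglyMeasurable
    · filter_upwards [hmem] with η hη using hdiv η hη
  -- integrals over the complement of a symmetric neighbourhood
  have hint : ∀ {χ : ℝ → ℝ}, IntegrableOn χ S → ∀ ε > 0,
      IntegrableOn (fun η => χ η / (η - ξ)) (S \ Ioo (ξ - ε) (ξ + ε)) := by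
    intro χ hχ ε hε
    have hχ' : IntegrableOn χ (S \ Ioo (ξ - ε) (ξ + ε)) := hχ.mono_set sdiff_subset
    refine Integrable.mono' (hχ'.abs.mul_const ε⁻¹) ?_ ?_
    · exact hχ'.aestronglyMeasurable.mul (Measurable.inv (by fun_prop)).aestronglyMeasurable
    · filter_upwards [ae_restrict_mem (hmS.diff measurableSet_Ioo)] with η hη
      rw [norm_div, div_eq_mul_inv, Real.norm_eq_abs, Real.norm_eq_abs]
      have h1 : ε ≤ |η - ξ| := by
        by_contra! h2
        rw [abs_lt] at h2
        exact hη.2 ⟨by linarith [h2.1], by linarith [h2.2]⟩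
      gcongr
  -- the constant part contributes nothing: the integrand is odd under reflection about `ξ`
  have hodd : ∀ ε > 0, ∫ η in S \ Ioo (ξ - ε) (ξ + ε),
      J.indicator (fun _ => φ ξ) η / (η - ξ) = 0 := by
    intro ε hε
    rw [← integral_indicator (hmS.diff measurableSet_Ioo)]
    set g : ℝ → ℝ := (S \ Ioo (ξ - ε) (ξ + ε)).indicator
      (fun η => J.indicator (fun _ => φ ξ) η / (η - ξ)) with hg
    have h1 : ∀ η, g (2 * ξ - η) = -g η := by
      intro η
      have e1 : 2 * ξ - η ∈ J ↔ η ∈ J := by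
        simp only [hJ, mem_Ioo]; constructor <;> rintro ⟨a, b⟩ <;> constructor <;> linarith
      have e2 : 2 * ξ - η ∈ Ioo (ξ - ε) (ξ + ε) ↔ η ∈ Ioo (ξ - ε) (ξ + ε) := by
        simp only [mem_Ioo]; constructor <;> rintro ⟨a, b⟩ <;> constructor <;> linarith
      by_cases hη : η ∈ J
      · by_cases hη' : η ∈ Ioo (ξ - ε) (ξ + ε)
        · have n1 : 2 * ξ - η ∉ S \ Ioo (ξ - ε) (ξ + ε) := fun h => h.2 (e2.2 hη')
          have n2 : η ∉ S \ Ioo (ξ - ε) (ξ + ε) := fun h => h.2 hη'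
          rw [hg, indicator_of_notMem n1, indicator_of_notMem n2, neg_zero]
        · have n1 : 2 * ξ - η ∈ S \ Ioo (ξ - ε) (ξ + ε) :=
            ⟨hJS (e1.2 hη), fun h => hη' (e2.1 h)⟩
          have n2 : η ∈ S \ Ioo (ξ - ε) (ξ + ε) := ⟨hJS hη, hη'⟩
          rw [hg, indicator_of_mem n1, indicator_of_mem n2, indicator_of_mem hη, indicator_of_mem (e1.2 hη),
            show 2 * ξ - η - ξ = -(η - ξ) by ring, div_neg]
      · have hη2 : 2 * ξ - η ∉ J := fun h => hη (e1.1 h)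
        have n1 : ∀ x ∉ J, g x = 0 := fun x hx => by
          simp only [hg, indicator, hx, if_false, zero_div, ite_self]
        rw [n1 _ hη, n1 _ hη2, neg_zero]
    have h2 := integral_sub_left_eq_self g volume (2 * ξ)
    simp only [h1, integral_neg] at h2
    linarith
  have hpv : HasPV φ S ξ (∫ η in S, ψ η / (η - ξ)) := by
    refine ⟨fun ε hε => hint hφ ε hε, ?_⟩
    have h1 : ∀ ε > 0, ∫ η in S \ Ioo (ξ - ε) (ξ + ε), φ η / (η - ξ) =
        ∫ η in S, ((Ioo (ξ - ε) (ξ + ε))ᶜ).indicator (fun η => ψ η / (η - ξ)) η := by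
      intro ε hε
      rw [setIntegral_indicator measurableSet_Ioo.compl, ← sdiff_eq,
        ← add_zero (∫ η in S \ Ioo (ξ - ε) (ξ + ε), ψ η / (η - ξ)), ← hodd ε hε,
        ← integral_add (hint hψi ε hε) (hint hind ε hε)]
      congr 1; ext η; simp only [hψ]; ring
    have h2 : Tendsto (fun ε : ℝ => ∫ η in S,
        ((Ioo (ξ - ε) (ξ + ε))ᶜ).indicator (fun η => ψ η / (η - ξ)) η) (𝓝[>] 0)
        (𝓝 (∫ η in S, ψ η / (η - ξ))) := by
      refine tendsto_integral_filter_of_dominated_convergence _ ?_ ?_ hbi ?_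
      · exact Eventually.of_forall fun ε =>
          hψdi.aestronglyMeasurable.indicator measurableSet_Ioo.compl
      · refine Eventually.of_forall fun ε => ?_
        filter_upwards [hmem] with η hη
        exact (norm_indicator_le_norm_self _ _).trans (hdiv η hη)
      · filter_upwards [hae] with η hη
        have h3 : 0 < |η - ξ| := abs_pos.2 (sub_ne_zero.2 hη)
        refine tendsto_const_nhds.congr' ?_
        filter_upwards [Ioo_mem_nhdsGT h3] with ε hε
        rw [indicator_of_mem]
        intro h4
        have : |η - ξ| < ε := abs_lt.2 ⟨by linarith [h4.1], by linarith [h4.2]⟩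
        linarith [hε.2]
    refine h2.congr' ?_
    filter_upwards [self_mem_nhdsWithin] with ε hε
    exact (h1 ε hε).symm
  rw [hpv.pv_eq]
  refine ⟨hpv, fun s => ?_⟩
  have hnr : ∀ ε : ℝ, 0 < ε → ∀ η : ℝ, (η : ℂ) ≠ ξ + s.sgn * ε * I := fun ε hε η h => by
    have := congrArg Complex.im h
    simp at this
    exact this.elim s.sgn_ne_zero hε.ne'
  have hsplit : ∀ ε : ℝ, 0 < ε → cauchyInt φ S (ξ + s.sgn * ε * I) =
      (∫ η in S, (ψ η : ℂ) / ((η : ℂ) - (ξ + s.sgn * ε * I))) +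
        φ ξ * (s.sgn * (2 * Real.arctan (δ / ε)) * I) := by
    intro ε hε
    rw [← integral_inv_sub_vertical s ξ hε, intervalIntegral.integral_of_le (by linarith),
      integral_Ioc_eq_integral_Ioo, ← hJ, ← integral_const_mul]
    have h1 : ∫ η in J, (φ ξ : ℂ) * ((η : ℂ) - (ξ + s.sgn * ε * I))⁻¹ =
        cauchyInt (J.indicator (fun _ => φ ξ)) S (ξ + s.sgn * ε * I) := by
      rw [cauchyInt, ← inter_eq_self_of_subset_right hJS, ← setIntegral_indicator (show MeasurableSet J from measurableSet_Ioo),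
        inter_eq_self_of_subset_right hJS]
      refine setIntegral_congr_fun hmS fun η _ => ?_
      by_cases h : η ∈ J
      · simp only [indicator_of_mem h, div_eq_mul_inv]
      · simp only [indicator_of_notMem h, ofReal_zero, zero_div]
    rw [h1]
    have h2 := cauchyInt_add (φ := ψ) hS hψi hind fun η _ => hnr ε hε η
    simp only [hψ, sub_add_cancel] at h2
    exact h2
  have hlim1 : Tendsto (fun ε : ℝ => ∫ η in S, (ψ η : ℂ) / ((η : ℂ) - (ξ + s.sgn * ε * I)))
      (𝓝[>] 0) (𝓝 (((∫ η in S, ψ η / (η - ξ) : ℝ) : ℂ))) := by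
    rw [← integral_complex_ofReal]
    refine tendsto_integral_filter_of_dominated_convergence _ ?_ ?_ hbi ?_
    · filter_upwards [self_mem_nhdsWithin] with ε hε
      exact (integrableOn_cauchy hS hψi fun η _ => hnr ε hε η).aestronglyMeasurable
    · refine Eventually.of_forall fun ε => ?_
      filter_upwards [hmem] with η hη
      rw [norm_div, norm_real, Real.norm_eq_abs]
      refine div_le_of_le_mul₀ (norm_nonneg _) (by positivity) ((hbound η hη).trans ?_)
      refine mul_le_mul_of_nonneg_left ?_ (by positivity)
      have := abs_re_le_norm ((η : ℂ) - (ξ + s.sgn * ε * I))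
      simpa using this
    · filter_upwards [hae] with η hη
      have h1 : (η : ℂ) - ξ ≠ 0 := sub_ne_zero.2 fun h => hη (ofReal_inj.1 h)
      have h2 : ContinuousAt (fun ε : ℝ => (ψ η : ℂ) / ((η : ℂ) - (ξ + s.sgn * ε * I))) 0 := by
        refine ContinuousAt.div (by fun_prop) (by fun_prop) (by simpa using h1)
      have h3 := h2.tendsto.mono_left (nhdsWithin_le_nhds (s := Ioi 0))
      simpa using h3
  have hlim2 : Tendsto (fun ε : ℝ => (φ ξ : ℂ) * (s.sgn * (2 * Real.arctan (δ / ε)) * I)) (𝓝[>] 0)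
      (𝓝 (φ ξ * (s.sgn * (2 * (Real.pi / 2 : ℝ)) * I))) := by
    have h1 : Tendsto (fun ε : ℝ => δ / ε) (𝓝[>] 0) atTop :=
      tendsto_inv_nhdsGT_zero.const_mul_atTop hδ
    have h2 := (Real.tendsto_arctan_atTop.mono_right nhdsWithin_le_nhds).comp h1
    have h3 := (continuous_ofReal.tendsto _).comp h2
    exact ((((h3.const_mul 2).const_mul _).mul_const I).const_mul _)
  have := hlim1.add hlim2
  refine (this.congr' ?_).trans_eq ?_
  · filter_upwards [self_mem_nhdsWithin] with ε hε
    exact (hsplit ε hε).symm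
  · congr 1
    push_cast; ring

theorem plemelj_exterior (hS : IsCompact S) (hφ : IntegrableOn φ S) {ξ : ℝ} (hξ : ξ ∉ S) :
    HasPV φ S ξ (pv φ S ξ) ∧ ∀ s : Bank,
      Tendsto (fun ε : ℝ => cauchyInt φ S (ξ + s.sgn * ε * I)) (𝓝[>] 0) (𝓝 (pv φ S ξ)) := by
  have hne : ∀ η ∈ S, (η : ℂ) ≠ ξ := fun η hη h => hξ (ofReal_inj.1 h ▸ hη)
  have hint : IntegrableOn (fun η => φ η / (η - ξ)) S := by
    simp only [div_eq_mul_inv]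
    exact hφ.mul_continuousOn (ContinuousOn.inv₀ (by fun_prop)
      fun η hη h => hξ (sub_eq_zero.1 h ▸ hη)) hS
  have hpv : HasPV φ S ξ (∫ η in S, φ η / (η - ξ)) := by
    refine ⟨fun ε _ => hint.mono_set sdiff_subset, tendsto_const_nhds.congr' ?_⟩
    obtain ⟨r, hr, hb⟩ := Metric.mem_nhds_iff.1 (hS.isClosed.isOpen_compl.mem_nhds hξ)
    rw [Real.ball_eq_Ioo] at hb
    filter_upwards [Ioo_mem_nhdsGT hr] with ε hε
    congr 2
    refine (sdiff_eq_left.2 (disjoint_left.2 fun η hη h => ?_)).symm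
    exact hb ⟨by linarith [h.1, hε.2], by linarith [h.2, hε.2]⟩ hη
  rw [hpv.pv_eq]
  refine ⟨hpv, fun s => ?_⟩
  rw [← cauchyInt_ofReal]
  exact (continuousAt_cauchyInt hS hφ hne).tendsto.comp
    ((tendsto_vertical s ξ).mono_right (bankFilter_le_nhds s ξ))

end

section

variable {k : ℝ}

/-! ### The weight `1/|q|` and the period identity -/

theorem absq_neg (k η : ℝ) : absq k (-η) = absq k η := by simp [absq]

theorem mem_slit_zero_iff {η : ℝ} : -η ∈ slit k 0 ↔ η ∈ slit k 1 := by
  rw [slit_zero, slit_one, mem_Icc, mem_Icc]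
  constructor <;> rintro ⟨h1, h2⟩ <;> constructor <;> linarith

theorem setIntegral_slit_zero (f : ℝ → ℂ) :
    ∫ η in slit k 0, f η = ∫ η in slit k 1, f (-η) := by
  rw [← (Measure.measurePreserving_neg (volume : Measure ℝ)).setIntegral_preimage_emb
    (Homeomorph.neg ℝ).measurableEmbedding]
  congr 2
  ext η
  exact mem_slit_zero_iff

/-- An explicit primitive of `2η/|q(η)|` on `(k, 1)`, elementary because the integrand is a function
of `η²` times `dη²`. -/
theorem hasDerivAt_arcsin_weight (hk0 : 0 < k) (hk1 : k < 1) {η : ℝ} (h : η ∈ Ioo k 1) :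
    HasDerivAt (fun η : ℝ => Real.arcsin ((2 * η ^ 2 - 1 - k ^ 2) / (1 - k ^ 2)))
      (2 * η / absq k η) η := by
  have hη : η ∈ openSlit k 1 := by rwa [openSlit_one]
  have hq := absq_pos hk0 hη
  have hq2 := absq_sq hk0 (openSlit_subset k 1 hη)
  have hk2 : 0 < 1 - k ^ 2 := by nlinarith
  set x := (2 * η ^ 2 - 1 - k ^ 2) / (1 - k ^ 2) with hx
  have h1 : 1 - x ^ 2 = (2 * absq k η / (1 - k ^ 2)) ^ 2 := by
    rw [hx, div_pow, div_pow, mul_pow, hq2]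
    field_simp
    ring
  have h2 : √(1 - x ^ 2) = 2 * absq k η / (1 - k ^ 2) := by
    rw [h1, Real.sqrt_sq (by positivity)]
  have h3 : 0 < 1 - x ^ 2 := by rw [h1]; positivity
  have h4 : HasDerivAt (fun η : ℝ => (2 * η ^ 2 - 1 - k ^ 2) / (1 - k ^ 2))
      (4 * η / (1 - k ^ 2)) η := by
    have := ((((hasDerivAt_id η).pow 2).const_mul 2).sub_const 1 |>.sub_const (k ^ 2)).div_const
      (1 - k ^ 2)
    refine this.congr_deriv ?_
    simp; ring
  have h5 := (Real.hasDerivAt_arcsin (x := x) (by rintro h; rw [h] at h3; norm_num at h3)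
    (by rintro h; rw [h] at h3; norm_num at h3)).comp η h4
  refine h5.congr_deriv ?_
  rw [h2]
  field_simp
  ring

theorem integrableOn_weight_one (hk0 : 0 < k) (hk1 : k < 1) :
    IntegrableOn (fun η => 2 * η / absq k η) (slit k 1) := by
  rw [slit_one, integrableOn_Icc_iff_integrableOn_Ioc]
  refine intervalIntegral.integrableOn_deriv_of_nonneg ?_
    (fun η h => hasDerivAt_arcsin_weight hk0 hk1 h) fun η h => ?_
  · exact (Real.continuous_arcsin.comp (by fun_prop)).continuousOn
  · have : 0 < η := hk0.trans h.1
    have := absq_nonneg k η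
    positivity

theorem integral_weight_one (hk0 : 0 < k) (hk1 : k < 1) :
    ∫ η in slit k 1, 2 * η / absq k η = Real.pi := by
  have hk2 : 1 - k ^ 2 ≠ 0 := by nlinarith
  rw [slit_one, integral_Icc_eq_integral_Ioc, ← intervalIntegral.integral_of_le hk1.le,
    intervalIntegral.integral_eq_sub_of_hasDerivAt_of_le hk1.le _
      (fun η h => hasDerivAt_arcsin_weight hk0 hk1 h)]
  · have e1 : (2 * (1 : ℝ) ^ 2 - 1 - k ^ 2) / (1 - k ^ 2) = 1 := by field_simp; ring
    have e2 : (2 * k ^ 2 - 1 - k ^ 2) / (1 - k ^ 2) = -1 := by field_simp; ring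
    simp only [e1, e2, Real.arcsin_one, Real.arcsin_neg]
    ring
  · rw [intervalIntegrable_iff_integrableOn_Icc_of_le hk1.le, ← slit_one]
    exact integrableOn_weight_one hk0 hk1
  · exact (Real.continuous_arcsin.comp (by fun_prop)).continuousOn

theorem integrableOn_inv_absq (hk0 : 0 < k) (hk1 : k < 1) (j : Fin 2) :
    IntegrableOn (fun η => 1 / absq k η) (slit k j) := by
  have h1 : IntegrableOn (fun η => 1 / absq k η) (slit k 1) := by
    have hc : ContinuousOn (fun η : ℝ => (2 * η)⁻¹) (slit k 1) := by
      refine ContinuousOn.inv₀ (by fun_prop) fun η hη => ?_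
      rw [slit_one] at hη
      have := hk0.trans_le hη.1
      positivity
    refine ((integrableOn_weight_one hk0 hk1).mul_continuousOn hc (isCompact_slit k 1)).congr_fun
      (fun η hη => ?_) (measurableSet_slit k 1)
    rw [slit_one] at hη
    have : η ≠ 0 := (hk0.trans_le hη.1).ne'
    field_simp
  fin_cases j
  · have h2 : slit k 0 = Neg.neg ⁻¹' slit k 1 := by
      ext η
      rw [mem_preimage, ← mem_slit_zero_iff, neg_neg]
    have h3 := (Measure.measurePreserving_neg (volume : Measure ℝ)).integrableOn_comp_preimage
      (Homeomorph.neg ℝ).measurableEmbedding (f := fun η => 1 / absq k η) (s := slit k 1)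
    simp only [Fin.zero_eta]
    rw [h2]
    have h4 := h3.2 h1
    simpa [Function.comp_def, absq_neg] using h4
  · exact h1

theorem integral_inv_absq_zero (k : ℝ) :
    ∫ η in slit k 0, 1 / absq k η = ∫ η in slit k 1, 1 / absq k η := by
  have := setIntegral_slit_zero (k := k) (fun η => ((1 / absq k η : ℝ) : ℂ))
  simp only [absq_neg] at this
  rw [integral_complex_ofReal, integral_complex_ofReal] at this
  exact_mod_cast this

theorem integral_inv_absq_pos (hk0 : 0 < k) (hk1 : k < 1) :
    0 < ∫ η in slit k 1, 1 / absq k η := by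
  have h1 := integrableOn_inv_absq hk0 hk1 1
  rw [slit_one] at h1 ⊢
  rw [integral_Icc_eq_integral_Ioc, ← intervalIntegral.integral_of_le hk1.le]
  refine intervalIntegral.intervalIntegral_pos_of_pos_on ?_ (fun η hη => ?_) hk1
  · rwa [intervalIntegrable_iff_integrableOn_Icc_of_le hk1.le]
  · have := absq_pos (j := 1) hk0 (by rwa [openSlit_one])
    positivity

/-- `K_j(ζ) = ∫_{l_j} dη/(|q(η)|(η - ζ))`. -/
def periodInt (k : ℝ) (j : Fin 2) : ℂ → ℂ := cauchyInt (fun η => 1 / absq k η) (slit k j)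

theorem hasDerivAt_periodInt (hk0 : 0 < k) (hk1 : k < 1) {ζ : ℂ} (h : ζ ∈ slitDomain k)
    (j : Fin 2) : HasDerivAt (periodInt k j)
      (∫ η in slit k j, ((1 / absq k η : ℝ) : ℂ) / ((η : ℂ) - ζ) ^ 2) ζ :=
  hasDerivAt_cauchyInt (isCompact_slit k j) (integrableOn_inv_absq hk0 hk1 j)
    (mem_slitDomain.1 h j)

theorem sq_sub_sq_ne_zero {ζ : ℂ} (h : ζ ∈ slitDomain k) {η : ℝ} (hη : η ∈ slit k 1) :
    ζ ^ 2 - (η : ℂ) ^ 2 ≠ 0 := by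
  have h1 := mem_slitDomain.1 h 1 η hη
  have h0 := mem_slitDomain.1 h 0 (-η) (mem_slit_zero_iff.2 hη)
  push_cast at h0
  rw [sq_sub_sq]
  exact mul_ne_zero (fun h => h0 (by linear_combination -h)) (fun h => h1 (by linear_combination -h))

theorem sub_ne_zero_of_mem {ζ : ℂ} (h : ζ ∈ slitDomain k) {η : ℝ} (hη : η ∈ slit k 1) :
    (η : ℂ) - ζ ≠ 0 ∧ -(η : ℂ) - ζ ≠ 0 := by
  have h1 := mem_slitDomain.1 h 1 η hη
  have h0 := mem_slitDomain.1 h 0 (-η) (mem_slit_zero_iff.2 hη)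
  push_cast at h0
  exact ⟨sub_ne_zero.2 h1, sub_ne_zero.2 h0⟩

/-- The total derivative of `|q(η)|/(ζ² - η²)` integrates to zero over the slit. -/
theorem integral_deriv_eq_zero (hk0 : 0 < k) (hk1 : k < 1) {ζ : ℂ} (h : ζ ∈ slitDomain k) :
    ∫ η in slit k 1, ((1 / absq k η : ℝ) : ℂ) * (η * ((1 + (k : ℂ) ^ 2 - 2 * η ^ 2) *
      (ζ ^ 2 - η ^ 2) + 2 * ((1 - η ^ 2) * (η ^ 2 - (k : ℂ) ^ 2))) / (ζ ^ 2 - η ^ 2) ^ 2) = 0 := by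
  have hc : ContinuousOn (fun η : ℝ => (η * ((1 + (k : ℂ) ^ 2 - 2 * η ^ 2) *
      (ζ ^ 2 - η ^ 2) + 2 * ((1 - η ^ 2) * (η ^ 2 - (k : ℂ) ^ 2))) / (ζ ^ 2 - η ^ 2) ^ 2 : ℂ))
      (slit k 1) :=
    ContinuousOn.div (by fun_prop) (by fun_prop) fun η hη => pow_ne_zero 2 (sq_sub_sq_ne_zero h hη)
  have hi := integrableOn_mul_continuousOn (isCompact_slit k 1) (integrableOn_inv_absq hk0 hk1 1) hc
  rw [slit_one] at hi ⊢
  rw [integral_Icc_eq_integral_Ioc, ← intervalIntegral.integral_of_le hk1.le,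
    intervalIntegral.integral_eq_sub_of_hasDerivAt_of_le hk1.le
      (f := fun η : ℝ => (absq k η : ℂ) / (ζ ^ 2 - (η : ℂ) ^ 2))]
  · simp [absq_tip (k := k) (e := 1) (by simp), absq_tip (k := k) (e := k) (by simp)]
  · refine ContinuousOn.div ?_ (by fun_prop) fun η hη =>
      sq_sub_sq_ne_zero h (by rwa [slit_one])
    exact (continuous_ofReal.comp (continuous_absq k)).continuousOn
  · intro η hη
    have hη1 : η ∈ openSlit k 1 := by rwa [openSlit_one]
    have hηs := openSlit_subset k 1 hη1
    have hq := absq_pos hk0 hη1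
    have hq2 := absq_sq hk0 hηs
    have hne := sq_sub_sq_ne_zero h hηs
    have d1 : HasDerivAt (fun η : ℝ => (1 - η ^ 2) * (η ^ 2 - k ^ 2))
        (2 * η * (1 + k ^ 2 - 2 * η ^ 2)) η := by
      have := (((hasDerivAt_id η).pow 2).const_sub 1).mul (((hasDerivAt_id η).pow 2).sub_const (k ^ 2))
      refine this.congr_deriv ?_
      simp; ring
    have d2 : HasDerivAt (absq k) (2 * η * (1 + k ^ 2 - 2 * η ^ 2) / (2 * absq k η)) η :=
      d1.sqrt (radicand_pos hk0 hη1).ne'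
    have d3 : HasDerivAt (fun η : ℝ => ζ ^ 2 - (η : ℂ) ^ 2) (-(2 * (η : ℂ))) η := by
      have := ((hasDerivAt_id (η : ℂ)).pow 2).const_sub (ζ ^ 2)
      have := this.comp_ofReal
      refine this.congr_deriv ?_
      simp
    refine (d2.ofReal_comp.div d3 hne).congr_deriv ?_
    have hqc : (absq k η : ℂ) ≠ 0 := ofReal_ne_zero.2 hq.ne'
    have hq2c : (absq k η : ℂ) ^ 2 = (1 - η ^ 2) * (η ^ 2 - (k : ℂ) ^ 2) := by exact_mod_cast hq2
    rw [← hq2c]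
    push_cast
    field_simp
    ring
  · rwa [intervalIntegrable_iff_integrableOn_Icc_of_le hk1.le]

/-- The difference of the two period integrals as one integral over `l₁`. -/
theorem periodInt_sub (hk0 : 0 < k) (hk1 : k < 1) {ζ : ℂ} (h : ζ ∈ slitDomain k) :
    periodInt k 0 ζ - periodInt k 1 ζ =
      ∫ η in slit k 1, ((1 / absq k η : ℝ) : ℂ) * (2 * η / (ζ ^ 2 - η ^ 2)) := by
  have hw := integrableOn_inv_absq hk0 hk1 1
  have hS := isCompact_slit k 1
  unfold periodInt cauchyInt
  rw [setIntegral_slit_zero, ← integral_sub]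
  · refine setIntegral_congr_fun (measurableSet_slit k 1) fun η hη => ?_
    obtain ⟨h1, h2⟩ := sub_ne_zero_of_mem h hη
    have h3 := sq_sub_sq_ne_zero h hη
    simp only [absq_neg, ofReal_neg]
    field_simp
    ring
  · simp only [absq_neg, div_eq_mul_inv, ofReal_neg]
    simp only [← div_eq_mul_inv]
    simp only [div_eq_mul_inv (_ : ℂ)]
    exact integrableOn_mul_continuousOn hS hw
      (ContinuousOn.inv₀ (by fun_prop) fun η hη => (sub_ne_zero_of_mem h hη).2)
  · simp only [div_eq_mul_inv (_ : ℂ)]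
    exact integrableOn_mul_continuousOn hS hw
      (ContinuousOn.inv₀ (by fun_prop) fun η hη => (sub_ne_zero_of_mem h hη).1)

/-- The derivative of `K₀ - K₁` as one integral over `l₁`. -/
theorem deriv_periodInt_sub (hk0 : 0 < k) (hk1 : k < 1) {ζ : ℂ} (h : ζ ∈ slitDomain k) :
    (∫ η in slit k 0, ((1 / absq k η : ℝ) : ℂ) / ((η : ℂ) - ζ) ^ 2) -
      (∫ η in slit k 1, ((1 / absq k η : ℝ) : ℂ) / ((η : ℂ) - ζ) ^ 2) =
      ∫ η in slit k 1, ((1 / absq k η : ℝ) : ℂ) * (-(4 * η * ζ) / (ζ ^ 2 - η ^ 2) ^ 2) := by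
  have hw := integrableOn_inv_absq hk0 hk1 1
  have hS := isCompact_slit k 1
  rw [setIntegral_slit_zero, ← integral_sub]
  · refine setIntegral_congr_fun (measurableSet_slit k 1) fun η hη => ?_
    obtain ⟨h1, h2⟩ := sub_ne_zero_of_mem h hη
    have h3 := sq_sub_sq_ne_zero h hη
    simp only [absq_neg, ofReal_neg]
    field_simp
    ring
  · simp only [absq_neg, ofReal_neg, div_eq_mul_inv (_ : ℂ)]
    exact integrableOn_mul_continuousOn hS hw (ContinuousOn.inv₀ (by fun_prop) fun η hη =>
      pow_ne_zero 2 (sub_ne_zero_of_mem h hη).2)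
  · simp only [div_eq_mul_inv (_ : ℂ)]
    exact integrableOn_mul_continuousOn hS hw (ContinuousOn.inv₀ (by fun_prop) fun η hη =>
      pow_ne_zero 2 (sub_ne_zero_of_mem h hη).1)

/-- The derivative of `q(K₀ - K₁)` is, up to the factor `2ζ/q`, the integral of a total
derivative. -/
theorem hasDerivAt_branch_mul_periodInt_sub (hk0 : 0 < k) (hk1 : k < 1) {ζ : ℂ}
    (h : ζ ∈ slitDomain k) :
    HasDerivAt (fun ζ => branch k ζ * (periodInt k 0 ζ - periodInt k 1 ζ)) 0 ζ := by
  have hq := ((differentiableOn_branch hk0 hk1).differentiableAt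
    ((isOpen_slitDomain k).mem_nhds h)).hasDerivAt
  have hq0 := branch_ne_zero hk1 h
  have hX := (hasDerivAt_periodInt hk0 hk1 h 0).sub (hasDerivAt_periodInt hk0 hk1 h 1)
  rw [deriv_periodInt_sub hk0 hk1 h] at hX
  refine (hq.mul hX).congr_deriv ?_
  have hq' : 2 * branch k ζ * deriv (branch k) ζ = 2 * ζ * (2 * ζ ^ 2 - 1 - (k : ℂ) ^ 2) := by
    have h1 := hq.pow 2
    have h2 : HasDerivAt (fun ζ : ℂ => (ζ ^ 2 - 1) * (ζ ^ 2 - (k : ℂ) ^ 2))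
        (2 * ζ * (2 * ζ ^ 2 - 1 - (k : ℂ) ^ 2)) ζ := by
      have := (((hasDerivAt_id ζ).pow 2).sub_const 1).mul
        (((hasDerivAt_id ζ).pow 2).sub_const ((k : ℂ) ^ 2))
      refine this.congr_deriv ?_
      simp; ring
    have h3 : branch k ^ 2 = fun ζ : ℂ => (ζ ^ 2 - 1) * (ζ ^ 2 - (k : ℂ) ^ 2) :=
      funext fun ζ => branch_sq k ζ
    rw [h3] at h1
    simpa using h1.unique h2
  have hq2 := branch_sq k ζ
  have hw := integrableOn_inv_absq hk0 hk1 1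
  have hS := isCompact_slit k 1
  simp only [Pi.sub_apply]
  rw [periodInt_sub hk0 hk1 h]
  apply mul_left_cancel₀ (mul_ne_zero two_ne_zero hq0)
  rw [mul_zero]
  set A := ∫ η in slit k 1, ((1 / absq k η : ℝ) : ℂ) * (2 * η / (ζ ^ 2 - η ^ 2)) with hA
  set B := ∫ η in slit k 1, ((1 / absq k η : ℝ) : ℂ) * (-(4 * η * ζ) / (ζ ^ 2 - η ^ 2) ^ 2) with hB
  have e1 : 2 * branch k ζ * (deriv (branch k) ζ * A + branch k ζ * B) =
      2 * ζ * (2 * ζ ^ 2 - 1 - (k : ℂ) ^ 2) * A +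
        2 * ((ζ ^ 2 - 1) * (ζ ^ 2 - (k : ℂ) ^ 2)) * B := by
    rw [← hq', ← hq2]; ring
  rw [e1, hA, hB, ← integral_const_mul, ← integral_const_mul, ← integral_add]
  · rw [← mul_zero (4 * ζ), ← integral_deriv_eq_zero hk0 hk1 h, ← integral_const_mul]
    refine setIntegral_congr_fun (measurableSet_slit k 1) fun η hη => ?_
    have h3 := sq_sub_sq_ne_zero h hη
    field_simp
    ring
  · refine (integrableOn_mul_continuousOn hS hw ?_).const_mul _
    exact ContinuousOn.div (by fun_prop) (by fun_prop) fun η hη => sq_sub_sq_ne_zero h hη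
  · refine (integrableOn_mul_continuousOn hS hw ?_).const_mul _
    exact ContinuousOn.div (by fun_prop) (by fun_prop)
      fun η hη => pow_ne_zero 2 (sq_sub_sq_ne_zero h hη)

/-- At infinity `K₀ - K₁ ~ ζ⁻² ∫_{l₁} 2η dη/|q| = πζ⁻²`, the terms of order `ζ⁻¹` cancelling by
symmetry. -/
theorem tendsto_branch_mul_periodInt_sub (hk0 : 0 < k) (hk1 : k < 1) :
    Tendsto (fun ζ => branch k ζ * (periodInt k 0 ζ - periodInt k 1 ζ)) (cocompact ℂ)
      (𝓝 (Real.pi : ℂ)) := by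
  have hw := fun j => integrableOn_inv_absq hk0 hk1 j
  have hS := fun j => isCompact_slit k j
  have hw' : ∀ j, IntegrableOn (fun η => η * (1 / absq k η)) (slit k j) := fun j =>
    (hw j).continuousOn_mul continuousOn_id (hS j)
  have h1 := (tendsto_mul_cauchyInt (hS 0) (hw' 0)).sub (tendsto_mul_cauchyInt (hS 1) (hw' 1))
  have h2 := (tendsto_branch_div_sq hk0 hk1).mul h1
  have hval : (1 : ℂ) * (-((∫ η in slit k 0, η * (1 / absq k η) : ℝ) : ℂ) -
      -((∫ η in slit k 1, η * (1 / absq k η) : ℝ) : ℂ)) = (Real.pi : ℂ) := by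
    have e0 : ∫ η in slit k 0, η * (1 / absq k η) = -∫ η in slit k 1, η * (1 / absq k η) := by
      have := setIntegral_slit_zero (k := k) (fun η => ((η * (1 / absq k η) : ℝ) : ℂ))
      simp only [absq_neg, neg_mul, ofReal_neg, integral_neg] at this
      rw [integral_complex_ofReal, integral_complex_ofReal] at this
      exact_mod_cast this
    have e1 := integral_weight_one hk0 hk1
    have e2 : ∫ η in slit k 1, 2 * η / absq k η = 2 * ∫ η in slit k 1, η * (1 / absq k η) := by
      rw [← integral_const_mul]; congr 1; ext η; ring
    rw [e0, ← e1, e2]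
    push_cast; ring
  rw [hval] at h2
  refine h2.congr' ?_
  filter_upwards [eventually_one_lt_norm] with ζ hζ
  have h0 : ζ ≠ 0 := fun h' => by rw [h', norm_zero] at hζ; linarith
  have hm := mem_slitDomain_of_one_lt_norm hk0 hζ
  have m0 := mul_cauchyInt (hS 0) (hw 0) (mem_slitDomain.1 hm 0)
  have m1 := mul_cauchyInt (hS 1) (hw 1) (mem_slitDomain.1 hm 1)
  rw [integral_inv_absq_zero] at m0
  unfold periodInt
  have e3 : cauchyInt (fun η => η * (1 / absq k η)) (slit k 0) ζ -
      cauchyInt (fun η => η * (1 / absq k η)) (slit k 1) ζ =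
      ζ * (cauchyInt (fun η => 1 / absq k η) (slit k 0) ζ -
        cauchyInt (fun η => 1 / absq k η) (slit k 1) ζ) := by
    linear_combination m1 - m0
  rw [← mul_sub, e3]
  field_simp

/-- The period identity `q(K₀ - K₁) = π`: the left side is locally constant, with limit `π` at
infinity. -/
theorem branch_mul_periodInt_sub (hk0 : 0 < k) (hk1 : k < 1) {ζ : ℂ} (h : ζ ∈ slitDomain k) :
    branch k ζ * (periodInt k 0 ζ - periodInt k 1 ζ) = Real.pi := by
  have hd : ∀ ζ ∈ slitDomain k, HasDerivAt
      (fun ζ => branch k ζ * (periodInt k 0 ζ - periodInt k 1 ζ)) 0 ζ :=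
    fun ζ hζ => hasDerivAt_branch_mul_periodInt_sub hk0 hk1 hζ
  refine eqOn_slitDomain_of_im_ne (fun ζ hζ => (hd ζ hζ).continuousAt.continuousWithinAt)
    continuousOn_const (fun w hw => ?_) h
  -- along the vertical ray from `w` to infinity, inside the half-plane that contains `w`
  obtain ⟨σ, hσ⟩ : ∃ σ : ℝ, 0 < σ * w.im := ⟨w.im, mul_self_pos.2 hw⟩
  have hσ0 : σ ≠ 0 := left_ne_zero_of_mul hσ.ne'
  have hU : IsOpen {ζ : ℂ | 0 < σ * ζ.im} :=
    isOpen_lt continuous_const (continuous_const.mul continuous_im)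
  have hconv : Convex ℝ {ζ : ℂ | 0 < σ * ζ.im} := by
    have := (convex_Ioi (0 : ℝ)).linear_preimage (σ • imLm)
    exact this
  have hsub : {ζ : ℂ | 0 < σ * ζ.im} ⊆ slitDomain k := fun ζ hζ =>
    mem_slitDomain_of_im_ne (right_ne_zero_of_mul (ne_of_gt hζ))
  have hray : ∀ t : ℝ, 0 ≤ t → w + t * (σ * I) ∈ {ζ : ℂ | 0 < σ * ζ.im} := fun t ht => by
    have : 0 ≤ t * (σ * σ) := mul_nonneg ht (mul_self_nonneg σ)
    simp only [mem_ofPred_eq, add_im, mul_im, ofReal_re, ofReal_im, I_re, I_im]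
    simp only [mul_one, mul_zero, zero_mul, add_zero]
    nlinarith
  have hconst : ∀ t : ℝ, 0 ≤ t →
      branch k w * (periodInt k 0 w - periodInt k 1 w) =
      (fun ζ => branch k ζ * (periodInt k 0 ζ - periodInt k 1 ζ)) (w + t * (σ * I)) := fun t ht =>
    hU.is_const_of_deriv_eq_zero hconv.isPreconnected
      (fun ζ hζ => (hd ζ (hsub hζ)).differentiableAt.differentiableWithinAt)
      (fun ζ hζ => (hd ζ (hsub hζ)).deriv) hσ (hray t ht)
  have hinf : Tendsto (fun t : ℝ => w + t * (σ * I)) atTop (cocompact ℂ) := by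
    rw [← Metric.cobounded_eq_cocompact, ← tendsto_norm_atTop_iff_cobounded]
    have h1 : Tendsto (fun t : ℝ => t * |σ| - ‖w‖) atTop atTop :=
      tendsto_atTop_add_const_right _ _ (tendsto_id.atTop_mul_const (abs_pos.2 hσ0))
    refine tendsto_atTop_mono (fun t => ?_) h1
    have h2 := norm_sub_norm_le ((t : ℂ) * (σ * I)) (-w)
    rw [sub_neg_eq_add, norm_neg, norm_mul, norm_mul, norm_I, norm_real, norm_real, mul_one,
      add_comm] at h2
    have h3 : t * |σ| ≤ ‖t‖ * ‖σ‖ := by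
      rw [Real.norm_eq_abs, Real.norm_eq_abs]
      exact mul_le_mul_of_nonneg_right (le_abs_self t) (abs_nonneg σ)
    linarith
  refine tendsto_nhds_unique (tendsto_const_nhds.congr' ?_)
    ((tendsto_branch_mul_periodInt_sub hk0 hk1).comp hinf)
  filter_upwards [eventually_ge_atTop 0] with t ht using hconst t ht

end

section

variable {k : ℝ}

/-! ### Cauchy integrals of rational densities with the weight `1/|q|` -/

/-- The real density `α + r/(η - z)`. -/
def ratDens (z α r η : ℝ) : ℝ := α + r / (η - z)

/-- The rational function `α + r/(ζ - z)` of a complex variable. -/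
def ratFun (z α r : ℝ) (ζ : ℂ) : ℂ := α + r / (ζ - z)

/-- `∫_{l_j} (α + r/(η - z)) dη/(|q(η)|(η - ζ))`. -/
def ratInt (k z α r : ℝ) (j : Fin 2) : ℂ → ℂ :=
  cauchyInt (fun η => ratDens z α r η / absq k η) (slit k j)

/-- The solution `(iq/π) ∑_j (-1)^j ∫_{l_j} A_j dη/(|q|(η - ζ))` of the Schwarz problem whose
densities `A_j = α_j + r_j/(ξ - z)` are the same on the two banks. -/
def evenPart (k z : ℝ) (α r : Fin 2 → ℝ) (ζ : ℂ) : ℂ :=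
  I * branch k ζ / Real.pi * ∑ j, (sg j : ℂ) * ratInt k z (α j) (r j) j ζ

/-- The solution `(1/π) ∑_j (-1)^j λ_j ∫_{l_j} g dη/(η - ζ)` of the Schwarz problem whose densities
`± (-1)^j λ_j g` are opposite on the two banks. -/
def oddPart (k : ℝ) (lam : Fin 2 → ℝ) (g : ℝ → ℝ) (ζ : ℂ) : ℂ :=
  1 / Real.pi * ∑ j, ((sg j * lam j : ℝ) : ℂ) * cauchyInt g (slit k j) ζ

/-- The analytic function `N_m` near the slit `l_m` for which the even part equals `i(A_m + qN_m)`;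
the period identity removes the singular integral over `l_m` itself. -/
def localFactor (k z : ℝ) (α r : Fin 2 → ℝ) (m : Fin 2) (ζ : ℂ) : ℂ :=
  1 / Real.pi * (sg m * (ratFun z (α m) (r m) ζ * periodInt k (m + 1) ζ -
    r m * periodInt k m z / (ζ - z)) + sg (m + 1) * ratInt k z (α (m + 1)) (r (m + 1)) (m + 1) ζ)

/-- A neighbourhood of the slit `l_m`: the complement of the other slit and of `z`. -/
def nearSlit (k z : ℝ) (m : Fin 2) : Set ℂ :=
  ((fun x : ℝ => (x : ℂ)) '' slit k (m + 1))ᶜ ∩ {ζ | ζ ≠ z}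

theorem isOpen_nearSlit (k z : ℝ) (m : Fin 2) : IsOpen (nearSlit k z m) :=
  (isCompact_ofReal_slit k (m + 1)).isClosed.isOpen_compl.inter isOpen_ne

theorem ne_of_mem_nearSlit {z : ℝ} {m : Fin 2} {ζ : ℂ} (h : ζ ∈ nearSlit k z m) :
    ∀ η ∈ slit k (m + 1), (η : ℂ) ≠ ζ := fun η hη he => h.1 ⟨η, hη, he⟩

theorem ne_add_one (m : Fin 2) : m ≠ m + 1 := by fin_cases m <;> decide

theorem sum_eq_add_other {M : Type*} [AddCommMonoid M] (f : Fin 2 → M) (m : Fin 2) :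
    ∑ j, f j = f m + f (m + 1) := by
  fin_cases m
  · simp [Fin.sum_univ_two]
  · simp [Fin.sum_univ_two, add_comm]

theorem not_mem_slit_of_mid {z : ℝ} (hz : z ∈ Ioo (-k) k) (j : Fin 2) : z ∉ slit k j :=
  ofReal_mem_slitDomain.1 (mid_mem_slitDomain hz) j

theorem mem_nearSlit (hk0 : 0 < k) {z : ℝ} (hz : z ∈ Ioo (-k) k) {m : Fin 2} {ξ : ℝ}
    (hξ : ξ ∈ slit k m) : (ξ : ℂ) ∈ nearSlit k z m := by
  refine ⟨?_, fun h => not_mem_slit_of_mid hz m (ofReal_inj.1 h ▸ hξ)⟩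
  rintro ⟨x, hx, hxξ⟩
  have : x = ξ := ofReal_inj.1 hxξ
  exact slit_disjoint hk0 (ne_add_one m) hξ (this ▸ hx)

/-- The period identity near the slit `l_m`. -/
theorem periodInt_eq_other (hk0 : 0 < k) (hk1 : k < 1) (m : Fin 2) {ζ : ℂ}
    (h : ζ ∈ slitDomain k) :
    periodInt k m ζ = periodInt k (m + 1) ζ + sg m * Real.pi / branch k ζ := by
  have h1 := branch_mul_periodInt_sub hk0 hk1 h
  have h2 := branch_ne_zero hk1 h
  rw [← h1]
  fin_cases m
  · simp [sg_zero]
    field_simp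
    ring
  · simp [sg_one]
    field_simp
    ring

section Rational

variable {z : ℝ}

theorem ratFun_ofReal (z α r η : ℝ) : ratFun z α r η = ratDens z α r η := by
  simp [ratFun, ratDens]

theorem continuousOn_ratDens (hz : z ∈ Ioo (-k) k) (α r : ℝ) (j : Fin 2) :
    ContinuousOn (ratDens z α r) (slit k j) := by
  unfold ratDens
  refine continuousOn_const.add (ContinuousOn.div continuousOn_const (by fun_prop) fun η hη h => ?_)
  exact not_mem_slit_of_mid hz j (sub_eq_zero.1 h ▸ hη)

theorem integrableOn_ratDens_div (hk0 : 0 < k) (hk1 : k < 1) (hz : z ∈ Ioo (-k) k) (α r : ℝ)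
    (j : Fin 2) : IntegrableOn (fun η => ratDens z α r η / absq k η) (slit k j) := by
  have := (integrableOn_inv_absq hk0 hk1 j).continuousOn_mul (continuousOn_ratDens hz α r j)
    (isCompact_slit k j)
  simpa [div_eq_mul_inv] using this

theorem differentiableAt_ratFun {ζ : ℂ} (h : ζ ≠ z) (α r : ℝ) :
    DifferentiableAt ℂ (ratFun z α r) ζ := by
  unfold ratFun
  exact (differentiableAt_const _).add ((differentiableAt_const _).div (by fun_prop) (sub_ne_zero.2 h))

/-- Partial fractions express the Cauchy integral of a rational density by period integrals. -/
theorem ratInt_eq (hk0 : 0 < k) (hk1 : k < 1) (hz : z ∈ Ioo (-k) k) (α r : ℝ) (j : Fin 2) {ζ : ℂ}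
    (h : ∀ η ∈ slit k j, (η : ℂ) ≠ ζ) (hζ : ζ ≠ z) :
    ratInt k z α r j ζ =
      ratFun z α r ζ * periodInt k j ζ - r * periodInt k j z / (ζ - z) := by
  have hw := integrableOn_inv_absq hk0 hk1 j
  have e1 : ratInt k z α r j ζ =
      cauchyInt (fun η => 1 / absq k η * ratDens z α r η) (slit k j) ζ := by
    unfold ratInt
    congr 1; ext η; ring
  rw [e1, cauchyInt_mul (isCompact_slit k j) hw (fun η _ => ratFun_ofReal z α r η)
    (continuousOn_ratDens hz α r j) h, sub_eq_add_neg]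
  congr 1
  unfold cauchyRem periodInt cauchyInt
  rw [← integral_const_mul, ← integral_div, ← integral_neg]
  refine setIntegral_congr_fun (measurableSet_slit k j) fun η hη => ?_
  have h1 := sub_ne_zero.2 (h η hη)
  have h2 : (η : ℂ) - z ≠ 0 := sub_ne_zero.2 fun h =>
    not_mem_slit_of_mid hz j (ofReal_inj.1 h ▸ hη)
  have h3 := sub_ne_zero.2 hζ
  simp only [ratFun]
  generalize ((1 / absq k η : ℝ) : ℂ) = t
  field_simp
  ring

theorem differentiableAt_ratInt (hk0 : 0 < k) (hk1 : k < 1) (hz : z ∈ Ioo (-k) k) (α r : ℝ)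
    (j : Fin 2) {ζ : ℂ} (h : ∀ η ∈ slit k j, (η : ℂ) ≠ ζ) :
    DifferentiableAt ℂ (ratInt k z α r j) ζ :=
  (hasDerivAt_cauchyInt (isCompact_slit k j) (integrableOn_ratDens_div hk0 hk1 hz α r j)
    h).differentiableAt

variable (α r : Fin 2 → ℝ)

theorem differentiableOn_localFactor (hk0 : 0 < k) (hk1 : k < 1) (hz : z ∈ Ioo (-k) k)
    (m : Fin 2) : DifferentiableOn ℂ (localFactor k z α r m) (nearSlit k z m) := by
  intro ζ hζ
  have h1 := ne_of_mem_nearSlit hζ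
  have d1 := differentiableAt_ratFun hζ.2 (α m) (r m)
  have d2 : DifferentiableAt ℂ (periodInt k (m + 1)) ζ := (hasDerivAt_cauchyInt
    (isCompact_slit k _) (integrableOn_inv_absq hk0 hk1 _) h1).differentiableAt
  have d3 := differentiableAt_ratInt hk0 hk1 hz (α (m + 1)) (r (m + 1)) (m + 1) h1
  have d4 : DifferentiableAt ℂ (fun ζ : ℂ => (r m : ℂ) * periodInt k m z / (ζ - z)) ζ :=
    (differentiableAt_const _).div (by fun_prop) (sub_ne_zero.2 hζ.2)
  exact ((((d1.mul d2).sub d4).const_mul _).add (d3.const_mul _)).const_mul _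
    |>.differentiableWithinAt

theorem localFactor_im_ofReal (m : Fin 2) (ξ : ℝ) : (localFactor k z α r m ξ).im = 0 := by
  have e1 : ∀ j (x : ℝ), periodInt k j x = ((periodInt k j x).re : ℂ) := fun j x =>
    Complex.ext rfl (by simp [periodInt, cauchyInt_im_ofReal])
  have e2 : ∀ α r j (x : ℝ), ratInt k z α r j x = ((ratInt k z α r j x).re : ℂ) := fun α r j x =>
    Complex.ext rfl (by simp [ratInt, cauchyInt_im_ofReal])
  unfold localFactor
  rw [ratFun_ofReal, e1, e1 m z, e2]
  norm_cast

theorem localFactor_ofReal (m : Fin 2) (ξ : ℝ) :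
    localFactor k z α r m ξ = ((localFactor k z α r m ξ).re : ℂ) :=
  Complex.ext rfl (by simp [localFactor_im_ofReal])

/-- The even part equals `i(A_m + qN_m)`: the period identity replaces the integral over `l_m`,
which is singular there, by the one over the other slit. -/
theorem evenPart_eq_local (hk0 : 0 < k) (hk1 : k < 1) (hz : z ∈ Ioo (-k) k) (m : Fin 2) {ζ : ℂ}
    (h : ζ ∈ slitDomain k) (hζ : ζ ≠ z) :
    evenPart k z α r ζ =
      I * ratFun z (α m) (r m) ζ + I * branch k ζ * localFactor k z α r m ζ := by
  have hq := branch_ne_zero hk1 h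
  have hpi : (Real.pi : ℂ) ≠ 0 := ofReal_ne_zero.2 Real.pi_ne_zero
  have hs : (sg m : ℂ) * sg m = 1 := by exact_mod_cast sg_mul_self m
  have hζ' := sub_ne_zero.2 hζ
  unfold evenPart localFactor
  rw [sum_eq_add_other _ m, ratInt_eq hk0 hk1 hz (α m) (r m) m (mem_slitDomain.1 h m) hζ,
    periodInt_eq_other hk0 hk1 m h]
  field_simp
  linear_combination (ratFun z (α m) (r m) ζ * Real.pi * (ζ - z)) * hs

theorem differentiableOn_evenPart (hk0 : 0 < k) (hk1 : k < 1) (hz : z ∈ Ioo (-k) k) :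
    DifferentiableOn ℂ (evenPart k z α r) (slitDomain k) := by
  have hq := differentiableOn_branch hk0 hk1
  unfold evenPart
  refine ((hq.const_mul I).div_const _).mul ?_
  refine DifferentiableOn.fun_sum fun j _ => ?_
  exact DifferentiableOn.const_mul (fun ζ hζ => (differentiableAt_ratInt hk0 hk1 hz _ _ j
    (mem_slitDomain.1 hζ j)).differentiableWithinAt) _

theorem eventually_ne_of_slit (hz : z ∈ Ioo (-k) k) {m : Fin 2} {ξ : ℝ} (hξ : ξ ∈ slit k m) :
    ∀ᶠ ζ : ℂ in 𝓝 (ξ : ℂ), ζ ≠ (z : ℂ) :=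
  isOpen_ne.mem_nhds fun h => not_mem_slit_of_mid hz m (ofReal_inj.1 h ▸ hξ)

theorem tendsto_evenPart_bank (hk0 : 0 < k) (hk1 : k < 1) (hz : z ∈ Ioo (-k) k) {m : Fin 2}
    {ξ : ℝ} (hξ : ξ ∈ slit k m) (s : Bank) :
    Tendsto (evenPart k z α r) (bankFilter s ξ)
      (𝓝 (((s.sgn * sg m * (absq k ξ * (localFactor k z α r m ξ).re) : ℝ) : ℂ) +
        (ratDens z (α m) (r m) ξ : ℂ) * I)) := by
  have hn := mem_nearSlit hk0 hz hξ
  have c1 : Tendsto (localFactor k z α r m) (bankFilter s ξ) (𝓝 (localFactor k z α r m ξ)) :=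
    ((differentiableOn_localFactor α r hk0 hk1 hz m).continuousOn.continuousAt
      ((isOpen_nearSlit k z m).mem_nhds hn)).tendsto.mono_left (bankFilter_le_nhds s ξ)
  have c2 : Tendsto (ratFun z (α m) (r m)) (bankFilter s ξ) (𝓝 (ratFun z (α m) (r m) ξ)) :=
    (differentiableAt_ratFun hn.2 _ _).continuousAt.tendsto.mono_left (bankFilter_le_nhds s ξ)
  have h := (c2.const_mul I).add (((tendsto_branch_bank hk0 hξ s).const_mul I).mul c1)
  rw [ratFun_ofReal, localFactor_ofReal] at h
  refine (h.congr' ?_).trans_eq ?_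
  · filter_upwards [eventually_bank_mem_slitDomain s ξ,
      (eventually_ne_of_slit hz hξ).filter_mono (bankFilter_le_nhds s ξ)] with ζ h1 h2
    exact (evenPart_eq_local α r hk0 hk1 hz m h1 h2).symm
  · congr 1
    unfold bankV
    push_cast
    linear_combination (-(sg m * s.sgn * absq k ξ * (localFactor k z α r m ξ).re) : ℂ) * I_sq

theorem tendsto_evenPart_tip (hk0 : 0 < k) (hk1 : k < 1) (hz : z ∈ Ioo (-k) k) {m : Fin 2}
    {e : ℝ} (hm : e ∈ slit k m) (he : e ∈ ({-1, -k, k, 1} : Set ℝ)) :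
    ∃ w, Tendsto (evenPart k z α r) (𝓝[slitDomain k] (e : ℂ)) (𝓝 w) := by
  have hn := mem_nearSlit hk0 hz hm
  have c1 : Tendsto (localFactor k z α r m) (𝓝 (e : ℂ)) (𝓝 (localFactor k z α r m e)) :=
    ((differentiableOn_localFactor α r hk0 hk1 hz m).continuousOn.continuousAt
      ((isOpen_nearSlit k z m).mem_nhds hn)).tendsto
  have c2 : Tendsto (ratFun z (α m) (r m)) (𝓝 (e : ℂ)) (𝓝 (ratFun z (α m) (r m) e)) :=
    (differentiableAt_ratFun hn.2 _ _).continuousAt.tendsto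
  have h := ((c2.const_mul I).add (((tendsto_branch_tip he).const_mul I).mul c1)).mono_left
    (nhdsWithin_le_nhds (s := slitDomain k))
  refine ⟨_, h.congr' ?_⟩
  filter_upwards [self_mem_nhdsWithin,
    (eventually_ne_of_slit hz hm).filter_mono nhdsWithin_le_nhds] with ζ h1 h2
  exact (evenPart_eq_local α r hk0 hk1 hz m h1 h2).symm

theorem isSchwarz_evenPart (hk0 : 0 < k) (hk1 : k < 1) (hz : z ∈ Ioo (-k) k) :
    IsSchwarz k (fun j _ ξ => ratDens z (α j) (r j) ξ) (evenPart k z α r) := by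
  refine ⟨differentiableOn_evenPart α r hk0 hk1 hz, ⟨fun j ξ hξ s =>
    ⟨_, tendsto_evenPart_bank α r hk0 hk1 hz hξ s⟩, fun e he => ?_⟩, fun j ξ hξ s => ?_⟩
  · obtain ⟨j, hj⟩ := exists_slit_of_tip hk1 he
    exact tendsto_evenPart_tip α r hk0 hk1 hz hj he
  · have := (continuous_im.tendsto _).comp (tendsto_evenPart_bank α r hk0 hk1 hz hξ s)
    simpa [Function.comp_def] using this

/-! ### Principal values and the singular integral on the slits -/

theorem isBigO_sub_of_differentiableAt {φ : ℝ → ℝ} {ξ : ℝ} (h : DifferentiableAt ℝ φ ξ) :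
    (fun η => φ η - φ ξ) =O[𝓝 ξ] (fun η => η - ξ) := h.isBigO_sub

theorem slit_mem_nhds {m : Fin 2} {ξ : ℝ} (h : ξ ∈ openSlit k m) : slit k m ∈ 𝓝 ξ :=
  mem_of_superset ((isOpen_openSlit k m).mem_nhds h) (openSlit_subset k m)

/-- Existence of the principal value, and its relation to the vertical limits of the Cauchy
integral, for both slits together. -/
theorem plemelj_slit (hk0 : 0 < k) {φ : ℝ → ℝ} {j m : Fin 2} {ξ : ℝ}
    (hφ : IntegrableOn φ (slit k j)) (hξ : ξ ∈ openSlit k m)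
    (hd : j = m → DifferentiableAt ℝ φ ξ) :
    HasPV φ (slit k j) ξ (pv φ (slit k j) ξ) ∧ ∀ s : Bank,
      Tendsto (fun ε : ℝ => cauchyInt φ (slit k j) (ξ + s.sgn * ε * I)) (𝓝[>] 0)
        (𝓝 (pv φ (slit k j) ξ + if j = m then s.sgn * (Real.pi * φ ξ : ℝ) * I else 0)) := by
  by_cases h : j = m
  · subst h
    simp only [if_true]
    exact plemelj_interior (isCompact_slit k j) hφ (slit_mem_nhds hξ)
      (isBigO_sub_of_differentiableAt (hd rfl))
  · simp only [h, if_false, add_zero]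
    exact plemelj_exterior (isCompact_slit k j) hφ
      (slit_disjoint hk0 (Ne.symm h) (openSlit_subset k m hξ))

theorem differentiableAt_absq (hk0 : 0 < k) {m : Fin 2} {ξ : ℝ} (h : ξ ∈ openSlit k m) :
    DifferentiableAt ℝ (absq k) ξ := by
  unfold absq
  exact DifferentiableAt.sqrt (by fun_prop) (radicand_pos hk0 h).ne'

theorem differentiableAt_ratDens (hz : z ∈ Ioo (-k) k) {m : Fin 2} {ξ : ℝ} (h : ξ ∈ slit k m)
    (α r : ℝ) : DifferentiableAt ℝ (ratDens z α r) ξ := by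
  unfold ratDens
  exact (differentiableAt_const _).add ((differentiableAt_const _).div (by fun_prop)
    (sub_ne_zero.2 fun h' => not_mem_slit_of_mid hz m (h' ▸ h)))

theorem differentiableAt_ratDens_div (hk0 : 0 < k) (hz : z ∈ Ioo (-k) k) {m : Fin 2} {ξ : ℝ}
    (h : ξ ∈ openSlit k m) (α r : ℝ) :
    DifferentiableAt ℝ (fun η => ratDens z α r η / absq k η) ξ :=
  (differentiableAt_ratDens hz (openSlit_subset k m h) α r).div (differentiableAt_absq hk0 h)
    (absq_pos hk0 h).ne'

theorem plemelj_ratDens (hk0 : 0 < k) (hk1 : k < 1) (hz : z ∈ Ioo (-k) k) {m : Fin 2} {ξ : ℝ}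
    (hξ : ξ ∈ openSlit k m) (α r : ℝ) (j : Fin 2) :
    HasPV (fun η => ratDens z α r η / absq k η) (slit k j) ξ
      (pv (fun η => ratDens z α r η / absq k η) (slit k j) ξ) ∧ ∀ s : Bank,
      Tendsto (fun ε : ℝ => ratInt k z α r j (ξ + s.sgn * ε * I)) (𝓝[>] 0)
        (𝓝 (pv (fun η => ratDens z α r η / absq k η) (slit k j) ξ +
          if j = m then s.sgn * (Real.pi * (ratDens z α r ξ / absq k ξ) : ℝ) * I else 0)) :=
  plemelj_slit hk0 (integrableOn_ratDens_div hk0 hk1 hz α r j) hξ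
    fun _ => differentiableAt_ratDens_div hk0 hz hξ α r

/-- The singular integral `(|q(ξ)|/π) ∑_j (-1)^j p.v. ∫_{l_j} A_j dη/(|q|(η - ξ))` in terms of the
analytic function `N_m`: two expressions for the same boundary value of the even part. -/
theorem singularInt_eq (hk0 : 0 < k) (hk1 : k < 1) (hz : z ∈ Ioo (-k) k) {m : Fin 2} {ξ : ℝ}
    (hξ : ξ ∈ slit k m) :
    absq k ξ / Real.pi * ∑ j, sg j * pv (fun η => ratDens z (α j) (r j) η / absq k η) (slit k j) ξ =
      absq k ξ * (localFactor k z α r m ξ).re := by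
  rcases mem_openSlit_or_tip hξ with h | h
  · have l1 := (tendsto_evenPart_bank α r hk0 hk1 hz hξ Bank.upper).comp
      (tendsto_vertical Bank.upper ξ)
    have l2 := ((((tendsto_branch_bank hk0 hξ Bank.upper).comp
      (tendsto_vertical Bank.upper ξ)).const_mul I).div_const (Real.pi : ℂ)).mul
      (tendsto_finsetSum Finset.univ fun j _ =>
        ((plemelj_ratDens hk0 hk1 hz h (α j) (r j) j).2 Bank.upper).const_mul (sg j : ℂ))
    have e := tendsto_nhds_unique l1 l2
    have hre := congrArg Complex.re e
    rw [sum_eq_add_other _ m] at hre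
    rw [sum_eq_add_other _ m]
    have hm : ¬ m + 1 = m := fun h => ne_add_one m h.symm
    have hs := sg_mul_self m
    simp only [if_true, hm, if_false, bankV, Bank.sgn, add_zero] at hre
    have hre' : sg m * (absq k ξ * (localFactor k z α r m ξ).re) = sg m * absq k ξ / Real.pi *
        (sg m * pv (fun η => ratDens z (α m) (r m) η / absq k η) (slit k m) ξ +
        sg (m + 1) * pv (fun η => ratDens z (α (m + 1)) (r (m + 1)) η / absq k η)
          (slit k (m + 1)) ξ) := by
      have e3 : ∀ (q P1 P2 t : ℝ), ((I * (-((sg m * 1 * q : ℝ) : ℂ) * I) / (Real.pi : ℂ) *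
          ((sg m : ℂ) * (P1 + ((1 : ℝ) : ℂ) * (t : ℂ) * I) + sg (m + 1) * (P2 : ℂ)))).re =
          sg m * q / Real.pi * (sg m * P1 + sg (m + 1) * P2) := by
        intro q P1 P2 t
        have : (I * (-((sg m * 1 * q : ℝ) : ℂ) * I) / (Real.pi : ℂ) *
          ((sg m : ℂ) * (P1 + ((1 : ℝ) : ℂ) * (t : ℂ) * I) + sg (m + 1) * (P2 : ℂ))) =
          ((sg m * q / Real.pi * (sg m * P1 + sg (m + 1) * P2) : ℝ) : ℂ) +
            ((sg m * q / Real.pi * (sg m * t) : ℝ) : ℂ) * I := by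
          push_cast
          linear_combination (-(sg m * q / Real.pi) * (sg m * P1 + sg m * t * I + sg (m + 1) * P2) : ℂ) * I_sq
        rw [this]
        simp
      rw [e3] at hre
      rw [← hre]
      simp
    have h2 := congrArg (fun x => sg m * x) hre'
    rw [← mul_assoc, hs, one_mul] at h2
    rw [h2]
    linear_combination -(absq k ξ / Real.pi *
        (sg m * pv (fun η => ratDens z (α m) (r m) η / absq k η) (slit k m) ξ +
        sg (m + 1) * pv (fun η => ratDens z (α (m + 1)) (r (m + 1)) η / absq k η)
          (slit k (m + 1)) ξ)) * hs
  · simp [absq_tip h]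

end Rational

/-! ### Densities of opposite signs on the two banks -/

section Odd

/-- A density that near each slit equals `|q|` times a function which extends analytically to a
neighbourhood `U_j` of the slit. -/
structure IsTipRegular (k : ℝ) (U : Fin 2 → Set ℂ) (N : Fin 2 → ℂ → ℂ) (g : ℝ → ℝ) : Prop where
  isOpen : ∀ j, IsOpen (U j)
  subset : ∀ j, ∀ ξ ∈ slit k j, (ξ : ℂ) ∈ U j
  disjoint : ∀ j, ∀ ζ ∈ U j, ∀ η ∈ slit k (j + 1), (η : ℂ) ≠ ζ
  differentiableOn : ∀ j, DifferentiableOn ℂ (N j) (U j)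
  real : ∀ j, ∀ ξ ∈ slit k j, (N j ξ).im = 0
  eq : ∀ j, ∀ ξ ∈ slit k j, g ξ = absq k ξ * (N j ξ).re

variable {U : Fin 2 → Set ℂ} {N : Fin 2 → ℂ → ℂ} {g : ℝ → ℝ}

theorem IsTipRegular.continuousOn_re (hg : IsTipRegular k U N g) (j : Fin 2) :
    ContinuousOn (fun ξ : ℝ => (N j ξ).re) (slit k j) :=
  continuous_re.comp_continuousOn
    ((hg.differentiableOn j).continuousOn.comp continuous_ofReal.continuousOn (hg.subset j))

theorem IsTipRegular.continuousOn (hg : IsTipRegular k U N g) (j : Fin 2) :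
    ContinuousOn g (slit k j) :=
  ((continuous_absq k).continuousOn.mul (hg.continuousOn_re j)).congr (hg.eq j)

theorem IsTipRegular.integrableOn (hg : IsTipRegular k U N g) (j : Fin 2) :
    IntegrableOn g (slit k j) := (hg.continuousOn j).integrableOn_compact (isCompact_slit k j)

theorem IsTipRegular.differentiableAt (hg : IsTipRegular k U N g) (hk0 : 0 < k) {m : Fin 2} {ξ : ℝ}
    (h : ξ ∈ openSlit k m) : DifferentiableAt ℝ g ξ := by
  have hs := openSlit_subset k m h
  have h1 : DifferentiableAt ℝ (fun ξ : ℝ => (N m ξ).re) ξ :=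
    ((hg.differentiableOn m).differentiableAt
      ((hg.isOpen m).mem_nhds (hg.subset m ξ hs))).hasDerivAt.real_of_complex.differentiableAt
  refine ((differentiableAt_absq hk0 h).mul h1).congr_of_eventuallyEq ?_
  filter_upwards [slit_mem_nhds h] with η hη using hg.eq m η hη

/-- The polynomial `-q²` times `N_m`, whose restriction to the slit is `|q|g`. -/
theorem IsTipRegular.mul_radicand (hg : IsTipRegular k U N g) (hk0 : 0 < k) {m : Fin 2} {η : ℝ}
    (hη : η ∈ slit k m) : -(((η : ℂ) ^ 2 - 1) * ((η : ℂ) ^ 2 - (k : ℂ) ^ 2)) * N m η =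
      ((absq k η ^ 2 * (N m η).re : ℝ) : ℂ) := by
  have h1 : N m η = ((N m η).re : ℂ) := Complex.ext rfl (by simp [hg.real m η hη])
  conv_lhs => rw [h1]
  rw [absq_sq hk0 hη]
  push_cast; ring

/-- The decomposition of the Cauchy integral of `g` near the slit: the period identity turns the
factor `-q²K_m` into `-(-1)^mπq - q²K_{m'}`. -/
theorem IsTipRegular.cauchyInt_eq (hg : IsTipRegular k U N g) (hk0 : 0 < k) (hk1 : k < 1)
    (m : Fin 2) {ζ : ℂ} (h : ζ ∈ slitDomain k) :
    cauchyInt g (slit k m) ζ = -(sg m * Real.pi * branch k ζ * N m ζ) +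
      (-((ζ ^ 2 - 1) * (ζ ^ 2 - (k : ℂ) ^ 2)) * N m ζ * periodInt k (m + 1) ζ +
      cauchyRem (fun η => 1 / absq k η) (slit k m)
        (fun ζ => -((ζ ^ 2 - 1) * (ζ ^ 2 - (k : ℂ) ^ 2)) * N m ζ) ζ) := by
  have hq := branch_ne_zero hk1 h
  have e1 : cauchyInt g (slit k m) ζ =
      cauchyInt (fun η => 1 / absq k η * (absq k η ^ 2 * (N m η).re)) (slit k m) ζ := by
    refine cauchyInt_congr (isCompact_slit k m) (fun η hη => ?_) ζ
    rw [hg.eq m η hη]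
    by_cases h0 : absq k η = 0
    · simp [h0]
    · field_simp
  rw [e1, cauchyInt_mul (isCompact_slit k m) (integrableOn_inv_absq hk0 hk1 m)
    (f := fun ζ => -((ζ ^ 2 - 1) * (ζ ^ 2 - (k : ℂ) ^ 2)) * N m ζ)
    (fun η hη => hg.mul_radicand hk0 hη)
    (((continuous_absq k).pow 2).continuousOn.mul (hg.continuousOn_re m)) (mem_slitDomain.1 h m),
    ← add_assoc]
  congr 1
  change _ * periodInt k m ζ = _
  rw [periodInt_eq_other hk0 hk1 m h, ← branch_sq]
  field_simp
  ring

/-- At a point of `l_m` the odd part is `-λ_m q N_m` plus a function that is continuous and real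
there. -/
theorem IsTipRegular.exists_regular (hg : IsTipRegular k U N g) (hk0 : 0 < k) (hk1 : k < 1)
    (lam : Fin 2 → ℝ) {m : Fin 2} {ξ : ℝ} (hξ : ξ ∈ slit k m) :
    ∃ ψ : ℂ → ℂ, ContinuousAt ψ ξ ∧ (ψ ξ).im = 0 ∧ ContinuousAt (N m) ξ ∧
      ∀ ζ ∈ slitDomain k, oddPart k lam g ζ = -(lam m * branch k ζ * N m ζ) + ψ ζ := by
  have hU := (hg.isOpen m).mem_nhds (hg.subset m ξ hξ)
  have hne := hg.disjoint m ξ (hg.subset m ξ hξ)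
  set f : ℂ → ℂ := fun ζ => -((ζ ^ 2 - 1) * (ζ ^ 2 - (k : ℂ) ^ 2)) * N m ζ with hf
  have hfd : DifferentiableOn ℂ f (U m) :=
    (DifferentiableOn.neg (by fun_prop)).mul (hg.differentiableOn m)
  have hfr : ∀ η ∈ slit k m, f η = ((absq k η ^ 2 * (N m η).re : ℝ) : ℂ) :=
    fun η hη => hg.mul_radicand hk0 hη
  refine ⟨fun ζ => 1 / Real.pi * (((sg m * lam m : ℝ) : ℂ) * (f ζ * periodInt k (m + 1) ζ +
      cauchyRem (fun η => 1 / absq k η) (slit k m) f ζ) +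
      ((sg (m + 1) * lam (m + 1) : ℝ) : ℂ) * cauchyInt g (slit k (m + 1)) ζ), ?_, ?_, ?_, ?_⟩
  · have c1 := hfd.continuousOn.continuousAt hU
    have c2 : ContinuousAt (periodInt k (m + 1)) ξ :=
      continuousAt_cauchyInt (isCompact_slit k _) (integrableOn_inv_absq hk0 hk1 _) hne
    have c3 := continuousAt_cauchyInt (isCompact_slit k (m + 1)) (hg.integrableOn _) hne
    have c4 := continuousAt_cauchyRem (isCompact_slit k m) (integrableOn_inv_absq hk0 hk1 m)
      (hg.isOpen m) hfd (hg.subset m) (hg.subset m ξ hξ)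
    exact ((((c1.mul c2).add c4).const_mul _).add (c3.const_mul _)).const_mul _
  · have r1 : ∀ w : ℂ, w.im = 0 → w = (w.re : ℂ) := fun w hw => Complex.ext rfl (by simp [hw])
    have r2 := r1 _ (cauchyInt_im_ofReal (fun η => 1 / absq k η) (slit k (m + 1)) ξ)
    have r3 := r1 _ (cauchyInt_im_ofReal g (slit k (m + 1)) ξ)
    have r4 := r1 _ (cauchyRem_im_ofReal (φ := fun η => 1 / absq k η) (isCompact_slit k m) hfr hξ)
    simp only [periodInt]
    rw [hfr ξ hξ, r2, r3, r4]
    norm_cast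
  · exact (hg.differentiableOn m).continuousOn.continuousAt hU
  · intro ζ hζ
    have hpi : (Real.pi : ℂ) ≠ 0 := ofReal_ne_zero.2 Real.pi_ne_zero
    have hs : (sg m : ℂ) * sg m = 1 := by exact_mod_cast sg_mul_self m
    unfold oddPart
    rw [sum_eq_add_other _ m, hg.cauchyInt_eq hk0 hk1 m hζ]
    simp only [hf]
    push_cast
    field_simp
    linear_combination (-(lam m * branch k ζ * Real.pi * N m ζ) : ℂ) * hs

theorem differentiableOn_oddPart (hg : ∀ j, IntegrableOn g (slit k j)) (lam : Fin 2 → ℝ) :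
    DifferentiableOn ℂ (oddPart k lam g) (slitDomain k) := by
  unfold oddPart
  refine DifferentiableOn.const_mul (DifferentiableOn.fun_sum fun j _ => ?_) _
  exact DifferentiableOn.const_mul (fun ζ hζ => (hasDerivAt_cauchyInt (isCompact_slit k j) (hg j)
    (mem_slitDomain.1 hζ j)).differentiableAt.differentiableWithinAt) _

/-- On the banks of `l_j` the imaginary part of the odd part comes from `-λ_j q N_j` alone, which is
`±(-1)^j iλ_j |q| N_j = ±(-1)^j iλ_j g`. -/
theorem IsTipRegular.isSchwarz_oddPart (hg : IsTipRegular k U N g) (hk0 : 0 < k) (hk1 : k < 1)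
    (lam : Fin 2 → ℝ) :
    IsSchwarz k (fun j s ξ => s.sgn * sg j * (lam j * g ξ)) (oddPart k lam g) := by
  have hbank : ∀ j, ∀ ξ ∈ slit k j, ∀ s, ∃ w, Tendsto (oddPart k lam g) (bankFilter s ξ) (𝓝 w) ∧
      w.im = s.sgn * sg j * (lam j * g ξ) := by
    intro j ξ hξ s
    obtain ⟨ψ, h1, h2, h3, h4⟩ := hg.exists_regular hk0 hk1 lam hξ
    have l := ((((tendsto_branch_bank hk0 hξ s).const_mul (lam j : ℂ)).mul
      (h3.tendsto.mono_left (bankFilter_le_nhds s ξ))).neg).add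
      (h1.tendsto.mono_left (bankFilter_le_nhds s ξ))
    refine ⟨_, l.congr' ?_, ?_⟩
    · filter_upwards [eventually_bank_mem_slitDomain s ξ] with ζ hζ using (h4 ζ hζ).symm
    · rw [show N j ξ = ((N j ξ).re : ℂ) from Complex.ext rfl (by simp [hg.real j ξ hξ]),
        hg.eq j ξ hξ]
      simp only [add_im, h2, add_zero, bankV]
      simp
      ring
  refine ⟨differentiableOn_oddPart hg.integrableOn lam, ⟨fun j ξ hξ s => ?_, fun e he => ?_⟩,
    fun j ξ hξ s => ?_⟩
  · obtain ⟨w, hw, -⟩ := hbank j ξ hξ s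
    exact ⟨w, hw⟩
  · obtain ⟨j, hj⟩ := exists_slit_of_tip hk1 he
    obtain ⟨ψ, h1, h2, h3, h4⟩ := hg.exists_regular hk0 hk1 lam hj
    have l := (((((tendsto_branch_tip he).const_mul (lam j : ℂ)).mul h3.tendsto).neg).add
      h1.tendsto).mono_left (nhdsWithin_le_nhds (s := slitDomain k))
    refine ⟨_, l.congr' ?_⟩
    filter_upwards [self_mem_nhdsWithin] with ζ hζ using (h4 ζ hζ).symm
  · obtain ⟨w, hw, hwi⟩ := hbank j ξ hξ s
    rw [← hwi]
    exact (continuous_im.tendsto w).comp hw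

end Odd

end

section

variable {k : ℝ}

/-! ### The particular solution and its behaviour at infinity -/

/-- The density `A_j ± (-1)^j λ_j g` on the banks of `l_j`, with `A_j = α_j + r_j/(ξ - z)`. -/
def bankDens (z : ℝ) (α r lam : Fin 2 → ℝ) (g : ℝ → ℝ) (j : Fin 2) (s : Bank) (ξ : ℝ) : ℝ :=
  ratDens z (α j) (r j) ξ + s.sgn * sg j * (lam j * g ξ)

/-- The solution of the Schwarz problem with the density `bankDens` given by singular integrals. -/
def particularSol (k z : ℝ) (α r lam : Fin 2 → ℝ) (g : ℝ → ℝ) (ζ : ℂ) : ℂ :=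
  evenPart k z α r ζ + oddPart k lam g ζ

/-- The moment `∑_j (-1)^j ∫_{l_j} A_j dξ/|q|`, the obstruction to boundedness at infinity. -/
def moment (k z : ℝ) (α r : Fin 2 → ℝ) : ℝ :=
  ∑ j, sg j * ∫ η in slit k j, ratDens z (α j) (r j) η / absq k η

variable {z : ℝ} {α r lam : Fin 2 → ℝ} {U : Fin 2 → Set ℂ} {N : Fin 2 → ℂ → ℂ} {g : ℝ → ℝ}

theorem isSchwarz_particularSol (hk0 : 0 < k) (hk1 : k < 1) (hz : z ∈ Ioo (-k) k)
    (hg : IsTipRegular k U N g) :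
    IsSchwarz k (bankDens z α r lam g) (particularSol k z α r lam g) :=
  (isSchwarz_evenPart α r hk0 hk1 hz).add (hg.isSchwarz_oddPart hk0 hk1 lam)

theorem evenPart_conj (hk0 : 0 < k) (hk1 : k < 1) {ζ : ℂ} (h : ζ ∈ slitDomain k) :
    conj (evenPart k z α r (conj ζ)) =
      I * (-branch k ζ) / Real.pi * ∑ j, (sg j : ℂ) * ratInt k z (α j) (r j) j ζ := by
  unfold evenPart ratInt
  simp only [map_mul, map_div₀, map_sum, conj_I, conj_ofReal, cauchyInt_conj, conj_conj,
    branch_conj hk0 hk1 h]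
  ring

theorem oddPart_conj (ζ : ℂ) : conj (oddPart k lam g (conj ζ)) = oddPart k lam g ζ := by
  unfold oddPart
  simp only [map_mul, map_div₀, map_sum, map_one, conj_ofReal, cauchyInt_conj, conj_conj]

/-- Integration along a loop subtracts the lower bank from the upper one: equal densities survive
with the factor `u/v`, opposite ones with the factor `1`. -/
theorem loopIntegral_bankDens (hk0 : 0 < k) (hk1 : k < 1) (hz : z ∈ Ioo (-k) k)
    (hg : IsTipRegular k U N g) (j : Fin 2) {ζ : ℂ} (h : ζ ∈ slitDomain k) (u : ℂ) :
    loopIntegral k j (fun s ξ =>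
      (bankDens z α r lam g j s ξ : ℂ) * (1 + u / bankV k j s ξ) / ((ξ : ℂ) - ζ)) =
      2 * (((sg j * lam j : ℝ) : ℂ) * cauchyInt g (slit k j) ζ +
        I * u * (sg j * ratInt k z (α j) (r j) j ζ)) := by
  have hS := isCompact_slit k j
  have hne := mem_slitDomain.1 h j
  have i1 := integrableOn_ratDens_div hk0 hk1 hz (α j) (r j) j
  have i2 : IntegrableOn (ratDens z (α j) (r j)) (slit k j) :=
    (continuousOn_ratDens hz (α j) (r j) j).integrableOn_compact hS
  have i3 := hg.integrableOn j
  have i4 : IntegrableOn (fun η => g η / absq k η) (slit k j) := by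
    have := (integrableOn_inv_absq hk0 hk1 j).continuousOn_mul (hg.continuousOn j) hS
    simpa [div_eq_mul_inv] using this
  have key : ∀ s : Bank, EqOn (fun ξ : ℝ =>
      (bankDens z α r lam g j s ξ : ℂ) * (1 + u / bankV k j s ξ) / ((ξ : ℂ) - ζ))
      (fun ξ : ℝ => ((((ratDens z (α j) (r j) ξ : ℝ) : ℂ) / ((ξ : ℂ) - ζ) +
        ((s.sgn * sg j * lam j : ℝ) : ℂ) * ((g ξ : ℂ) / ((ξ : ℂ) - ζ))) +
        (I * u * ((s.sgn * sg j : ℝ) : ℂ) *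
          (((ratDens z (α j) (r j) ξ / absq k ξ : ℝ) : ℂ) / ((ξ : ℂ) - ζ)) +
        I * u * (lam j : ℂ) * (((g ξ / absq k ξ : ℝ) : ℂ) / ((ξ : ℂ) - ζ))))) (slit k j) := by
    intro s ξ hξ
    have h1 : (bankV k j s ξ)⁻¹ = I * ((s.sgn * sg j : ℝ) : ℂ) * (absq k ξ : ℂ)⁻¹ := by
      have e1 : (s.sgn : ℂ)⁻¹ = s.sgn :=
        inv_eq_of_mul_eq_one_right (by exact_mod_cast s.sgn_mul_self)
      have e2 : (sg j : ℂ)⁻¹ = sg j := inv_eq_of_mul_eq_one_right (by exact_mod_cast sg_mul_self j)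
      unfold bankV
      push_cast
      rw [neg_mul, inv_neg, mul_inv, mul_inv, mul_inv, e1, e2, inv_I]
      ring
    have h2 : (s.sgn : ℂ) * s.sgn = 1 := by exact_mod_cast s.sgn_mul_self
    have h3 : (sg j : ℂ) * sg j = 1 := by exact_mod_cast sg_mul_self j
    simp only [bankDens, div_eq_mul_inv u, h1]
    push_cast
    simp only [div_eq_mul_inv]
    linear_combination (I * u * lam j * g ξ * (absq k ξ : ℂ)⁻¹ * ((ξ : ℂ) - ζ)⁻¹) *
      (sg j * sg j * h2 + h3)
  unfold loopIntegral
  rw [setIntegral_congr_fun (measurableSet_slit k j) (key Bank.upper),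
    setIntegral_congr_fun (measurableSet_slit k j) (key Bank.lower)]
  have c1 := integrableOn_cauchy hS i1 hne
  have c2 := integrableOn_cauchy hS i2 hne
  have c3 := integrableOn_cauchy hS i3 hne
  have c4 := integrableOn_cauchy hS i4 hne
  have split : ∀ p q w : ℂ, ∫ ξ in slit k j, ((((ratDens z (α j) (r j) ξ : ℝ) : ℂ) /
      ((ξ : ℂ) - ζ) + p * ((g ξ : ℂ) / ((ξ : ℂ) - ζ))) +
      (q * (((ratDens z (α j) (r j) ξ / absq k ξ : ℝ) : ℂ) / ((ξ : ℂ) - ζ)) +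
        w * (((g ξ / absq k ξ : ℝ) : ℂ) / ((ξ : ℂ) - ζ)))) =
      (cauchyInt (ratDens z (α j) (r j)) (slit k j) ζ + p * cauchyInt g (slit k j) ζ) +
      (q * ratInt k z (α j) (r j) j ζ +
        w * cauchyInt (fun η => g η / absq k η) (slit k j) ζ) := by
    intro p q w
    unfold ratInt cauchyInt
    have a1 : IntegrableOn (fun ξ : ℝ => ((ratDens z (α j) (r j) ξ : ℝ) : ℂ) / ((ξ : ℂ) - ζ) +
        p * ((g ξ : ℂ) / ((ξ : ℂ) - ζ))) (slit k j) := c2.add (c3.const_mul p)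
    have a2 : IntegrableOn (fun ξ : ℝ =>
        q * (((ratDens z (α j) (r j) ξ / absq k ξ : ℝ) : ℂ) / ((ξ : ℂ) - ζ)) +
        w * (((g ξ / absq k ξ : ℝ) : ℂ) / ((ξ : ℂ) - ζ))) (slit k j) :=
      (c1.const_mul q).add (c4.const_mul w)
    rw [integral_add a1 a2, integral_add c2 (c3.const_mul p), integral_add (c1.const_mul q) (c4.const_mul w),
      integral_const_mul, integral_const_mul, integral_const_mul]
  rw [split, split]
  simp only [Bank.sgn]
  push_cast
  ring

theorem rhFormula_eq (hk0 : 0 < k) (hk1 : k < 1) (hz : z ∈ Ioo (-k) k)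
    (hg : IsTipRegular k U N g) (b₀ b₁ : ℝ) {ζ : ℂ} (h : ζ ∈ slitDomain k) (u : ℂ) :
    rhFormula k (bankDens z α r lam g) b₀ b₁ (ζ, u) = b₀ + b₁ * ζ +
      (I * u / Real.pi * (∑ j, (sg j : ℂ) * ratInt k z (α j) (r j) j ζ) + oddPart k lam g ζ) := by
  unfold rhFormula oddPart
  simp only [loopIntegral_bankDens hk0 hk1 hz hg _ h, Fin.sum_univ_two]
  have hpi : (Real.pi : ℂ) ≠ 0 := ofReal_ne_zero.2 Real.pi_ne_zero
  field_simp
  ring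

theorem rhFormula_eq_lift (hk0 : 0 < k) (hk1 : k < 1) (hz : z ∈ Ioo (-k) k)
    (hg : IsTipRegular k U N g) (b₀ b₁ : ℝ) {p : ℂ × ℂ} (hp : p ∈ sheetOne k ∪ sheetTwo k) :
    rhFormula k (bankDens z α r lam g) b₀ b₁ p =
      b₀ + b₁ * p.1 + lift k (particularSol k z α r lam g) p := by
  obtain ⟨ζ, u⟩ := p
  rcases hp with ⟨hζ, hu⟩ | ⟨hζ, hu⟩
  · simp only at hζ hu
    rw [rhFormula_eq hk0 hk1 hz hg b₀ b₁ hζ, hu, lift_one]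
    rfl
  · simp only at hζ hu
    rw [rhFormula_eq hk0 hk1 hz hg b₀ b₁ hζ, hu, lift_two hk1 _ hζ, particularSol, map_add,
      evenPart_conj hk0 hk1 hζ, oddPart_conj]

theorem tendsto_oddPart_cocompact (hg : ∀ j, IntegrableOn g (slit k j)) :
    Tendsto (oddPart k lam g) (cocompact ℂ) (𝓝 0) := by
  have := (tendsto_finsetSum Finset.univ fun j _ => (tendsto_cauchyInt_cocompact
    (isCompact_slit k j) (hg j)).const_mul ((sg j * lam j : ℝ) : ℂ)).const_mul (1 / Real.pi : ℂ)
  refine this.trans_eq ?_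
  simp

/-- The leading coefficient of the particular solution at infinity is purely imaginary. -/
theorem tendsto_particularSol_div (hk0 : 0 < k) (hk1 : k < 1) (hz : z ∈ Ioo (-k) k)
    (hg : ∀ j, IntegrableOn g (slit k j)) :
    Tendsto (fun ζ => particularSol k z α r lam g ζ / ζ) (cocompact ℂ)
      (𝓝 (-(I / Real.pi * moment k z α r))) := by
  have h1 := tendsto_finsetSum Finset.univ fun j _ => (tendsto_mul_cauchyInt
    (isCompact_slit k j) (integrableOn_ratDens_div hk0 hk1 hz (α j) (r j) j)).const_mul (sg j : ℂ)
  have h2 := ((tendsto_branch_div_sq hk0 hk1).mul h1).const_mul (I / Real.pi)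
  have h3 := h2.add ((tendsto_oddPart_cocompact (lam := lam) hg).mul tendsto_inv_cocompact)
  refine (h3.congr' ?_).trans_eq ?_
  · filter_upwards [eventually_one_lt_norm] with ζ hζ
    have h0 : ζ ≠ 0 := fun h' => by rw [h', norm_zero] at hζ; linarith
    simp only [particularSol, evenPart, ratInt, Fin.sum_univ_two]
    field_simp
  · congr 1
    simp only [moment, Fin.sum_univ_two]
    push_cast
    ring

theorem isBigO_of_tendsto_div {f : ℂ → ℂ} {w : ℂ}
    (h : Tendsto (fun ζ => f ζ / ζ) (cocompact ℂ) (𝓝 w)) : f =O[cocompact ℂ] (fun ζ => ζ) := by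
  have h1 := (h.isBigO_one ℂ).mul (isBigO_refl (fun ζ : ℂ => ζ) (cocompact ℂ))
  refine h1.congr' ?_ (Eventually.of_forall fun ζ => one_mul ζ)
  filter_upwards [eventually_one_lt_norm] with ζ hζ
  have h0 : ζ ≠ 0 := fun h' => by rw [h', norm_zero] at hζ; linarith
  field_simp

theorem isBigO_particularSol (hk0 : 0 < k) (hk1 : k < 1) (hz : z ∈ Ioo (-k) k)
    (hg : ∀ j, IntegrableOn g (slit k j)) :
    particularSol k z α r lam g =O[cocompact ℂ] (fun ζ => ζ) :=
  isBigO_of_tendsto_div (tendsto_particularSol_div hk0 hk1 hz hg)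

theorem isBigO_one_particularSol (hk0 : 0 < k) (hk1 : k < 1) (hz : z ∈ Ioo (-k) k)
    (hg : ∀ j, IntegrableOn g (slit k j)) (hm : moment k z α r = 0) :
    particularSol k z α r lam g =O[cocompact ℂ] (fun _ => (1 : ℝ)) := by
  have i1 := fun j => integrableOn_ratDens_div hk0 hk1 hz (α j) (r j) j
  have i2 : ∀ j, IntegrableOn (fun η => η * (ratDens z (α j) (r j) η / absq k η)) (slit k j) :=
    fun j => (i1 j).continuousOn_mul continuousOn_id (isCompact_slit k j)
  have h1 := tendsto_finsetSum Finset.univ fun j _ => (tendsto_mul_cauchyInt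
    (isCompact_slit k j) (i2 j)).const_mul (sg j : ℂ)
  have h2 := ((tendsto_branch_div_sq hk0 hk1).mul h1).const_mul (I / Real.pi)
  refine IsBigO.add ?_ ((tendsto_oddPart_cocompact hg).isBigO_one ℝ)
  refine (h2.isBigO_one ℝ).congr' ?_ EventuallyEq.rfl
  filter_upwards [eventually_one_lt_norm] with ζ hζ
  have h0 : ζ ≠ 0 := fun h' => by rw [h', norm_zero] at hζ; linarith
  have hs := mem_slitDomain.1 (mem_slitDomain_of_one_lt_norm hk0 hζ)
  have e0 := mul_cauchyInt (isCompact_slit k 0) (i1 0) (hs 0)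
  have e1 := mul_cauchyInt (isCompact_slit k 1) (i1 1) (hs 1)
  have hm' : (sg 0 : ℂ) * ((∫ η in slit k 0, ratDens z (α 0) (r 0) η / absq k η : ℝ) : ℂ) +
      (sg 1 : ℂ) * ((∫ η in slit k 1, ratDens z (α 1) (r 1) η / absq k η : ℝ) : ℂ) = 0 := by
    simp only [moment, Fin.sum_univ_two] at hm
    exact_mod_cast hm
  simp only [evenPart, ratInt, Fin.sum_univ_two]
  have e2 : (sg 0 : ℂ) * cauchyInt (fun η => η * (ratDens z (α 0) (r 0) η / absq k η)) (slit k 0) ζ +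
      (sg 1 : ℂ) * cauchyInt (fun η => η * (ratDens z (α 1) (r 1) η / absq k η)) (slit k 1) ζ =
      ζ * ((sg 0 : ℂ) * cauchyInt (fun η => ratDens z (α 0) (r 0) η / absq k η) (slit k 0) ζ +
        (sg 1 : ℂ) * cauchyInt (fun η => ratDens z (α 1) (r 1) η / absq k η) (slit k 1) ζ) := by
    linear_combination (-(sg 0 : ℂ)) * e0 - (sg 1 : ℂ) * e1 + hm'
  have e3 : (sg 0 : ℂ) * (ζ * cauchyInt (fun η => η * (ratDens z (α 0) (r 0) η / absq k η))
        (slit k 0) ζ) +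
      (sg 1 : ℂ) * (ζ * cauchyInt (fun η => η * (ratDens z (α 1) (r 1) η / absq k η))
        (slit k 1) ζ) =
      ζ ^ 2 * ((sg 0 : ℂ) * cauchyInt (fun η => ratDens z (α 0) (r 0) η / absq k η) (slit k 0) ζ +
        (sg 1 : ℂ) * cauchyInt (fun η => ratDens z (α 1) (r 1) η / absq k η) (slit k 1) ζ) := by
    linear_combination ζ * e2
  rw [e3]
  field_simp

/-- An affine function plus the particular solution is bounded at infinity only if both the slope
and the moment vanish: they are the real and the imaginary part of the coefficient of `ζ`. -/
theorem isBigO_one_affine_add_iff (hk0 : 0 < k) (hk1 : k < 1) (hz : z ∈ Ioo (-k) k)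
    (hg : ∀ j, IntegrableOn g (slit k j)) (b₀ b₁ : ℝ) :
    (fun ζ => b₀ + b₁ * ζ + particularSol k z α r lam g ζ) =O[cocompact ℂ] (fun _ => (1 : ℝ)) ↔
      b₁ = 0 ∧ moment k z α r = 0 := by
  constructor
  · intro h
    have l1 : Tendsto (fun ζ => (b₀ + b₁ * ζ + particularSol k z α r lam g ζ) / ζ) (cocompact ℂ)
        (𝓝 0) := by
      have := (h.mul (isBigO_refl (fun ζ : ℂ => ζ⁻¹) (cocompact ℂ)).norm_right).trans_tendsto
        (by simpa using tendsto_inv_cocompact.norm)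
      simpa [div_eq_mul_inv] using this
    have l2 := ((tendsto_inv_cocompact.const_mul (b₀ : ℂ)).add_const (b₁ : ℂ)).add
      (tendsto_particularSol_div (α := α) (r := r) (lam := lam) hk0 hk1 hz hg)
    have l3 : Tendsto (fun ζ => (b₀ + b₁ * ζ + particularSol k z α r lam g ζ) / ζ) (cocompact ℂ)
        (𝓝 (b₀ * 0 + b₁ + -(I / Real.pi * moment k z α r))) := by
      refine l2.congr' ?_
      filter_upwards [eventually_one_lt_norm] with ζ hζ
      have h0 : ζ ≠ 0 := fun h' => by rw [h', norm_zero] at hζ; linarith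
      field_simp
    have e := tendsto_nhds_unique l1 l3
    have hre := congrArg Complex.re e
    have him := congrArg Complex.im e
    have e2 : (b₀ * 0 + b₁ + -(I / Real.pi * moment k z α r) : ℂ) =
        (b₁ : ℂ) + ((-(moment k z α r / Real.pi) : ℝ) : ℂ) * I := by
      push_cast; ring
    rw [e2] at hre him
    simp at hre him
    exact ⟨hre.symm, him⟩
  · rintro ⟨rfl, hm⟩
    simp only [ofReal_zero, zero_mul, add_zero]
    exact (isBigO_const_const _ one_ne_zero _).add (isBigO_one_particularSol hk0 hk1 hz hg hm)

theorem boundedAtInfinities_rhFormula_iff (hk0 : 0 < k) (hk1 : k < 1) (hz : z ∈ Ioo (-k) k)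
    (hg : IsTipRegular k U N g) (b₀ b₁ : ℝ) :
    BoundedAtInfinities k (rhFormula k (bankDens z α r lam g) b₀ b₁) ↔
      b₁ = 0 ∧ moment k z α r = 0 := by
  have h1 : ∀ ζ ∈ slitDomain k, rhFormula k (bankDens z α r lam g) b₀ b₁ (ζ, branch k ζ) =
      b₀ + b₁ * ζ + particularSol k z α r lam g ζ := fun ζ hζ => by
    rw [rhFormula_eq_lift hk0 hk1 hz hg b₀ b₁ (Or.inl ⟨hζ, rfl⟩), lift_one]
  rw [boundedAtInfinities_iff hk0 fun ζ hζ => ?_,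
    ← isBigO_one_affine_add_iff hk0 hk1 hz hg.integrableOn b₀ b₁]
  · refine isBigO_congr ?_ EventuallyEq.rfl
    filter_upwards [eventually_mem_slitDomain hk0] with ζ hζ using h1 ζ hζ
  · rw [h1 _ (conj_mem_slitDomain hζ), rhFormula_eq_lift hk0 hk1 hz hg b₀ b₁ (Or.inr ⟨hζ, rfl⟩),
      lift_two hk1 _ hζ]
    simp

theorem rh_general_solution_rhFormula (hk0 : 0 < k) (hk1 : k < 1) (hz : z ∈ Ioo (-k) k)
    (hg : IsTipRegular k U N g) (Φ : ℂ × ℂ → ℂ) :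
    (IsRHSolution k (bankDens z α r lam g) Φ ∧ SimplePolesAtInfinities k Φ) ↔
      ∃ b₀ b₁ : ℝ, ∀ p ∈ sheetOne k ∪ sheetTwo k,
        Φ p = rhFormula k (bankDens z α r lam g) b₀ b₁ p := by
  rw [rh_general_solution hk0 hk1 (isSchwarz_particularSol hk0 hk1 hz hg)
    (isBigO_particularSol hk0 hk1 hz hg.integrableOn)]
  refine exists_congr fun b₀ => exists_congr fun b₁ => forall₂_congr fun p hp => ?_
  rw [rhFormula_eq_lift hk0 hk1 hz hg b₀ b₁ hp]

/-- The bounded solutions of the Schwarz problem. -/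
theorem bounded_schwarz_iff (hk0 : 0 < k) (hk1 : k < 1) (hz : z ∈ Ioo (-k) k)
    (hg : IsTipRegular k U N g) (f : ℂ → ℂ) :
    (IsSchwarz k (bankDens z α r lam g) f ∧ f =O[cocompact ℂ] (fun _ => (1 : ℝ))) ↔
      moment k z α r = 0 ∧
        ∃ b₀ : ℝ, ∀ ζ ∈ slitDomain k, f ζ = b₀ + particularSol k z α r lam g ζ := by
  have hS := isSchwarz_particularSol (α := α) (r := r) (lam := lam) hk0 hk1 hz hg
  constructor
  · rintro ⟨hf, hO⟩
    have hd : IsSchwarz k (fun _ _ _ => 0) (fun ζ => f ζ + -particularSol k z α r lam g ζ) := by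
      have := hf.add hS.neg
      simpa using this
    obtain ⟨b₀, b₁, hb⟩ := homogeneous_schwarz hk0 hk1 hd ((hO.trans isBigO_one_id).add
      (isBigO_particularSol hk0 hk1 hz hg.integrableOn).neg_left)
    have hb' : ∀ ζ ∈ slitDomain k, f ζ = b₀ + b₁ * ζ + particularSol k z α r lam g ζ :=
      fun ζ hζ => by linear_combination hb ζ hζ
    obtain ⟨h1, h2⟩ := (isBigO_one_affine_add_iff hk0 hk1 hz hg.integrableOn b₀ b₁).1
      (hO.congr' (by
        filter_upwards [eventually_mem_slitDomain hk0] with ζ hζ using hb' ζ hζ) EventuallyEq.rfl)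
    refine ⟨h2, b₀, fun ζ hζ => ?_⟩
    rw [hb' ζ hζ, h1]
    simp
  · rintro ⟨hm, b₀, hb⟩
    refine ⟨?_, ?_⟩
    · have := ((isSchwarz_affine hk1 b₀ 0).add hS).congr (g := f) hk1 fun ζ hζ => by
        rw [hb ζ hζ]; simp
      simpa using this
    · refine ((isBigO_const_const (b₀ : ℂ) (one_ne_zero (α := ℝ)) _).add
        (isBigO_one_particularSol (α := α) (r := r) (lam := lam) hk0 hk1 hz hg.integrableOn
          hm)).congr' ?_ EventuallyEq.rfl
      filter_upwards [eventually_mem_slitDomain hk0] with ζ hζ using (hb ζ hζ).symm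

end

section

/-! ### The densities of the two problems -/

namespace Params

/-- The coefficient `Re[c₋₁(τ̄^∞/μ - τ̄/μ_j)]` of `1/(ξ - ζ_∞)` in `g₀`. -/
def resG (P : Params) (j : Fin 2) : ℝ :=
  (P.cm1 * (conj P.tauInf / P.mu - conj P.tau / P.muIncl j)).re

end Params

variable {P : Params}

theorem Params.Admissible.kappa_ne_one (hP : P.Admissible) (j : Fin 2) : 1 - P.kappa j ≠ 0 := by
  unfold Params.kappa
  have h1 := hP.mu_pos.ne'
  have h2 := hP.muIncl_ne j
  rw [Ne, sub_eq_zero, eq_comm, div_eq_one_iff_eq h1]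
  exact h2

theorem Params.Admissible.lam_ne_zero (hP : P.Admissible) (j : Fin 2) : P.lam j ≠ 0 :=
  div_ne_zero (hP.muIncl_pos j).ne' (hP.kappa_ne_one j)

theorem Params.Admissible.lam_eq (hP : P.Admissible) (j : Fin 2) :
    P.lam j = P.mu * P.lamT j := by
  have h1 := hP.mu_pos.ne'
  have h2 := hP.kappa_ne_one j
  unfold Params.lam Params.lamT
  rw [mul_div_assoc', Params.kappa, mul_div_cancel₀ _ h1]

theorem Params.Admissible.lam_div_sub (hP : P.Admissible) (j : Fin 2) :
    P.lam j / P.muIncl j - P.lam j / P.mu = 1 := by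
  have h1 := hP.mu_pos.ne'
  have h2 := hP.kappa_ne_one j
  have h3 := (hP.muIncl_pos j).ne'
  have h4 : P.lam j / P.mu = P.kappa j / (1 - P.kappa j) := by
    rw [hP.lam_eq, mul_div_cancel_left₀ _ h1, Params.lamT]
  have h5 : P.lam j / P.muIncl j = 1 / (1 - P.kappa j) := by
    rw [Params.lam, div_div_cancel_left' h3, one_div]
  rw [h4, h5, ← sub_div, div_self h2]

theorem Params.Admissible.conj_tau_ne (hP : P.Admissible) : conj P.tau ≠ 0 :=
  (map_ne_zero _).2 hP.tau_ne

theorem Params.Admissible.I_mul_tau_ne (hP : P.Admissible) : I * conj P.tau ≠ 0 :=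
  mul_ne_zero I_ne_zero hP.conj_tau_ne

theorem im_div_sub (c : ℂ) (x z : ℝ) : (c / ((x : ℂ) - z)).im = c.im / (x - z) := by
  rw [← ofReal_sub, div_ofReal_im]

theorem re_div_sub (c : ℂ) (x z : ℝ) : (c / ((x : ℂ) - z)).re = c.re / (x - z) := by
  rw [← ofReal_sub, div_ofReal_re]

theorem densOne_eq (P : Params) (a : Fin 2 → ℝ) (j : Fin 2) :
    densOne P a j = ratDens P.zInf (a j) (-P.c.im) := by
  funext ξ
  rw [densOne, im_div_sub, ratDens, neg_div, sub_eq_add_neg]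

theorem g0_eq (P : Params) (j : Fin 2) : g0 P j = ratDens P.zInf 0 (P.resG j) := by
  funext ξ
  rw [g0, ratDens, zero_add, Params.resG, ← re_div_sub, div_mul_eq_mul_div]

theorem mul_ratDens (z l α r η : ℝ) : l * ratDens z α r η = ratDens z (l * α) (l * r) η := by
  unfold ratDens; ring

theorem densOne_eq_bankDens (P : Params) (a : Fin 2 → ℝ) (g : ℝ → ℝ) :
    (fun j (_ : Bank) ξ => densOne P a j ξ) =
      bankDens P.zInf a (fun _ => -P.c.im) (fun _ => 0) g := by
  funext j s ξ
  rw [densOne_eq, bankDens]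
  ring

theorem densTwo_eq_bankDens (P : Params) (a ρ' : Fin 2 → ℝ) :
    densTwo P a ρ' = bankDens P.zInf (fun j => P.lam j * ρ' j) (fun j => P.lam j * P.resG j)
      P.lam (g1 P a) := by
  funext j s ξ
  rw [densTwo, g0_eq, bankDens, ← mul_ratDens]
  simp only [ratDens]
  ring

theorem g1_eq (hP : P.Admissible) (a : Fin 2 → ℝ) {m : Fin 2} {ξ : ℝ} (hξ : ξ ∈ slit P.k m) :
    g1 P a ξ = absq P.k ξ * (localFactor P.k P.zInf a (fun _ => -P.c.im) m ξ).re := by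
  unfold g1
  simp only [densOne_eq]
  exact singularInt_eq a (fun _ => -P.c.im) hP.k_pos hP.k_lt_one hP.zInf_mem hξ

/-- The density `g₁` vanishes at the tips like `|q|`. -/
theorem isTipRegular_g1 (hP : P.Admissible) (a : Fin 2 → ℝ) :
    IsTipRegular P.k (nearSlit P.k P.zInf) (localFactor P.k P.zInf a (fun _ => -P.c.im))
      (g1 P a) where
  isOpen := isOpen_nearSlit _ _
  subset _ _ hξ := mem_nearSlit hP.k_pos hP.zInf_mem hξ
  disjoint _ _ hζ := ne_of_mem_nearSlit hζ
  differentiableOn := differentiableOn_localFactor a _ hP.k_pos hP.k_lt_one hP.zInf_mem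
  real j ξ _ := localFactor_im_ofReal a _ j ξ
  eq _ _ hξ := g1_eq hP a hξ

theorem moment_eq (hk0 : 0 < P.k) (hk1 : P.k < 1) (hz : P.zInf ∈ Ioo (-P.k) P.k)
    (α r : Fin 2 → ℝ) :
    moment P.k P.zInf α r = (α 0 - α 1) * (∫ η in slit P.k 1, 1 / absq P.k η) +
      ((∫ η in slit P.k 0, ratDens P.zInf 0 (r 0) η / absq P.k η) -
        ∫ η in slit P.k 1, ratDens P.zInf 0 (r 1) η / absq P.k η) := by
  have h : ∀ j, ∫ η in slit P.k j, ratDens P.zInf (α j) (r j) η / absq P.k η =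
      α j * (∫ η in slit P.k j, 1 / absq P.k η) +
        ∫ η in slit P.k j, ratDens P.zInf 0 (r j) η / absq P.k η := by
    intro j
    rw [← integral_const_mul, ← integral_add ((integrableOn_inv_absq hk0 hk1 j).const_mul _)
      (integrableOn_ratDens_div hk0 hk1 hz 0 (r j) j)]
    congr 1
    funext η
    simp only [ratDens]
    ring
  simp only [moment, Fin.sum_univ_two, h, integral_inv_absq_zero, sg_zero, sg_one]
  ring

theorem moment_eq_zero_iff_solvOne (hP : P.Admissible) (a : Fin 2 → ℝ) :
    moment P.k P.zInf a (fun _ => -P.c.im) = 0 ↔ SolvOne P a := by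
  have hT := (integral_inv_absq_pos hP.k_pos hP.k_lt_one).ne'
  rw [moment_eq hP.k_pos hP.k_lt_one hP.zInf_mem, SolvOne]
  have h : ∀ j, ∫ η in slit P.k j, (P.c / ((η : ℂ) - P.zInf)).im / absq P.k η =
      -∫ η in slit P.k j, ratDens P.zInf 0 (-P.c.im) η / absq P.k η := by
    intro j
    rw [← integral_neg]
    congr 1
    funext η
    rw [im_div_sub, ratDens]
    ring
  rw [h, h, eq_comm (a := a 0 - a 1), inv_mul_eq_iff_eq_mul₀ hT]
  constructor <;> intro h' <;> linear_combination -h'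

theorem moment_eq_zero_iff_solvTwo (hP : P.Admissible) (ρ' : Fin 2 → ℝ) :
    moment P.k P.zInf (fun j => P.lam j * ρ' j) (fun j => P.lam j * P.resG j) = 0 ↔
      SolvTwo P ρ' := by
  have hT := (integral_inv_absq_pos hP.k_pos hP.k_lt_one).ne'
  rw [moment_eq hP.k_pos hP.k_lt_one hP.zInf_mem, SolvTwo]
  have h : ∀ j, ∫ η in slit P.k j, ratDens P.zInf 0 (P.lam j * P.resG j) η / absq P.k η =
      P.lam j * ∫ η in slit P.k j, g0 P j η / absq P.k η := by
    intro j
    rw [← integral_const_mul, g0_eq]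
    congr 1
    funext η
    simp only [ratDens]
    ring
  rw [h, h, eq_comm (a := P.lam 0 * ρ' 0 - P.lam 1 * ρ' 1), neg_mul, neg_eq_iff_eq_neg,
    inv_mul_eq_iff_eq_mul₀ hT]
  constructor <;> intro h' <;> linear_combination h'

/-! ### The regular part at the pole -/

theorem regularPart_of_ne (P : Params) (r : ℂ) (f : ℂ → ℂ) {ζ : ℂ} (h : ζ ≠ P.zInf) :
    regularPart P r f ζ = f ζ - r / (ζ - P.zInf) := Function.update_of_ne h _ _

theorem tendsto_pole_cocompact (r : ℂ) (z : ℂ) :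
    Tendsto (fun ζ : ℂ => r / (ζ - z)) (cocompact ℂ) (𝓝 0) := by
  have h1 : Tendsto (fun ζ : ℂ => ζ - z) (cocompact ℂ) (cocompact ℂ) := by
    simpa [sub_eq_add_neg] using
      (Homeomorph.addRight (-z)).isClosedEmbedding.tendsto_cocompact
  simpa [div_eq_mul_inv] using (tendsto_inv_cocompact.comp h1).const_mul r

theorem differentiableAt_pole (r : ℂ) {z ζ : ℂ} (h : ζ ≠ z) :
    DifferentiableAt ℂ (fun ζ : ℂ => r / (ζ - z)) ζ :=
  (differentiableAt_const _).div (by fun_prop) (sub_ne_zero.2 h)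

theorem ofReal_ne_zInf (hP : P.Admissible) {j : Fin 2} {ξ : ℝ} (hξ : ξ ∈ slit P.k j) :
    (ξ : ℂ) ≠ P.zInf := fun h => not_mem_slit_of_mid hP.zInf_mem j (ofReal_inj.1 h ▸ hξ)

theorem tendsto_pole_bank (hP : P.Admissible) (r : ℂ) {j : Fin 2} {ξ : ℝ} (hξ : ξ ∈ slit P.k j)
    (s : Bank) : Tendsto (fun ζ : ℂ => r / (ζ - P.zInf)) (bankFilter s ξ)
      (𝓝 (r / ((ξ : ℂ) - P.zInf))) :=
  (differentiableAt_pole r (ofReal_ne_zInf hP hξ)).continuousAt.tendsto.mono_left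
    (bankFilter_le_nhds s ξ)

theorem eventually_bank_mem_punctured (hP : P.Admissible) {j : Fin 2} {ξ : ℝ}
    (hξ : ξ ∈ slit P.k j) (s : Bank) : ∀ᶠ ζ in bankFilter s ξ, ζ ∈ P.punctured :=
  (eventually_bank_mem_slitDomain s ξ).and
    (bankFilter_le_nhds s ξ (isOpen_ne.mem_nhds (ofReal_ne_zInf hP hξ)))

theorem eventually_mem_punctured (hP : P.Admissible) : ∀ᶠ ζ in cocompact ℂ, ζ ∈ P.punctured :=
  (eventually_mem_slitDomain hP.k_pos).and (isCompact_singleton.compl_mem_cocompact)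

theorem punctured_mem_nhdsNE (hP : P.Admissible) : P.punctured ∈ 𝓝[≠] (P.zInf : ℂ) :=
  inter_mem (mem_nhdsWithin_of_mem_nhds
    ((isOpen_slitDomain P.k).mem_nhds (mid_mem_slitDomain hP.zInf_mem))) self_mem_nhdsWithin

theorem continuousUpToSlits_pole (hP : P.Admissible) (r : ℂ) :
    ContinuousUpToSlits P.k (fun ζ => r / (ζ - P.zInf)) :=
  continuousUpToSlits_of_continuousAt hP.k_lt_one fun _ _ hξ =>
    (differentiableAt_pole r (ofReal_ne_zInf hP hξ)).continuousAt

/-- Removability: the class of functions in both problems, in terms of a nonzero multiple of the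
regular part; boundedness at infinity is enough for a limit there. -/
theorem isSlitFunction_iff (hP : P.Admissible) {r e : ℂ} (he : e ≠ 0) (f : ℂ → ℂ) :
    IsSlitFunction P r f ↔
      DifferentiableOn ℂ (fun ζ => e * regularPart P r f ζ) (slitDomain P.k) ∧
      ContinuousUpToSlits P.k (fun ζ => e * regularPart P r f ζ) ∧
      (fun ζ => e * regularPart P r f ζ) =O[cocompact ℂ] (fun _ => (1 : ℝ)) := by
  have hU := (isOpen_slitDomain P.k).mem_nhds (mid_mem_slitDomain hP.zInf_mem)
  have hV : ∀ j, ∀ ξ ∈ slit P.k j, {ζ : ℂ | ζ ≠ P.zInf} ∈ 𝓝[slitDomain P.k] (ξ : ℂ) :=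
    fun j ξ hξ => mem_nhdsWithin_of_mem_nhds (isOpen_ne.mem_nhds (ofReal_ne_zInf hP hξ))
  have hinf : ∀ᶠ ζ in cocompact ℂ, e * regularPart P r f ζ = e * (f ζ - r / (ζ - P.zInf)) := by
    filter_upwards [eventually_mem_punctured hP] with ζ hζ
    rw [regularPart_of_ne P r f hζ.2]
  constructor
  · intro h
    refine ⟨DifferentiableOn.const_mul ?_ e, ?_, ?_⟩
    · refine (differentiableOn_compl_singleton_and_continuousAt_iff hU).1 ⟨?_, ?_⟩
      · refine (h.analytic.sub fun ζ hζ =>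
          (differentiableAt_pole r hζ.2).differentiableWithinAt).congr fun ζ hζ => ?_
        exact regularPart_of_ne P r f hζ.2
      · exact continuousAt_update_same.2 (tendsto_nhds_limUnder h.pole)
    · refine ContinuousUpToSlits.const_mul ?_ e
      refine (h.boundary.add (continuousUpToSlits_pole hP (-r))).congr hV hP.k_lt_one ?_
      intro ζ hζ
      simp only
      rw [regularPart_of_ne P r f hζ, neg_div, ← sub_eq_add_neg]
    · obtain ⟨w, hw⟩ := h.at_infinity
      exact (((hw.sub (tendsto_pole_cocompact r P.zInf)).const_mul e).isBigO_one ℝ).congr'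
        (hinf.mono fun _ h => h.symm) EventuallyEq.rfl
  · rintro ⟨h1, h2, h3⟩
    have h1' : DifferentiableOn ℂ (regularPart P r f) (slitDomain P.k) := by
      refine (h1.const_mul e⁻¹).congr fun ζ _ => ?_
      rw [inv_mul_cancel_left₀ he]
    refine ⟨?_, ⟨regularPart P r f P.zInf, ?_⟩, ?_, ?_⟩
    · refine ((h1'.mono sdiff_subset).add fun ζ hζ =>
        (differentiableAt_pole r hζ.2).differentiableWithinAt).congr fun ζ hζ => ?_
      simp only [Pi.add_apply]
      rw [regularPart_of_ne P r f hζ.2, sub_add_cancel]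
    · refine (((h1'.differentiableAt hU).continuousAt.tendsto.mono_left
        nhdsWithin_le_nhds)).congr' ?_
      filter_upwards [self_mem_nhdsWithin] with ζ hζ using regularPart_of_ne P r f hζ
    · obtain ⟨w, hw⟩ := exists_tendsto_of_isBigO_one
        ((eventually_mem_slitDomain hP.k_pos).mono fun ζ hζ =>
          h1.differentiableAt ((isOpen_slitDomain P.k).mem_nhds hζ)) h3
      refine ⟨_, ((hw.const_mul e⁻¹).add (tendsto_pole_cocompact r P.zInf)).congr' ?_⟩
      filter_upwards [hinf] with ζ hζ
      rw [hζ, inv_mul_cancel_left₀ he, sub_add_cancel]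
    · refine ((h2.const_mul e⁻¹).add (continuousUpToSlits_pole hP r)).congr hV hP.k_lt_one ?_
      intro ζ hζ
      simp only
      rw [inv_mul_cancel_left₀ he, regularPart_of_ne P r f hζ, sub_add_cancel]

theorem regularPart_eq_iff (hP : P.Admissible) {r : ℂ} {f G : ℂ → ℂ}
    (hG : ContinuousOn G (slitDomain P.k)) :
    (∀ ζ ∈ slitDomain P.k, regularPart P r f ζ = G ζ) ↔
      ∀ ζ ∈ P.punctured, f ζ = r / (ζ - P.zInf) + G ζ := by
  constructor
  · intro h ζ hζ
    rw [← h ζ hζ.1, regularPart_of_ne P r f hζ.2, add_sub_cancel]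
  · intro h ζ hζ
    by_cases hz : ζ = P.zInf
    · rw [hz, regularPart, Function.update_self]
      have hU := (isOpen_slitDomain P.k).mem_nhds (mid_mem_slitDomain hP.zInf_mem)
      refine Tendsto.limUnder_eq (((hG.continuousAt hU).tendsto.mono_left
        nhdsWithin_le_nhds).congr' ?_)
      filter_upwards [punctured_mem_nhdsNE hP] with ζ' hζ'
      rw [h ζ' hζ', add_sub_cancel_left]
    · rw [regularPart_of_ne P r f hz, h ζ ⟨hζ, hz⟩, add_sub_cancel_left]

/-! ### The first problem -/

theorem tendsto_im_regularPart_iff (hP : P.Admissible) {r e : ℂ} (f : ℂ → ℂ) {j : Fin 2} {ξ : ℝ}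
    (hξ : ξ ∈ slit P.k j) (s : Bank) (y : ℝ) :
    Tendsto (fun ζ => (e * regularPart P r f ζ).im) (bankFilter s ξ) (𝓝 y) ↔
      Tendsto (fun ζ => (e * f ζ).im) (bankFilter s ξ)
        (𝓝 (y + (e * (r / ((ξ : ℂ) - P.zInf))).im)) := by
  have hp : Tendsto (fun ζ : ℂ => (e * (r / (ζ - P.zInf))).im) (bankFilter s ξ)
      (𝓝 (e * (r / ((ξ : ℂ) - P.zInf))).im) :=
    (continuous_im.tendsto _).comp ((tendsto_pole_bank hP r hξ s).const_mul e)
  have heq : ∀ᶠ ζ in bankFilter s ξ, (e * regularPart P r f ζ).im =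
      (e * f ζ).im - (e * (r / (ζ - P.zInf))).im := by
    filter_upwards [eventually_bank_mem_punctured hP hξ s] with ζ hζ
    rw [regularPart_of_ne P r f hζ.2, mul_sub, sub_im]
  constructor
  · intro h
    refine (h.add hp).congr' ?_
    filter_upwards [heq] with ζ hζ
    rw [hζ, sub_add_cancel]
  · intro h
    have := h.sub hp
    rw [add_sub_cancel_right] at this
    exact this.congr' (heq.mono fun _ h => h.symm)

theorem isSchwarzOne_iff (hP : P.Admissible) (a : Fin 2 → ℝ) (F : ℂ → ℂ) :
    IsSchwarzOne P a F ↔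
      IsSchwarz P.k (fun j _ ξ => densOne P a j ξ) (regularPart P P.c F) ∧
        regularPart P P.c F =O[cocompact ℂ] (fun _ => (1 : ℝ)) := by
  have hb : (∀ j, ∀ ξ ∈ slit P.k j, ∀ s, Tendsto (fun ζ => (F ζ).im) (bankFilter s ξ) (𝓝 (a j))) ↔
      ∀ j, ∀ ξ ∈ slit P.k j, ∀ s : Bank, Tendsto (fun ζ => (regularPart P P.c F ζ).im)
        (bankFilter s ξ) (𝓝 (densOne P a j ξ)) := by
    refine forall_congr' fun j => forall₂_congr fun ξ hξ => forall_congr' fun s => ?_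
    have := tendsto_im_regularPart_iff hP (r := P.c) (e := 1) F hξ s (densOne P a j ξ)
    simp only [one_mul] at this
    rw [this, densOne, sub_add_cancel]
  have hs := isSlitFunction_iff hP (r := P.c) one_ne_zero F
  simp only [one_mul] at hs
  rw [IsSchwarzOne, hs, hb]
  exact ⟨fun h => ⟨⟨h.1.1, h.1.2.1, h.2⟩, h.1.2.2⟩, fun h => ⟨⟨h.1.1, h.1.2, h.2⟩, h.1.3⟩⟩

theorem ratInt_mul (k z l α r : ℝ) (j : Fin 2) (ζ : ℂ) :
    ratInt k z (l * α) (l * r) j ζ = l * ratInt k z α r j ζ := by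
  unfold ratInt
  rw [← cauchyInt_const_mul]
  simp only [← mul_ratDens, mul_div_assoc]

theorem formulaOne_eq (P : Params) (a : Fin 2 → ℝ) (β₀ : ℝ) (ζ : ℂ) :
    formulaOne P a β₀ ζ =
      β₀ + P.c / (ζ - P.zInf) + evenPart P.k P.zInf a (fun _ => -P.c.im) ζ := by
  have h : ∀ j, loopIntegral P.k j
      (fun s η => (densOne P a j η : ℂ) / (((η : ℂ) - ζ) * bankV P.k j s η)) =
      2 * I * sg j * ratInt P.k P.zInf (a j) (-P.c.im) j ζ := by
    intro j
    have key : ∀ (s : Bank) (η : ℝ),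
        (densOne P a j η : ℂ) / (((η : ℂ) - ζ) * bankV P.k j s η) =
        (I * sg j * s.sgn) * (((ratDens P.zInf (a j) (-P.c.im) η / absq P.k η : ℝ) : ℂ) /
          ((η : ℂ) - ζ)) := by
      intro s η
      have e1 : (s.sgn : ℂ)⁻¹ = s.sgn :=
        inv_eq_of_mul_eq_one_right (by exact_mod_cast s.sgn_mul_self)
      have e2 : (sg j : ℂ)⁻¹ = sg j := inv_eq_of_mul_eq_one_right (by exact_mod_cast sg_mul_self j)
      rw [densOne_eq, bankV]
      push_cast
      rw [div_eq_mul_inv, mul_inv, neg_mul, inv_neg, mul_inv, mul_inv, mul_inv, e1, e2, inv_I]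
      ring
    unfold loopIntegral ratInt cauchyInt
    simp only [key]
    rw [integral_const_mul, integral_const_mul]
    simp only [Bank.sgn]
    push_cast
    ring
  have hpi : (Real.pi : ℂ) ≠ 0 := ofReal_ne_zero.2 Real.pi_ne_zero
  simp only [formulaOne, h, evenPart, Fin.sum_univ_two]
  field_simp

theorem particularSol_zero (k z : ℝ) (α r : Fin 2 → ℝ) (g : ℝ → ℝ) (ζ : ℂ) :
    particularSol k z α r (fun _ => 0) g ζ = evenPart k z α r ζ := by
  simp [particularSol, oddPart]

theorem isSchwarzOne_iff_formula (hP : P.Admissible) (a : Fin 2 → ℝ) (F : ℂ → ℂ) :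
    IsSchwarzOne P a F ↔
      SolvOne P a ∧ ∃ β₀ : ℝ, ∀ ζ ∈ P.punctured, F ζ = formulaOne P a β₀ ζ := by
  rw [isSchwarzOne_iff hP, densOne_eq_bankDens P a (g1 P a),
    bounded_schwarz_iff hP.k_pos hP.k_lt_one hP.zInf_mem (isTipRegular_g1 hP a),
    moment_eq_zero_iff_solvOne hP]
  refine and_congr_right fun _ => exists_congr fun β₀ => ?_
  simp only [particularSol_zero, formulaOne_eq]
  rw [regularPart_eq_iff hP (G := fun ζ => β₀ + evenPart P.k P.zInf a (fun _ => -P.c.im) ζ)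
    (continuousOn_const.add
      (differentiableOn_evenPart _ _ hP.k_pos hP.k_lt_one hP.zInf_mem).continuousOn)]
  refine forall₂_congr fun ζ _ => ?_
  rw [← add_assoc, add_comm (P.c / _)]

theorem tendsto_formulaOne_bank (hP : P.Admissible) (a : Fin 2 → ℝ) (β₀ : ℝ) {j : Fin 2} {ξ : ℝ}
    (hξ : ξ ∈ slit P.k j) (s : Bank) :
    Tendsto (fun ζ => formulaOne P a β₀ ζ - P.c / (ζ - P.zInf)) (bankFilter s ξ)
      (𝓝 (((β₀ + s.sgn * sg j * g1 P a ξ : ℝ) : ℂ) + (densOne P a j ξ : ℂ) * I)) := by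
  have h := (tendsto_evenPart_bank a (fun _ => -P.c.im) hP.k_pos hP.k_lt_one hP.zInf_mem hξ
    s).const_add (β₀ : ℂ)
  rw [← g1_eq hP a hξ, ← densOne_eq, ← add_assoc, ← ofReal_add] at h
  refine h.congr fun ζ => ?_
  rw [formulaOne_eq]
  ring

/-! ### The second problem -/

theorem tendsto_re_formulaOne (hP : P.Admissible) {a : Fin 2 → ℝ} {β₀ : ℝ} {F : ℂ → ℂ}
    (hF : ∀ ζ ∈ P.punctured, F ζ = formulaOne P a β₀ ζ) {j : Fin 2} {ξ : ℝ}
    (hξ : ξ ∈ slit P.k j) (s : Bank) :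
    Tendsto (fun ζ => (F ζ).re) (bankFilter s ξ)
      (𝓝 (β₀ + s.sgn * sg j * g1 P a ξ + (P.c / ((ξ : ℂ) - P.zInf)).re)) := by
  have h := (continuous_re.tendsto _).comp
    ((tendsto_formulaOne_bank hP a β₀ hξ s).add (tendsto_pole_bank hP P.c hξ s))
  have e : (((β₀ + s.sgn * sg j * g1 P a ξ : ℝ) : ℂ) + (densOne P a j ξ : ℂ) * I +
      P.c / ((ξ : ℂ) - P.zInf)).re =
      β₀ + s.sgn * sg j * g1 P a ξ + (P.c / ((ξ : ℂ) - P.zInf)).re := by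
    rw [add_re, add_re, ofReal_re, re_ofReal_mul, I_re, mul_zero, add_zero]
  rw [e] at h
  refine h.congr' ?_
  filter_upwards [eventually_bank_mem_punctured hP hξ s] with ζ hζ
  simp only [Function.comp_apply]
  rw [hF ζ hζ, sub_add_cancel]

/-- The compatibility of the principal parts of `F` and `ω` with the density `g₀`. -/
theorem lam_mul_g0 (hP : P.Admissible) (j : Fin 2) (ξ : ℝ) :
    P.lam j * g0 P j ξ = P.lam j * (P.c / ((ξ : ℂ) - P.zInf)).re -
      (conj P.tau * (P.cm1 / ((ξ : ℂ) - P.zInf))).re := by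
  have h := hP.lam_div_sub j
  have h1 : (P.lam j / P.muIncl j : ℂ) - P.lam j / P.mu = 1 := by exact_mod_cast h
  rw [g0, ← re_ofReal_mul, ← re_ofReal_mul, ← sub_re]
  congr 1
  rw [Params.c]
  simp only [div_eq_mul_inv] at h1 ⊢
  linear_combination (-(conj P.tau * (P.cm1 * ((ξ : ℂ) - P.zInf)⁻¹))) * h1

theorem isSchwarzTwo_iff (hP : P.Admissible) {a : Fin 2 → ℝ} {β₀ : ℝ} {F : ℂ → ℂ}
    (hF : ∀ ζ ∈ P.punctured, F ζ = formulaOne P a β₀ ζ) (d : Fin 2 → ℝ) (ω : ℂ → ℂ) :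
    IsSchwarzTwo P F d ω ↔
      IsSchwarz P.k (densTwo P a (fun j => β₀ - d j))
        (fun ζ => I * conj P.tau * regularPart P P.cm1 ω ζ) ∧
      (fun ζ => I * conj P.tau * regularPart P P.cm1 ω ζ) =O[cocompact ℂ] (fun _ => (1 : ℝ)) := by
  have hIm : ∀ w : ℂ, (I * conj P.tau * w).im = (conj P.tau * w).re := fun w => by
    rw [mul_assoc, mul_comm, mul_I_im]
  have hb : (∀ j, ∀ ξ ∈ slit P.k j, ∀ s, Tendsto (fun ζ => (conj P.tau * ω ζ).re -
      P.lam j * ((F ζ).re - d j)) (bankFilter s ξ) (𝓝 0)) ↔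
      ∀ j, ∀ ξ ∈ slit P.k j, ∀ s : Bank,
        Tendsto (fun ζ => (I * conj P.tau * regularPart P P.cm1 ω ζ).im)
        (bankFilter s ξ) (𝓝 (densTwo P a (fun j => β₀ - d j) j s ξ)) := by
    refine forall_congr' fun j => forall₂_congr fun ξ hξ => forall_congr' fun s => ?_
    have hF' := ((tendsto_re_formulaOne hP hF hξ s).sub_const (d j)).const_mul (P.lam j)
    have e : densTwo P a (fun j => β₀ - d j) j s ξ +
        (I * conj P.tau * (P.cm1 / ((ξ : ℂ) - P.zInf))).im =
        P.lam j * (β₀ + s.sgn * sg j * g1 P a ξ + (P.c / ((ξ : ℂ) - P.zInf)).re - d j) := by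
      rw [hIm, densTwo]
      linear_combination lam_mul_g0 hP j ξ
    rw [tendsto_im_regularPart_iff hP ω hξ s, e]
    simp only [hIm]
    constructor
    · intro h
      simpa using h.add hF'
    · intro h
      simpa using h.sub hF'
  rw [IsSchwarzTwo, isSlitFunction_iff hP hP.I_mul_tau_ne, hb]
  exact ⟨fun h => ⟨⟨h.1.1, h.1.2.1, h.2⟩, h.1.2.2⟩, fun h => ⟨⟨h.1.1, h.1.2, h.2⟩, h.1.3⟩⟩

/-- The particular solution of the second problem. -/
def solTwo (P : Params) (a ρ' : Fin 2 → ℝ) : ℂ → ℂ :=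
  particularSol P.k P.zInf (fun j => P.lam j * ρ' j) (fun j => P.lam j * P.resG j) P.lam (g1 P a)

theorem isSchwarz_solTwo (hP : P.Admissible) (a ρ' : Fin 2 → ℝ) :
    IsSchwarz P.k (densTwo P a ρ') (solTwo P a ρ') := by
  rw [densTwo_eq_bankDens]
  exact isSchwarz_particularSol hP.k_pos hP.k_lt_one hP.zInf_mem (isTipRegular_g1 hP a)

theorem formulaTwo_eq_sum (hP : P.Admissible) (a ρ' : Fin 2 → ℝ) (γ' : ℂ) {ζ : ℂ}
    (hζ : ζ ∈ slitDomain P.k) :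
    formulaTwo P a ρ' γ' ζ = γ' + P.cm1 / (ζ - P.zInf) - I / (Real.pi * conj P.tau) *
      ∑ j, (sg j * P.lam j : ℂ) * (cauchyInt (g1 P a) (slit P.k j) ζ +
        I * branch P.k ζ * ratInt P.k P.zInf (ρ' j) (P.resG j) j ζ) := by
  have h : ∀ j, (∫ η in slit P.k j, ((g1 P a η : ℂ) + I * branch P.k ζ / absq P.k η *
      ((g0 P j η : ℂ) + ρ' j)) / ((η : ℂ) - ζ)) = cauchyInt (g1 P a) (slit P.k j) ζ +
        I * branch P.k ζ * ratInt P.k P.zInf (ρ' j) (P.resG j) j ζ := by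
    intro j
    have c1 := integrableOn_cauchy (isCompact_slit P.k j) ((isTipRegular_g1 hP a).integrableOn j)
      (mem_slitDomain.1 hζ j)
    have c2 := integrableOn_cauchy (isCompact_slit P.k j) (integrableOn_ratDens_div hP.k_pos
      hP.k_lt_one hP.zInf_mem (ρ' j) (P.resG j) j) (mem_slitDomain.1 hζ j)
    unfold ratInt cauchyInt
    rw [← integral_const_mul, ← integral_add c1 (c2.const_mul _)]
    congr 1
    funext η
    rw [g0_eq]
    simp only [ratDens]
    push_cast
    ring
  unfold formulaTwo
  simp only [h]

theorem formulaTwo_eq (hP : P.Admissible) (a ρ' : Fin 2 → ℝ) (γ' : ℂ) {ζ : ℂ}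
    (hζ : ζ ∈ slitDomain P.k) :
    formulaTwo P a ρ' γ' ζ =
      P.cm1 / (ζ - P.zInf) + (γ' + (I * conj P.tau)⁻¹ * solTwo P a ρ' ζ) := by
  have ht := hP.conj_tau_ne
  have hpi : (Real.pi : ℂ) ≠ 0 := ofReal_ne_zero.2 Real.pi_ne_zero
  rw [formulaTwo_eq_sum hP a ρ' γ' hζ]
  simp only [solTwo, particularSol, evenPart, oddPart, ratInt_mul, Fin.sum_univ_two]
  rw [mul_inv, inv_I]
  push_cast
  field_simp
  ring

theorem continuousOn_solTwo (hP : P.Admissible) (a ρ' : Fin 2 → ℝ) :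
    ContinuousOn (solTwo P a ρ') (slitDomain P.k) :=
  (isSchwarz_solTwo hP a ρ').differentiableOn.continuousOn

theorem regularPart_formulaTwo_iff (hP : P.Admissible) {a ρ' : Fin 2 → ℝ} {γ' : ℂ} {ω : ℂ → ℂ} :
    (∀ ζ ∈ P.punctured, ω ζ = formulaTwo P a ρ' γ' ζ) ↔
      ∀ ζ ∈ slitDomain P.k, I * conj P.tau * regularPart P P.cm1 ω ζ =
        I * conj P.tau * γ' + solTwo P a ρ' ζ := by
  have he := hP.I_mul_tau_ne
  have h1 : (∀ ζ ∈ P.punctured, ω ζ = formulaTwo P a ρ' γ' ζ) ↔ ∀ ζ ∈ P.punctured, ω ζ =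
      P.cm1 / (ζ - P.zInf) + (γ' + (I * conj P.tau)⁻¹ * solTwo P a ρ' ζ) :=
    forall₂_congr fun ζ hζ => by rw [formulaTwo_eq hP a ρ' γ' hζ.1]
  rw [h1, ← regularPart_eq_iff hP (G := fun ζ => γ' + (I * conj P.tau)⁻¹ * solTwo P a ρ' ζ)
    (continuousOn_const.add (continuousOn_const.mul (continuousOn_solTwo hP a ρ')))]
  refine forall₂_congr fun ζ _ => ?_
  rw [← mul_right_inj' he, mul_add, mul_inv_cancel_left₀ he]

theorem isSchwarzTwo_iff_formula (hP : P.Admissible) {a : Fin 2 → ℝ} {β₀ : ℝ} {F : ℂ → ℂ}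
    (hF : ∀ ζ ∈ P.punctured, F ζ = formulaOne P a β₀ ζ) (d : Fin 2 → ℝ) (ω : ℂ → ℂ) :
    IsSchwarzTwo P F d ω ↔ SolvTwo P (fun j => β₀ - d j) ∧ ∃ γ₀ : ℝ, ∀ ζ ∈ P.punctured,
      ω ζ = formulaTwo P a (fun j => β₀ - d j) (-I * γ₀ / conj P.tau) ζ := by
  rw [isSchwarzTwo_iff hP hF, densTwo_eq_bankDens, bounded_schwarz_iff hP.k_pos hP.k_lt_one
    hP.zInf_mem (isTipRegular_g1 hP a), moment_eq_zero_iff_solvTwo hP]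
  refine and_congr_right fun _ => exists_congr fun γ₀ => ?_
  rw [regularPart_formulaTwo_iff hP]
  have e : I * conj P.tau * (-I * γ₀ / conj P.tau) = γ₀ := by
    have ht := hP.conj_tau_ne
    field_simp
    linear_combination (-(γ₀ : ℂ)) * I_sq
  rw [e]
  rfl

/-- An arbitrary constant `γ'` changes `Re[τ̄ω]` on both slits by `Re[τ̄γ']`, which the real
constants `d_j` absorb. -/
theorem isSchwarzTwo_of_formulaTwo (hP : P.Admissible) {a : Fin 2 → ℝ} {β₀ : ℝ} {F : ℂ → ℂ}
    (hF : ∀ ζ ∈ P.punctured, F ζ = formulaOne P a β₀ ζ) (d : Fin 2 → ℝ)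
    (hS : SolvTwo P (fun j => β₀ - d j)) (γ' : ℂ) {ω : ℂ → ℂ}
    (hω : ∀ ζ ∈ P.punctured, ω ζ = formulaTwo P a (fun j => β₀ - d j) γ' ζ) :
    IsSchwarzTwo P F (fun j => d j - (conj P.tau * γ').re / P.lam j) ω := by
  have he := (regularPart_formulaTwo_iff hP).1 hω
  rw [isSchwarzTwo_iff hP hF]
  constructor
  · have h := ((isSchwarz_affine hP.k_lt_one (I * conj P.tau * γ') 0).add
      (isSchwarz_solTwo hP a fun j => β₀ - d j)).congr hP.k_lt_one
      (g := fun ζ => I * conj P.tau * regularPart P P.cm1 ω ζ) fun ζ hζ => by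
        simp only
        rw [he ζ hζ, zero_mul, add_zero]
    convert h using 1
    funext j s ξ
    have hl := hP.lam_ne_zero j
    have hIm : (I * conj P.tau * γ').im = (conj P.tau * γ').re := by
      rw [mul_assoc, mul_comm, mul_I_im]
    rw [hIm, zero_im, zero_mul, add_zero, densTwo, densTwo]
    field_simp
    ring
  · refine ((isBigO_const_const (I * conj P.tau * γ') (one_ne_zero (α := ℝ)) _).add
      (isBigO_one_particularSol hP.k_pos hP.k_lt_one hP.zInf_mem (lam := P.lam)
        (isTipRegular_g1 hP a).integrableOn
        ((moment_eq_zero_iff_solvTwo hP _).2 hS))).congr' ?_ EventuallyEq.rfl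
    filter_upwards [eventually_mem_slitDomain hP.k_pos] with ζ hζ
    exact (he ζ hζ).symm

theorem isSlitFunction_of_formulaTwo (hP : P.Admissible) {a ρ' : Fin 2 → ℝ} (hS : SolvTwo P ρ')
    (γ' : ℂ) {ω : ℂ → ℂ} (hω : ∀ ζ ∈ P.punctured, ω ζ = formulaTwo P a ρ' γ' ζ) :
    IsSlitFunction P P.cm1 ω := by
  have e : (fun j => 0 - -ρ' j) = ρ' := by simp
  exact (isSchwarzTwo_of_formulaTwo hP (F := formulaOne P a 0) (fun _ _ => rfl) (fun j => -ρ' j)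
    (by rwa [e]) γ' (by rwa [e])).1

end

section

variable {k : ℝ}

/-! ### Contours of boundary values -/

theorem mem_closure_bank (s : Bank) (ξ : ℝ) : (ξ : ℂ) ∈ closure {ζ : ℂ | 0 < s.sgn * ζ.im} :=
  mem_closure_iff_nhdsWithin_neBot.2 (bankFilter_neBot s ξ)

/-- The boundary value of `f` at `ξ ± i0`. -/
def bankValue (f : ℂ → ℂ) (s : Bank) (ξ : ℝ) : ℂ := extendFrom {ζ : ℂ | 0 < s.sgn * ζ.im} f (ξ : ℂ)

theorem bankValue_eq {f : ℂ → ℂ} {s : Bank} {ξ : ℝ} {w : ℂ} (h : Tendsto f (bankFilter s ξ) (𝓝 w)) :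
    bankValue f s ξ = w := extendFrom_eq (mem_closure_bank s ξ) h

theorem ContinuousUpToSlits.continuousOn_bankValue {f : ℂ → ℂ} (hf : ContinuousUpToSlits k f)
    (j : Fin 2) (s : Bank) : ContinuousOn (bankValue f s) (slit k j) := by
  have h : ContinuousOn (extendFrom {ζ : ℂ | 0 < s.sgn * ζ.im} f)
      ((fun x : ℝ => (x : ℂ)) '' slit k j) := by
    refine continuousOn_extendFrom ?_ ?_
    · rintro _ ⟨ξ, -, rfl⟩
      exact mem_closure_bank s ξ
    · rintro _ ⟨ξ, hξ, rfl⟩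
      exact hf.1 j ξ hξ s
  exact h.comp continuous_ofReal.continuousOn (mapsTo_image _ _)

theorem profile_eq_iUnion {P : Params} {f : ℂ → ℂ} (hf : ContinuousUpToSlits P.k f) (m : Fin 2) :
    profile P f m = bankValue f Bank.upper '' slit P.k m ∪ bankValue f Bank.lower '' slit P.k m := by
  have h : ∀ ξ ∈ slit P.k m, ∀ s, Tendsto f (bankFilter s ξ) (𝓝 (bankValue f s ξ)) := by
    intro ξ hξ s
    obtain ⟨w, hw⟩ := hf.1 m ξ hξ s
    rwa [bankValue_eq hw]
  ext z
  constructor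
  · rintro ⟨ξ, hξ, s, hs⟩
    rcases s with _ | _
    · exact Or.inl ⟨ξ, hξ, bankValue_eq hs⟩
    · exact Or.inr ⟨ξ, hξ, bankValue_eq hs⟩
  · rintro (⟨ξ, hξ, rfl⟩ | ⟨ξ, hξ, rfl⟩)
    · exact ⟨ξ, hξ, _, h ξ hξ _⟩
    · exact ⟨ξ, hξ, _, h ξ hξ _⟩

/-- The contour is the closure of the boundary values at the interior points of the slit, by
continuity of the boundary values along each bank. -/
theorem profile_eq_closure {P : Params} (hk1 : P.k < 1) {f : ℂ → ℂ}
    (hf : ContinuousUpToSlits P.k f) (m : Fin 2) :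
    profile P f m = closure {z | ∃ s, ∃ ξ ∈ openSlit P.k m, z = bankValue f s ξ} := by
  have h1 : {z | ∃ s, ∃ ξ ∈ openSlit P.k m, z = bankValue f s ξ} =
      bankValue f Bank.upper '' openSlit P.k m ∪ bankValue f Bank.lower '' openSlit P.k m := by
    ext z
    constructor
    · rintro ⟨_ | _, ξ, hξ, rfl⟩
      · exact Or.inl ⟨ξ, hξ, rfl⟩
      · exact Or.inr ⟨ξ, hξ, rfl⟩
    · rintro (⟨ξ, hξ, rfl⟩ | ⟨ξ, hξ, rfl⟩)
      · exact ⟨_, ξ, hξ, rfl⟩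
      · exact ⟨_, ξ, hξ, rfl⟩
  have h2 : ∀ s, closure (bankValue f s '' openSlit P.k m) = bankValue f s '' slit P.k m := by
    intro s
    rw [← image_closure_of_isCompact, closure_openSlit hk1]
    · rw [closure_openSlit hk1]; exact isCompact_slit P.k m
    · rw [closure_openSlit hk1]; exact hf.continuousOn_bankValue m s
  rw [h1, closure_union, h2, h2, profile_eq_iUnion hf]

/-! ### Images of univalent functions -/

/-- Openness of an injective analytic function at a point. -/
theorem nhds_le_map_of_injOn {f : ℂ → ℂ} {D : Set ℂ} (hD : IsOpen D) (hf : DifferentiableOn ℂ f D)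
    (hi : InjOn f D) {ζ : ℂ} (hζ : ζ ∈ D) : 𝓝 (f ζ) ≤ map f (𝓝 ζ) := by
  have ha := hf.analyticAt (hD.mem_nhds hζ)
  refine ha.eventually_constant_or_nhds_le_map_nhds.resolve_left fun h => ?_
  have h1 : ∀ᶠ ζ' in 𝓝[≠] ζ, False := by
    filter_upwards [h.filter_mono nhdsWithin_le_nhds,
      mem_nhdsWithin_of_mem_nhds (hD.mem_nhds hζ), self_mem_nhdsWithin] with ζ' e1 e2 e3
    exact e3 (hi e2 hζ e1)
  exact h1.exists.choose_spec

/-- Openness at infinity of a function that does not assume its value at infinity. -/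
theorem insert_image_mem_nhds {f : ℂ → ℂ} {D : Set ℂ} {w : ℂ} (hD : IsOpen D)
    (hDc : D ∈ cocompact ℂ) (hf : DifferentiableOn ℂ f D) (hw : Tendsto f (cocompact ℂ) (𝓝 w))
    (hwD : w ∉ f '' D) {V : Set ℂ} (hV : V ∈ cocompact ℂ) : insert w (f '' V) ∈ 𝓝 w := by
  set g : ℂ → ℂ := Function.update (fun t => f t⁻¹) 0 w with hg
  have g0 : g 0 = w := Function.update_self _ _ _
  have gne : ∀ t ≠ 0, g t = f t⁻¹ := fun t ht => Function.update_of_ne ht _ _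
  have hc : ContinuousAt g 0 := continuousAt_update_same.2 (hw.comp tendsto_inv_punctured)
  have hd : ∀ᶠ t in 𝓝[≠] (0 : ℂ), DifferentiableAt ℂ g t := by
    filter_upwards [tendsto_inv_punctured.eventually hDc, self_mem_nhdsWithin] with t h1 h2
    have : DifferentiableAt ℂ (fun t => f t⁻¹) t :=
      DifferentiableAt.comp t (hf.differentiableAt (hD.mem_nhds h1)) (differentiableAt_inv h2)
    refine this.congr_of_eventuallyEq ?_
    filter_upwards [isOpen_ne.mem_nhds h2] with t' ht' using gne t' ht'
  have ha := analyticAt_of_differentiable_on_punctured_nhds_of_continuousAt hd hc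
  have hle : 𝓝 (g 0) ≤ map g (𝓝 0) := by
    refine ha.eventually_constant_or_nhds_le_map_nhds.resolve_left fun h => ?_
    have h1 : ∀ᶠ t in 𝓝[≠] (0 : ℂ), False := by
      filter_upwards [h.filter_mono nhdsWithin_le_nhds, tendsto_inv_punctured.eventually hDc,
        self_mem_nhdsWithin] with t e1 e2 e3
      exact hwD ⟨t⁻¹, e2, by rw [← gne t e3, e1, g0]⟩
    exact h1.exists.choose_spec
  rw [g0] at hle
  refine hle (mem_map.2 ?_)
  have h2 : ∀ᶠ t in 𝓝[≠] (0 : ℂ), t⁻¹ ∈ V := tendsto_inv_punctured.eventually hV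
  filter_upwards [eventually_nhdsWithin_iff.1 h2] with t ht
  by_cases h0 : t = 0
  · left; rw [h0, g0]
  · right; exact ⟨t⁻¹, ht h0, (gne t h0).symm⟩

theorem isOpen_insert_image {f : ℂ → ℂ} {D : Set ℂ} {w : ℂ} (hD : IsOpen D)
    (hDc : D ∈ cocompact ℂ) (hf : DifferentiableOn ℂ f D) (hi : InjOn f D)
    (hw : Tendsto f (cocompact ℂ) (𝓝 w)) (hwD : w ∉ f '' D) : IsOpen (insert w (f '' D)) := by
  rw [isOpen_iff_mem_nhds]
  rintro _ (rfl | ⟨ζ, hζ, rfl⟩)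
  · exact insert_image_mem_nhds hD hDc hf hw hwD hDc
  · refine mem_of_superset (nhds_le_map_of_injOn hD hf hi hζ (mem_map.2 ?_)) (subset_insert _ _)
    exact mem_of_superset (hD.mem_nhds hζ) (subset_preimage_image f D)

/-- A limit of a univalent function along a filter in `D` which escapes from every point of `D` and
from infinity is not a value of the function. -/
theorem notMem_insert_image_of_tendsto {f : ℂ → ℂ} {D : Set ℂ} {w x y : ℂ} {l : Filter ℂ} [l.NeBot]
    (hD : IsOpen D) (hDc : D ∈ cocompact ℂ) (hf : DifferentiableOn ℂ f D) (hi : InjOn f D)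
    (hw : Tendsto f (cocompact ℂ) (𝓝 w)) (hwD : w ∉ f '' D) (hlD : D ∈ l) (hl : l ≤ 𝓝 x)
    (hx : x ∉ D) (hy : Tendsto f l (𝓝 y)) : y ∉ insert w (f '' D) := by
  have key : ∀ V W : Set ℂ, V ⊆ D → W ∈ 𝓝 x → Disjoint V W → insert w (f '' V) ∈ 𝓝 y → False := by
    intro V W hVD hW hVW hV
    obtain ⟨ζ, h1, h2, h3⟩ := ((hy.eventually hV).and (inter_mem hlD (hl hW))).exists
    rcases h1 with h1 | ⟨ζ', h4, h5⟩
    · exact hwD ⟨ζ, h2, h1⟩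
    · exact disjoint_left.1 hVW h4 (hi (hVD h4) h2 h5 ▸ h3)
  rintro (rfl | ⟨ζ, hζ, rfl⟩)
  · obtain ⟨K, hK, hKx⟩ := exists_compact_mem_nhds x
    refine key (D ∩ Kᶜ) K inter_subset_left hKx ?_
      (insert_image_mem_nhds hD hDc hf hw hwD (inter_mem hDc hK.compl_mem_cocompact))
    exact disjoint_left.2 fun _ h => h.2
  · obtain ⟨U, W, hU, hW, hζU, hxW, hUW⟩ := t2_separation (fun h : ζ = x => hx (h ▸ hζ))
    refine key (D ∩ U) W inter_subset_left (hW.mem_nhds hxW) (hUW.mono_left inter_subset_right) ?_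
    refine mem_of_superset (nhds_le_map_of_injOn hD hf hi hζ (mem_map.2 ?_)) (subset_insert _ _)
    exact mem_of_superset (inter_mem (hD.mem_nhds hζ) (hU.mem_nhds hζU)) (subset_preimage_image f _)

theorem ContinuousUpToSlits.exists_bank_of_ultrafilter {f : ℂ → ℂ} (hf : ContinuousUpToSlits k f)
    {j : Fin 2} {ξ : ℝ} (hξ : ξ ∈ slit k j) {u : Ultrafilter ℂ} (hu : ↑u ≤ 𝓝[slitDomain k] (ξ : ℂ))
    {y : ℂ} (hy : Tendsto f u (𝓝 y)) : ∃ s, Tendsto f (bankFilter s ξ) (𝓝 y) := by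
  rcases mem_openSlit_or_tip hξ with h | h
  · have hs : ∃ s, ↑u ≤ bankFilter s ξ := by
      rw [nhdsWithin_slitDomain_of_interior h, Ultrafilter.le_sup_iff] at hu
      exact hu.elim (fun h => ⟨_, h⟩) (fun h => ⟨_, h⟩)
    obtain ⟨s, hs⟩ := hs
    obtain ⟨w, hw⟩ := hf.1 j ξ hξ s
    exact ⟨s, tendsto_nhds_unique (hw.mono_left hs) hy ▸ hw⟩
  · obtain ⟨w, hw⟩ := hf.2 ξ h
    refine ⟨Bank.upper, ?_⟩
    rw [← tendsto_nhds_unique (hw.mono_left hu) hy]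
    exact hw.mono_left (bankFilter_le_slitDomain _ ξ)

theorem Params.isOpen_punctured (P : Params) : IsOpen P.punctured :=
  (isOpen_slitDomain P.k).sdiff isClosed_singleton

theorem ultrafilter_le_cocompact_or (u : Ultrafilter ℂ) :
    ↑u ≤ cocompact ℂ ∨ ∃ x : ℂ, ↑u ≤ 𝓝 x := by
  by_cases h : ↑u ≤ cocompact ℂ
  · exact Or.inl h
  · right
    rw [← Ultrafilter.disjoint_iff_not_le, disjoint_cocompact_right] at h
    obtain ⟨K, hK, hKc⟩ := h
    obtain ⟨x, -, hx⟩ := isCompact_iff_ultrafilter_le_nhds.1 hKc u (le_principal_iff.2 hK)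
    exact ⟨x, hx⟩

/-- The boundary of the image domain of a univalent slit function consists of the two contours. -/
theorem frontier_insert_image {P : Params} (hP : P.Admissible) {r : ℂ} (hr : r ≠ 0) {ω : ℂ → ℂ}
    (hω : IsSlitFunction P r ω) {w : ℂ} (hu : IsUnivalent P ω w) :
    frontier (insert w (ω '' P.punctured)) = profile P ω 0 ∪ profile P ω 1 := by
  obtain ⟨hw, hi, hwD⟩ := hu
  have hD := P.isOpen_punctured
  have hDc : P.punctured ∈ cocompact ℂ := eventually_mem_punctured hP
  have hprof : ∀ y, y ∈ profile P ω 0 ∪ profile P ω 1 ↔ ∃ j, y ∈ profile P ω j := fun y => by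
    rw [Fin.exists_fin_two]; rfl
  rw [(isOpen_insert_image hD hDc hω.analytic hi hw hwD).frontier_eq]
  ext y
  rw [hprof]
  constructor
  · rintro ⟨hy, hyn⟩
    rw [insert_eq, closure_union, closure_singleton] at hy
    rcases hy with rfl | hy
    · exact absurd (mem_insert _ _) hyn
    rw [mem_closure_iff_clusterPt] at hy
    -- an ultrafilter in the domain along which `ω` tends to `y`; it converges in the sphere, and
    -- only a point of a slit is possible
    have hne : (comap ω (𝓝 y) ⊓ 𝓟 P.punctured).NeBot := by
      have := hy
      rw [ClusterPt, ← map_principal, ← Filter.push_pull', map_neBot_iff] at this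
      exact this
    obtain ⟨u, hu⟩ := @Ultrafilter.exists_le _ _ hne
    have huD : P.punctured ∈ u := le_principal_iff.1 (hu.trans inf_le_right)
    have huy : Tendsto ω u (𝓝 y) := tendsto_iff_comap.2 (hu.trans inf_le_left)
    rcases ultrafilter_le_cocompact_or u with h | ⟨x, hx⟩
    · exact absurd (Or.inl (tendsto_nhds_unique huy (hw.mono_left h))) hyn
    by_cases hxs : x ∈ slitDomain P.k
    · exfalso
      by_cases hxz : x = P.zInf
      · -- at the pole `ω` is unbounded: otherwise `r = (ω - regular part)(ζ - ζ_∞)` would tend to 0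
        obtain ⟨v, hv⟩ := hω.pole
        have h1 : ↑u ≤ 𝓝[≠] (P.zInf : ℂ) :=
          le_inf (hxz ▸ hx) (le_principal_iff.2 (mem_of_superset huD fun ζ h => h.2))
        have h2 : Tendsto (fun ζ : ℂ => ζ - P.zInf) u (𝓝 0) := by
          have : Tendsto (fun ζ : ℂ => ζ - P.zInf) (𝓝 (P.zInf : ℂ)) (𝓝 (P.zInf - P.zInf)) :=
            (continuous_id.sub continuous_const).tendsto _
          rw [sub_self] at this
          exact this.mono_left (hxz ▸ hx)
        have h3 := (huy.sub (hv.mono_left h1)).mul h2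
        rw [mul_zero] at h3
        refine hr (tendsto_nhds_unique (tendsto_const_nhds.congr' ?_) h3)
        filter_upwards [huD] with ζ hζ
        have : ζ - P.zInf ≠ 0 := sub_ne_zero.2 hζ.2
        field_simp
        ring
      · have hxD : x ∈ P.punctured := ⟨hxs, hxz⟩
        have := tendsto_nhds_unique huy
          (((hω.analytic.differentiableAt (hD.mem_nhds hxD)).continuousAt.tendsto).mono_left hx)
        exact hyn (Or.inr ⟨x, hxD, this.symm⟩)
    · rw [mem_slitDomain] at hxs
      push Not at hxs
      obtain ⟨j, ξ, hξ, rfl⟩ := hxs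
      obtain ⟨s, hs⟩ := hω.boundary.exists_bank_of_ultrafilter hξ
        (le_inf hx (le_principal_iff.2 (mem_of_superset huD fun ζ h => h.1))) huy
      exact ⟨j, ξ, hξ, s, hs⟩
  · rintro ⟨j, ξ, hξ, s, hs⟩
    have hlD : P.punctured ∈ bankFilter s ξ := eventually_bank_mem_punctured hP hξ s
    refine ⟨?_, ?_⟩
    · refine mem_closure_of_tendsto hs ?_
      filter_upwards [hlD] with ζ hζ using Or.inr ⟨ζ, hζ, rfl⟩
    · exact notMem_insert_image_of_tendsto hD hDc hω.analytic hi hw hwD hlD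
        (bankFilter_le_nhds s ξ) (fun h => mem_slitDomain.1 h.1 j ξ hξ rfl) hs

/-! ### The profiles -/

variable {P : Params}

theorem profileDensity_eq (P : Params) (a ρ' : Fin 2 → ℝ) (m : Fin 2) (s : Bank) (ξ : ℝ)
    (j : Fin 2) :
    profileDensity P a ρ' m s ξ j = fun η => g1 P a η + s.sgn * sg m * absq P.k ξ *
      (ratDens P.zInf (ρ' j) (P.resG j) η / absq P.k η) := by
  funext η
  rw [profileDensity, g0_eq]
  simp only [ratDens]
  ring

theorem plemelj_profileDensity (hP : P.Admissible) (a ρ' : Fin 2 → ℝ) {m : Fin 2} (s : Bank)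
    {ξ : ℝ} (hξ : ξ ∈ openSlit P.k m) (j : Fin 2) :
    HasPV (profileDensity P a ρ' m s ξ j) (slit P.k j) ξ
      (pv (profileDensity P a ρ' m s ξ j) (slit P.k j) ξ) ∧ ∀ s' : Bank,
      Tendsto (fun ε : ℝ => cauchyInt (profileDensity P a ρ' m s ξ j) (slit P.k j)
        (ξ + s'.sgn * ε * I)) (𝓝[>] 0)
        (𝓝 (pv (profileDensity P a ρ' m s ξ j) (slit P.k j) ξ + if j = m then
          s'.sgn * (Real.pi * profileDensity P a ρ' m s ξ j ξ : ℝ) * I else 0)) := by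
  refine plemelj_slit hP.k_pos ?_ hξ fun _ => ?_
  · rw [profileDensity_eq]
    exact ((isTipRegular_g1 hP a).integrableOn j).add ((integrableOn_ratDens_div hP.k_pos
      hP.k_lt_one hP.zInf_mem (ρ' j) (P.resG j) j).const_mul _)
  · rw [profileDensity_eq]
    exact ((isTipRegular_g1 hP a).differentiableAt hP.k_pos hξ).add
      ((differentiableAt_ratDens_div hP.k_pos hP.zInf_mem hξ _ _).const_mul _)

/-- The boundary values of the map, computed along the normal direction: the kernel `iq(ζ)` may be
replaced by its boundary value in front of the second Cauchy integral. -/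
theorem tendsto_formulaTwo_vertical (hP : P.Admissible) (a ρ' : Fin 2 → ℝ) (γ' : ℂ) {m : Fin 2}
    (s : Bank) {ξ : ℝ} (hξ : ξ ∈ openSlit P.k m) :
    Tendsto (fun ε : ℝ => formulaTwo P a ρ' γ' (ξ + s.sgn * ε * I)) (𝓝[>] 0)
      (𝓝 (profileFormula P a ρ' γ' m s ξ)) := by
  have hs := openSlit_subset P.k m hξ
  have hv := tendsto_vertical s ξ
  have hq : Tendsto (fun ε : ℝ => I * branch P.k (ξ + s.sgn * ε * I) -
      ((s.sgn * sg m * absq P.k ξ : ℝ) : ℂ)) (𝓝[>] 0) (𝓝 0) := by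
    have h := (((tendsto_branch_bank hP.k_pos hs s).comp hv).const_mul I).sub_const
      ((s.sgn * sg m * absq P.k ξ : ℝ) : ℂ)
    refine h.trans_eq (congrArg 𝓝 ?_)
    rw [bankV]
    push_cast
    linear_combination (-(sg m * s.sgn * absq P.k ξ : ℂ)) * I_sq
  have hj : ∀ j, Tendsto (fun ε : ℝ => (sg j * P.lam j : ℂ) *
      (cauchyInt (profileDensity P a ρ' m s ξ j) (slit P.k j) (ξ + s.sgn * ε * I) +
        (I * branch P.k (ξ + s.sgn * ε * I) - ((s.sgn * sg m * absq P.k ξ : ℝ) : ℂ)) *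
        ratInt P.k P.zInf (ρ' j) (P.resG j) j (ξ + s.sgn * ε * I))) (𝓝[>] 0)
      (𝓝 ((sg j * P.lam j : ℂ) * ((pv (profileDensity P a ρ' m s ξ j) (slit P.k j) ξ +
        if j = m then s.sgn * (Real.pi * profileDensity P a ρ' m s ξ j ξ : ℝ) * I else 0)))) := by
    intro j
    have h1 := (plemelj_profileDensity hP a ρ' s hξ j).2 s
    have h2 := hq.mul ((plemelj_ratDens hP.k_pos hP.k_lt_one hP.zInf_mem hξ (ρ' j) (P.resG j)
      j).2 s)
    rw [zero_mul] at h2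
    simpa using (h1.add h2).const_mul (sg j * P.lam j : ℂ)
  have hsum := ((((tendsto_pole_bank hP P.cm1 hs s).comp hv).const_add γ').sub
    ((tendsto_finsetSum Finset.univ fun j _ => hj j).const_mul (I / (Real.pi * conj P.tau))))
  refine (hsum.congr' ?_).trans_eq (congrArg 𝓝 ?_)
  · filter_upwards [hv.eventually (eventually_bank_mem_slitDomain (k := P.k) s ξ)] with ε hε
    simp only [Function.comp_apply]
    rw [formulaTwo_eq_sum hP a ρ' γ' hε]
    congr 2
    refine Finset.sum_congr rfl fun j _ => ?_
    have hne := mem_slitDomain.1 hε j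
    have i2 := integrableOn_ratDens_div hP.k_pos hP.k_lt_one hP.zInf_mem (ρ' j) (P.resG j) j
    rw [profileDensity_eq, cauchyInt_add (isCompact_slit P.k j)
      ((isTipRegular_g1 hP a).integrableOn j) (i2.const_mul _) hne, cauchyInt_const_mul, ratInt]
    ring
  · have hlam : ∀ j, (P.lam j : ℂ) = P.mu * P.lamT j := fun j => by
      rw [hP.lam_eq]; push_cast; rfl
    have hite : ∑ j, (sg j * P.lam j : ℂ) * (if j = m then
        s.sgn * (Real.pi * profileDensity P a ρ' m s ξ j ξ : ℝ) * I else 0) =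
        sg m * P.lam m * (s.sgn * (Real.pi * profileDensity P a ρ' m s ξ m ξ : ℝ) * I) := by
      simp
    have hd : sg m * s.sgn * profileDensity P a ρ' m s ξ m ξ =
        g0 P m ξ + ρ' m + s.sgn * sg m * g1 P a ξ := by
      have h1 := s.sgn_mul_self
      have h2 := sg_mul_self m
      rw [profileDensity, div_self (absq_pos hP.k_pos hξ).ne']
      linear_combination (g0 P m ξ + ρ' m) * (sg m * sg m * h1 + h2)
    have hd' : (sg m * s.sgn * profileDensity P a ρ' m s ξ m ξ : ℂ) =
        g0 P m ξ + ρ' m + s.sgn * sg m * g1 P a ξ := by exact_mod_cast hd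
    simp only [mul_add, Finset.sum_add_distrib]
    rw [hite, profileFormula]
    push_cast
    simp only [hlam, Fin.sum_univ_two]
    linear_combination (-(I / (Real.pi * conj P.tau)) * P.mu * P.lamT m * Real.pi * I) * hd'

/-- The limit at `ξ ± i0` exists, so it may be computed along the normal. -/
theorem tendsto_profileFormula (hP : P.Admissible) {a ρ' : Fin 2 → ℝ} (hS : SolvTwo P ρ') {γ' : ℂ}
    {ω : ℂ → ℂ} (hω : ∀ ζ ∈ P.punctured, ω ζ = formulaTwo P a ρ' γ' ζ) {m : Fin 2} (s : Bank)
    {ξ : ℝ} (hξ : ξ ∈ openSlit P.k m) :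
    Tendsto ω (bankFilter s ξ) (𝓝 (profileFormula P a ρ' γ' m s ξ)) := by
  have hs := openSlit_subset P.k m hξ
  obtain ⟨w, hw⟩ := (isSlitFunction_of_formulaTwo hP hS γ' hω).boundary.1 m ξ hs s
  have h1 : Tendsto (fun ε : ℝ => ω (ξ + s.sgn * ε * I)) (𝓝[>] 0)
      (𝓝 (profileFormula P a ρ' γ' m s ξ)) := by
    refine (tendsto_formulaTwo_vertical hP a ρ' γ' s hξ).congr' ?_
    filter_upwards [(tendsto_vertical s ξ).eventually (eventually_bank_mem_punctured hP hs s)]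
      with ε hε using (hω _ hε).symm
  rwa [tendsto_nhds_unique h1 (hw.comp (tendsto_vertical s ξ))]

theorem profile_eq_closure_profileFormula (hP : P.Admissible) {a ρ' : Fin 2 → ℝ}
    (hS : SolvTwo P ρ') {γ' : ℂ} {ω : ℂ → ℂ}
    (hω : ∀ ζ ∈ P.punctured, ω ζ = formulaTwo P a ρ' γ' ζ) (m : Fin 2) :
    profile P ω m = closure {z | ∃ s, ∃ ξ ∈ openSlit P.k m, z = profileFormula P a ρ' γ' m s ξ} := by
  rw [profile_eq_closure hP.k_lt_one (isSlitFunction_of_formulaTwo hP hS γ' hω).boundary m]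
  congr 1
  ext z
  refine exists_congr fun s => exists_congr fun ξ => and_congr_right fun hξ => ?_
  rw [bankValue_eq (tendsto_profileFormula hP hS hω s hξ)]

end

end TwoSlits

end

theorem mainTheorem2 (P : Params) (hP : P.Admissible) (a d : Fin 2 → ℝ) :
    -- all integrals exist
    ((∀ j, IntegrableOn (fun ξ => 1 / absq P.k ξ) (slit P.k j)) ∧
      (∀ j, IntegrableOn (g1 P a) (slit P.k j)) ∧
      (∀ m, ∀ ξ ∈ openSlit P.k m, ∀ j,
        HasPV (fun η => densOne P a j η / absq P.k η) (slit P.k j) ξ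
          (pv (fun η => densOne P a j η / absq P.k η) (slit P.k j) ξ)) ∧
      (∀ ρ' : Fin 2 → ℝ, ∀ m s, ∀ ξ ∈ openSlit P.k m, ∀ j,
        HasPV (profileDensity P a ρ' m s ξ j) (slit P.k j) ξ
          (pv (profileDensity P a ρ' m s ξ j) (slit P.k j) ξ))) ∧
    -- the first Schwarz problem is a Riemann-Hilbert problem on the surface
    (∀ F : ℂ → ℂ, IsSchwarzOne P a F ↔
      IsRHSolution P.k (fun j _ ξ => densOne P a j ξ) (lift P.k (regularPart P P.c F)) ∧
      BoundedAtInfinities P.k (lift P.k (regularPart P P.c F))) ∧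
    -- its general solution, and when that is bounded
    (∀ Φ : ℂ × ℂ → ℂ,
      (IsRHSolution P.k (fun j _ ξ => densOne P a j ξ) Φ ∧ SimplePolesAtInfinities P.k Φ) ↔
        ∃ β₀ β₁ : ℝ, ∀ p ∈ sheetOne P.k ∪ sheetTwo P.k,
          Φ p = rhFormula P.k (fun j _ ξ => densOne P a j ξ) β₀ β₁ p) ∧
    (∀ β₀ β₁ : ℝ,
      BoundedAtInfinities P.k (rhFormula P.k (fun j _ ξ => densOne P a j ξ) β₀ β₁) ↔
        β₁ = 0 ∧ SolvOne P a) ∧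
    -- the solution of the first Schwarz problem and its values on the banks
    (∀ F : ℂ → ℂ, IsSchwarzOne P a F ↔
      SolvOne P a ∧ ∃ β₀ : ℝ, ∀ ζ ∈ P.punctured, F ζ = formulaOne P a β₀ ζ) ∧
    (∀ β₀ : ℝ, ∀ j, ∀ ξ ∈ slit P.k j, ∀ s,
      Tendsto (fun ζ => formulaOne P a β₀ ζ - P.c / (ζ - P.zInf)) (bankFilter s ξ)
        (𝓝 (((β₀ + s.sgn * sg j * g1 P a ξ : ℝ) : ℂ) + (densOne P a j ξ : ℂ) * I))) ∧
    -- the second problem, for a solution of the first one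
    ∀ (β₀ : ℝ) (F : ℂ → ℂ), SolvOne P a → (∀ ζ ∈ P.punctured, F ζ = formulaOne P a β₀ ζ) →
      ∀ ρ' : Fin 2 → ℝ, (∀ j, ρ' j = β₀ - d j) →
      -- it is a Riemann-Hilbert problem on the surface
      (∀ ω : ℂ → ℂ, IsSchwarzTwo P F d ω ↔
        IsRHSolution P.k (densTwo P a ρ')
          (lift P.k (fun ζ => I * conj P.tau * regularPart P P.cm1 ω ζ)) ∧
        BoundedAtInfinities P.k
          (lift P.k (fun ζ => I * conj P.tau * regularPart P P.cm1 ω ζ))) ∧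
      -- its general solution, and when that is bounded
      (∀ Φ : ℂ × ℂ → ℂ,
        (IsRHSolution P.k (densTwo P a ρ') Φ ∧ SimplePolesAtInfinities P.k Φ) ↔
          ∃ γ₀ γ₁ : ℝ, ∀ p ∈ sheetOne P.k ∪ sheetTwo P.k,
            Φ p = rhFormula P.k (densTwo P a ρ') γ₀ γ₁ p) ∧
      (∀ γ₀ γ₁ : ℝ, BoundedAtInfinities P.k (rhFormula P.k (densTwo P a ρ') γ₀ γ₁) ↔
        γ₁ = 0 ∧ SolvTwo P ρ') ∧
      -- the solutions of the second Schwarz problem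
      (∀ ω : ℂ → ℂ, IsSchwarzTwo P F d ω ↔
        SolvTwo P ρ' ∧ ∃ γ₀ : ℝ, ∀ ζ ∈ P.punctured,
          ω ζ = formulaTwo P a ρ' (-I * γ₀ / conj P.tau) ζ) ∧
      -- the additive constant is arbitrary up to a shift of the constants `d`
      (SolvTwo P ρ' → ∀ γ' : ℂ,
        IsSchwarzTwo P F (fun j => d j - (conj P.tau * γ').re / P.lam j)
          (formulaTwo P a ρ' γ')) ∧
      -- the values of the map on the banks, and the profiles
      ∀ (γ' : ℂ) (ω : ℂ → ℂ), SolvTwo P ρ' →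
        (∀ ζ ∈ P.punctured, ω ζ = formulaTwo P a ρ' γ' ζ) →
        (∀ m s, ∀ ξ ∈ openSlit P.k m,
          Tendsto ω (bankFilter s ξ) (𝓝 (profileFormula P a ρ' γ' m s ξ))) ∧
        (∀ m, profile P ω m =
          closure {z | ∃ s, ∃ ξ ∈ openSlit P.k m, z = profileFormula P a ρ' γ' m s ξ}) ∧
        ∀ w : ℂ, IsUnivalent P ω w →
          frontier (insert w (ω '' P.punctured)) = profile P ω 0 ∪ profile P ω 1 := by
  have hk0 := hP.k_pos
  have hk1 := hP.k_lt_one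
  have hz := hP.zInf_mem
  have hg := isTipRegular_g1 hP a
  refine ⟨⟨integrableOn_inv_absq hk0 hk1, hg.integrableOn, fun m ξ hξ j => ?_,
    fun ρ' m s ξ hξ j => (plemelj_profileDensity hP a ρ' s hξ j).1⟩, fun F => ?_, fun Φ => ?_,
    fun β₀ β₁ => ?_, isSchwarzOne_iff_formula hP a,
    fun β₀ j ξ hξ s => tendsto_formulaOne_bank hP a β₀ hξ s, ?_⟩
  · rw [densOne_eq]
    exact (plemelj_ratDens hk0 hk1 hz hξ _ _ j).1
  · rw [isSchwarzOne_iff hP, isRHSolution_lift_iff hk0 hk1, boundedAtInfinities_lift_iff hk0 hk1]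
  · rw [densOne_eq_bankDens P a (g1 P a)]
    exact rh_general_solution_rhFormula hk0 hk1 hz hg Φ
  · rw [densOne_eq_bankDens P a (g1 P a), boundedAtInfinities_rhFormula_iff hk0 hk1 hz hg,
      moment_eq_zero_iff_solvOne hP]
  intro β₀ F _ hF ρ' hρ
  obtain rfl : ρ' = fun j => β₀ - d j := funext hρ
  refine ⟨fun ω => ?_, fun Φ => ?_, fun γ₀ γ₁ => ?_, isSchwarzTwo_iff_formula hP hF d,
    fun hS γ' => isSchwarzTwo_of_formulaTwo hP hF d hS γ' fun _ _ => rfl, fun γ' ω hS hω => ?_⟩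
  · rw [isSchwarzTwo_iff hP hF, isRHSolution_lift_iff hk0 hk1,
      boundedAtInfinities_lift_iff hk0 hk1]
  · rw [densTwo_eq_bankDens]
    exact rh_general_solution_rhFormula hk0 hk1 hz hg Φ
  · rw [densTwo_eq_bankDens, boundedAtInfinities_rhFormula_iff hk0 hk1 hz hg,
      moment_eq_zero_iff_solvTwo hP]
  · exact ⟨fun m s ξ hξ => tendsto_profileFormula hP hS hω s hξ,
      profile_eq_closure_profileFormula hP hS hω,
      fun w hw => frontier_insert_image hP hP.cm1_ne (isSlitFunction_of_formulaTwo hP hS γ' hω) hw⟩
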